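/- For integers $2\le k\le n$ and probability distributions $p,q$ on the ordered set $[n]=\{1,\dots,n\}$ let $$\|q-p\|_{\mathcal A_k}=\max_{I_1,\dots,I_k}\ \sum_{j=1}^k |q(I_j)-p(I_j)|,$$ the maximum being over all partitions of $[n]$ into $k$ (nonempty) intervals $I_1,\dots,I_k$. (Upper bound.) There are absolute constants $C,c>0$, a polynomial $P$ and one randomized algorithm (a program for a random access machine with logarithmic cost that can toss fair coins and request independent samples from an unknown distribution $q$ on $[n]$) with the following property. Let $2\le k\le n$, let $\varepsilon>0$ be real, and let $p$ be a distribution on $[n]$. The input consists of $n$, $k$, a fraction $a/b$ with $\varepsilon/2\le a/b\le\varepsilon$, and nonnegative integers $N>0,\alpha_1,\dots,\alpha_n$ with $|\alpha_i/N-p_i|\le c\,\varepsilon^2/(n\sqrt k)$ for all $i$ (so rational $\varepsilon$ and rational $p$ may be given exactly, and arbitrary ones by sufficiently accurate approximations). Then, for all outcomes of the samples and coins, the algorithm halts within $P(L+\lceil 1/\varepsilon\rceil)$ steps, where $L$ is the bit length of the input, and draws at most $C\sqrt k/\varepsilon^2$ samples. If $q=p$, it answers "YES" with probability at least $2/3$;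 if $\|q-p\|_{\mathcal A_k}\ge\varepsilon$, it answers "NO" with probability at least $2/3$. (Lower bound.) There is an absolute constant $c'>0$ such that for all $2\le k\le n$ there is a distribution $p$ on $[n]$ with the following property. For all $0<\varepsilon\le 1$ and every $m\ge0$: if some randomized procedure (with no computational restriction, and allowed to depend on $n,k,\varepsilon,p$), given $m$ independent samples from an unknown distribution $q$ on $[n]$, answers "YES" with probability at least $2/3$ when $q=p$ and "NO" with probability at least $2/3$ whenever $\|q-p\|_{\mathcal A_k}\ge\varepsilon$, then $m\ge c'\sqrt k/\varepsilon^2$. -/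

import Mathlib

open MeasureTheory

/-- The `𝒜_k`-distance of two distributions on the ordered domain `Fin n`: the maximum, over all
partitions of the domain into exactly `k` (nonempty) intervals, of the `L₁`-distance of the
reduced distributions. (For `1 ≤ k ≤ n` the supremum is over a nonempty finite family.) -/
noncomputable def akDist {n : ℕ} (k : ℕ) (p q : PMF (Fin n)) : ℝ :=
  ⨆ I : {I : Finpartition (Finset.univ : Finset (Fin n)) //
      I.parts.card = k ∧ ∀ J ∈ I.parts, (J : Set (Fin n)).OrdConnected},
    ∑ J ∈ I.1.parts, |(∑ i ∈ J, (p i).toReal) - ∑ i ∈ J, (q i).toReal|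

/-! ### Random access machines with logarithmic cost, sample access and coin tosses -/

/-- Arithmetic operations of the machine, on natural numbers. Subtraction is truncated, division
is rounded down. -/
inductive Op
  | add | sub | mul | div

def Op.eval : Op → ℕ → ℕ → ℕ
  | .add, x, y => x + y
  | .sub, x, y => x - y
  | .mul, x, y => x * y
  | .div, x, y => x / y

/-- Programs of a random access machine with registers `R 0, R 1, …` and a memory
`M 0, M 1, …`, all holding natural numbers. -/
inductive Com
  /-- do nothing -/
  | skip
  /-- `R x := v` -/
  | const (x v : ℕ)
  /-- `R x := op (R y) (R z)` -/
  | arith (op : Op) (x y z : ℕ)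
  /-- `R x := M (R y)` -/
  | load (x y : ℕ)
  /-- `M (R x) := R y` -/
  | store (x y : ℕ)
  /-- `R x :=` a fresh sample from the unknown distribution -/
  | sample (x : ℕ)
  /-- `R x :=` a fresh fair random bit -/
  | flip (x : ℕ)
  /-- first `A`, then `B` -/
  | seq (A B : Com)
  /-- if `R x ≤ R y` then `A` else `B` -/
  | ite (x y : ℕ) (A B : Com)
  /-- while `R x < R y` do `A` -/
  | loop (x y : ℕ) (A : Com)

/-- A state of the machine: the contents of registers and memory, and the numbers of samples
and of random bits used so far. -/
structure State where
  reg : ℕ → ℕ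
  mem : ℕ → ℕ
  drawn : ℕ
  flipped : ℕ

/-- Write `v` to register `x`. -/
def State.setReg (σ : State) (x v : ℕ) : State :=
  { σ with reg := Function.update σ.reg x v }

/-- Write `v` to memory cell `x`. -/
def State.setMem (σ : State) (x v : ℕ) : State :=
  { σ with mem := Function.update σ.mem x v }

/-- The state in which a machine starts on the input `l`: the input is in the memory, and
everything else is zero. -/
def State.init (l : List ℕ) : State where
  reg := fun _ => 0
  mem := fun j => l.getD j 0
  drawn := 0
  flipped := 0

/-- `Exec s r A σ t τ`: when the samples are `s 0, s 1, …` and the random bits are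
`r 0, r 1, …`, the program `A`, started in state `σ`, halts in state `τ` after time `t`. Each
elementary step is charged by one plus the bit lengths of the numbers that it reads (the
logarithmic cost criterion). -/
inductive Exec (s : ℕ → ℕ) (r : ℕ → Bool) : Com → State → ℕ → State → Prop
  | skip (σ : State) : Exec s r .skip σ 1 σ
  | const (x v : ℕ) (σ : State) :
      Exec s r (.const x v) σ (1 + v.size) (σ.setReg x v)
  | arith (op : Op) (x y z : ℕ) (σ : State) :
      Exec s r (.arith op x y z) σ (1 + (σ.reg y).size + (σ.reg z).size)
        (σ.setReg x (op.eval (σ.reg y) (σ.reg z)))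
  | load (x y : ℕ) (σ : State) :
      Exec s r (.load x y) σ (1 + (σ.reg y).size + (σ.mem (σ.reg y)).size)
        (σ.setReg x (σ.mem (σ.reg y)))
  | store (x y : ℕ) (σ : State) :
      Exec s r (.store x y) σ (1 + (σ.reg x).size + (σ.reg y).size)
        (σ.setMem (σ.reg x) (σ.reg y))
  | sample (x : ℕ) (σ : State) :
      Exec s r (.sample x) σ (1 + (s σ.drawn).size)
        { σ.setReg x (s σ.drawn) with drawn := σ.drawn + 1 }
  | flip (x : ℕ) (σ : State) :
      Exec s r (.flip x) σ 2
        { σ.setReg x (r σ.flipped).toNat with flipped := σ.flipped + 1 }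
  | seq {A B : Com} {σ τ υ : State} {t u : ℕ} :
      Exec s r A σ t τ → Exec s r B τ u υ → Exec s r (.seq A B) σ (t + u) υ
  | iteTrue {x y : ℕ} {A B : Com} {σ τ : State} {t : ℕ} :
      σ.reg x ≤ σ.reg y → Exec s r A σ t τ →
      Exec s r (.ite x y A B) σ (1 + (σ.reg x).size + (σ.reg y).size + t) τ
  | iteFalse {x y : ℕ} {A B : Com} {σ τ : State} {t : ℕ} :
      ¬ σ.reg x ≤ σ.reg y → Exec s r B σ t τ →
      Exec s r (.ite x y A B) σ (1 + (σ.reg x).size + (σ.reg y).size + t) τ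
  | loopTrue {x y : ℕ} {A : Com} {σ τ υ : State} {t u : ℕ} :
      σ.reg x < σ.reg y → Exec s r A σ t τ → Exec s r (.loop x y A) τ u υ →
      Exec s r (.loop x y A) σ (1 + (σ.reg x).size + (σ.reg y).size + t + u) υ
  | loopFalse {x y : ℕ} {A : Com} {σ : State} :
      ¬ σ.reg x < σ.reg y →
      Exec s r (.loop x y A) σ (1 + (σ.reg x).size + (σ.reg y).size) σ

/-- On input `l`, samples `s` and random bits `r`, the program `A` halts and says "YES",
by leaving the number `1` in register `0`. -/
def SaysYes {n : ℕ} (A : Com) (l : List ℕ) (s : ℕ → Fin n) (r : ℕ → Bool) : Prop :=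
  ∃ t τ, Exec (fun j => (s j : ℕ)) r A (State.init l) t τ ∧ τ.reg 0 = 1

/-- On input `l`, samples `s` and random bits `r`, the program `A` halts and says "NO",
by leaving another number than `1` in register `0`. -/
def SaysNo {n : ℕ} (A : Com) (l : List ℕ) (s : ℕ → Fin n) (r : ℕ → Bool) : Prop :=
  ∃ t τ, Exec (fun j => (s j : ℕ)) r A (State.init l) t τ ∧ τ.reg 0 ≠ 1

/-- On input `l`, whatever the samples from `Fin n` and the random bits are, the program `A` halts
within time `T` and draws at most `m` samples. -/
def RunsWithin (n : ℕ) (A : Com) (l : List ℕ) (T : ℕ) (m : ℝ) : Prop :=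
  ∀ (s : ℕ → Fin n) (r : ℕ → Bool),
    ∃ t τ, Exec (fun j => (s j : ℕ)) r A (State.init l) t τ ∧ t ≤ T ∧ (τ.drawn : ℝ) ≤ m

/-- The joint law of infinitely many independent samples from `q` and infinitely many fair random
bits, all independent. -/
noncomputable def runLaw {n : ℕ} (q : PMF (Fin n)) : Measure ((ℕ → Fin n) × (ℕ → Bool)) :=
  (Measure.infinitePi fun _ : ℕ => q.toMeasure).prod
    (Measure.infinitePi fun _ : ℕ => (PMF.uniformOfFintype Bool).toMeasure)

/-! ### Inputs of an identity tester -/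

/-- The input of a tester: the domain size `n`, the parameter `k`, a fraction `a / b` that stands
for `ε`, and the fractions `α i / N` that stand for the probabilities `p i`. -/
def testerInput {n : ℕ} (k a b N : ℕ) (α : Fin n → ℕ) : List ℕ :=
  [n, k, a, b, N] ++ List.ofFn α

/-- The length of an input in bits (with one separator after each number). -/
def bitLength (l : List ℕ) : ℕ :=
  (l.map fun x => x.size + 1).sum

/-- The fractions `a / b` and `α i / N` describe `ε` and the explicit distribution `p`: the former is
`ε` up to a factor of two, and the latter are the `p i` up to an additive error `η`. Rational
parameters may be described exactly. -/
structure Describes {n : ℕ} (η ε : ℝ) (p : PMF (Fin n)) (a b N : ℕ) (α : Fin n → ℕ) : Prop where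
  eps_ge : (a : ℝ) / b ≤ ε
  eps_le : ε ≤ 2 * ((a : ℝ) / b)
  pos : 0 < N
  close : ∀ i, |(α i : ℝ) / N - (p i).toReal| ≤ η

/-! ### Testers without computational restrictions -/

/-- `f` is an arbitrary randomized identity tester for `p` in `𝒜_k`-distance `ε` from `m` samples;
`f s` is the probability with which it says "YES" when the samples are `s`. -/
structure IsTester {n : ℕ} (k : ℕ) (ε : ℝ) (p : PMF (Fin n)) (m : ℕ)
    (f : (Fin m → Fin n) → ℝ) : Prop where
  mem_Icc : ∀ s, f s ∈ Set.Icc (0 : ℝ) 1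
  complete : 2 / 3 ≤ ∫ s, f s ∂(Measure.pi fun _ : Fin m => p.toMeasure)
  sound : ∀ q : PMF (Fin n), ε ≤ akDist k q p →
    2 / 3 ≤ ∫ s, (1 - f s) ∂(Measure.pi fun _ : Fin m => q.toMeasure)

/-! Upper bound. Give each atom a subinterval of [0,1] of length proportional to its weight and
spread its q-mass evenly over it; if q is given by the weights, the result is uniform. Cut [0,1]
into ℓ = k·16^j equal cells for j = 0, …, N-1, where N is least with 16^N·a ≥ 256·b. The deficit of
a cell is 1/ℓ minus its q-mass, and the energy of q is Σ_j 2^j Σ_c deficit².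

If the distance is at least ε, there are at most k disjoint blocks of consecutive atoms on which q
misses mass ε/2 in total (`exists_blocks`). Apart from its two ends, a block is tiled by maximal
cells, at most 32 on each level after the coarsest. Cauchy–Schwarz within the levels, and then
across them with weights 2^(-j) and 2^j, bounds the missing mass by √(64·k·energy) plus a small
error (`sum_le_of_blocks`). Only an upper bound on the q-mass inside the cells is used, so heavy
atoms of q at the ends of a block do no harm. Hence the energy is at least of order ε²/k, while for
q = p it is a small fraction of that (`le_roundedEnergy`, `roundedEnergy_le`).

The energy, computed from rounded fractions, is the squared norm of the mean of a centered feature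
vector. The sum of the inner products over ordered pairs of distinct samples therefore has mean
m(m-1) times the energy. Its variance is controlled by the Hilbert–Schmidt norm of the covariance
(`sampleMean_pairSum_sub_sq_le`), whose square is at most 8/k + 4·4^(N-1)·energy
(`sum_inner_feature_sq_le`). For m of order √k/ε², Chebyshev's inequality separates the two cases
(`sampleMean_deviation_le`).

The program evaluates this statistic in natural numbers and tosses no coins. Hoare triples with time
bounds prove it correct; all numbers that it reads have O(Y) bits for Y = L + ⌈1/ε⌉
(`Sized.bounds`).

Lower bound. Let p be uniform on the first 2⌊k/2⌋ elements, and perturb its consecutive pairs by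
relative amounts ±ε with random signs. With singletons as parts, each perturbation is at distance ε.
The averaged likelihood ratio of m samples has second moment at most exp(m²ε⁴/(2h)), h = ⌊k/2⌋,
whereas a successful test forces it to be at least 10/9 (`le_exp_of_separates`). -/

section Machine

/-! ### Hoare triples with time bounds -/

/-- Started in a state satisfying `Pre`, the program `A` halts within time `T` in a state
satisfying `Post`. -/
def Triple (s : ℕ → ℕ) (r : ℕ → Bool) (Pre : State → Prop) (A : Com) (T : ℕ)
    (Post : State → Prop) : Prop :=
  ∀ σ, Pre σ → ∃ t τ, Exec s r A σ t τ ∧ t ≤ T ∧ Post τ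

/-- Sequential composition of a list of programs. -/
def Com.block : List Com → Com
  | [] => .skip
  | A :: l => .seq A (Com.block l)

/-- The weakest precondition of a list of elementary steps, including that all numbers which are
read are at most `X`. -/
def wp (s : ℕ → ℕ) (X : ℕ) : List Com → State → (State → Prop) → Prop
  | [], σ, Q => Q σ
  | .const x v :: l, σ, Q => v ≤ X ∧ wp s X l (σ.setReg x v) Q
  | .arith op x y z :: l, σ, Q =>
      σ.reg y ≤ X ∧ σ.reg z ≤ X ∧ wp s X l (σ.setReg x (op.eval (σ.reg y) (σ.reg z))) Q
  | .load x y :: l, σ, Q =>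
      σ.reg y ≤ X ∧ σ.mem (σ.reg y) ≤ X ∧ wp s X l (σ.setReg x (σ.mem (σ.reg y))) Q
  | .store x y :: l, σ, Q =>
      σ.reg x ≤ X ∧ σ.reg y ≤ X ∧ wp s X l (σ.setMem (σ.reg x) (σ.reg y)) Q
  | .sample x :: l, σ, Q =>
      s σ.drawn ≤ X ∧
        wp s X l { σ.setReg x (s σ.drawn) with drawn := σ.drawn + 1 } Q
  | _ :: _, _, _ => False

/-- The largest cost of an elementary step that reads numbers up to `X`. -/
def stepCost (X : ℕ) : ℕ := 1 + 2 * X.size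

variable {s : ℕ → ℕ} {r : ℕ → Bool} {X : ℕ}

/-- The extra unit in `l.length + 1` pays for the `skip` that ends every block. -/
theorem exec_block_of_wp {l : List Com} {σ : State} {Q : State → Prop} (h : wp s X l σ Q) :
    ∃ t τ, Exec s r (Com.block l) σ t τ ∧ t ≤ (l.length + 1) * stepCost X ∧ Q τ := by
  induction l generalizing σ with
  | nil => exact ⟨1, σ, .skip σ, by simp [stepCost], h⟩
  | cons A l ih =>
    have key : ∀ t₁ σ₁, Exec s r A σ t₁ σ₁ → t₁ ≤ stepCost X → wp s X l σ₁ Q →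
        ∃ t τ, Exec s r (Com.block (A :: l)) σ t τ ∧
          t ≤ ((A :: l).length + 1) * stepCost X ∧ Q τ := by
      intro t₁ σ₁ h₁ ht₁ h₂
      obtain ⟨t, τ, he, ht, hQ⟩ := ih h₂
      refine ⟨t₁ + t, τ, .seq h₁ he, ?_, hQ⟩
      rw [List.length_cons, add_mul _ 1 (stepCost X)]
      omega
    have hs : ∀ {a}, a ≤ X → a.size ≤ X.size := fun h => Nat.size_le_size h
    cases A with
    | const x v =>
      have := hs h.1
      exact key _ _ (.const x v σ) (by unfold stepCost; omega) h.2
    | arith op x y z =>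
      have := hs h.1
      have := hs h.2.1
      exact key _ _ (.arith op x y z σ) (by unfold stepCost; omega) h.2.2
    | load x y =>
      have := hs h.1
      have := hs h.2.1
      exact key _ _ (.load x y σ) (by unfold stepCost; omega) h.2.2
    | store x y =>
      have := hs h.1
      have := hs h.2.1
      exact key _ _ (.store x y σ) (by unfold stepCost; omega) h.2.2
    | sample x =>
      have := hs h.1
      exact key _ _ (.sample x σ) (by unfold stepCost; omega) h.2
    | skip => exact h.elim
    | flip x => exact h.elim
    | seq A B => exact h.elim
    | ite x y A B => exact h.elim
    | loop x y A => exact h.elim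

theorem Triple.block {l : List Com} {Pre Post : State → Prop}
    (h : ∀ σ, Pre σ → wp s X l σ Post) :
    Triple s r Pre (Com.block l) ((l.length + 1) * stepCost X) Post :=
  fun σ hσ => exec_block_of_wp (h σ hσ)

theorem Triple.seq {P Q R : State → Prop} {A B : Com} {T U : ℕ} (hA : Triple s r P A T Q)
    (hB : Triple s r Q B U R) : Triple s r P (.seq A B) (T + U) R := by
  intro σ hσ
  obtain ⟨t, τ, h₁, ht, hQ⟩ := hA σ hσ
  obtain ⟨u, υ, h₂, hu, hR⟩ := hB τ hQ
  exact ⟨t + u, υ, .seq h₁ h₂, add_le_add ht hu, hR⟩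

theorem Triple.mono {P P' Q Q' : State → Prop} {A : Com} {T T' : ℕ} (h : Triple s r P A T Q)
    (hP : ∀ σ, P' σ → P σ) (hT : T ≤ T') (hQ : ∀ σ, Q σ → Q' σ) : Triple s r P' A T' Q' := by
  intro σ hσ
  obtain ⟨t, τ, h₁, ht, hq⟩ := h σ (hP σ hσ)
  exact ⟨t, τ, h₁, ht.trans hT, hQ τ hq⟩

theorem Triple.ite {P Q : State → Prop} {A B : Com} {x y T : ℕ}
    (hX : ∀ σ, P σ → σ.reg x ≤ X ∧ σ.reg y ≤ X)
    (hA : Triple s r (fun σ => P σ ∧ σ.reg x ≤ σ.reg y) A T Q)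
    (hB : Triple s r (fun σ => P σ ∧ ¬ σ.reg x ≤ σ.reg y) B T Q) :
    Triple s r P (.ite x y A B) (stepCost X + T) Q := by
  intro σ hσ
  have h₁ := Nat.size_le_size (hX σ hσ).1
  have h₂ := Nat.size_le_size (hX σ hσ).2
  by_cases h : σ.reg x ≤ σ.reg y
  · obtain ⟨t, τ, he, ht, hq⟩ := hA σ ⟨hσ, h⟩
    exact ⟨_, τ, .iteTrue h he, by unfold stepCost; omega, hq⟩
  · obtain ⟨t, τ, he, ht, hq⟩ := hB σ ⟨hσ, h⟩
    exact ⟨_, τ, .iteFalse h he, by unfold stepCost; omega, hq⟩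

/-- A loop with invariant `Inv i` before the `i`-th of `N` rounds. -/
theorem Triple.loop {Inv : ℕ → State → Prop} {A : Com} {x y N T : ℕ}
    (hX : ∀ i ≤ N, ∀ σ, Inv i σ → σ.reg x ≤ X ∧ σ.reg y ≤ X)
    (hguard : ∀ i ≤ N, ∀ σ, Inv i σ → (σ.reg x < σ.reg y ↔ i < N))
    (hbody : ∀ i < N, Triple s r (Inv i) A T (Inv (i + 1))) :
    Triple s r (Inv 0) (.loop x y A) (N * (stepCost X + T) + stepCost X) (Inv N) := by
  -- Induction on the number `d` of remaining rounds. Every round pays for its guard, and the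
  -- failing guard costs one more step.
  have key : ∀ d i, i + d = N →
      Triple s r (Inv i) (.loop x y A) (d * (stepCost X + T) + stepCost X) (Inv N) := by
    intro d
    induction d with
    | zero =>
      intro i hi σ hσ
      obtain rfl : i = N := by omega
      have h₁ := Nat.size_le_size (hX i le_rfl σ hσ).1
      have h₂ := Nat.size_le_size (hX i le_rfl σ hσ).2
      refine ⟨_, σ, .loopFalse ?_, by unfold stepCost; omega, hσ⟩
      rw [hguard i le_rfl σ hσ]
      exact lt_irrefl i
    | succ d ih =>
      intro i hi σ hσ
      have hiN : i < N := by omega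
      have h₁ := Nat.size_le_size (hX i hiN.le σ hσ).1
      have h₂ := Nat.size_le_size (hX i hiN.le σ hσ).2
      obtain ⟨t, τ, he, ht, hτ⟩ := hbody i hiN σ hσ
      obtain ⟨u, υ, he', hu, hυ⟩ := ih (i + 1) (by omega) τ hτ
      refine ⟨_, υ, .loopTrue ((hguard i hiN.le σ hσ).2 hiN) he he', ?_, hυ⟩
      rw [add_mul d 1]
      unfold stepCost at *
      omega
  exact key N 0 (by omega)

/-- Fixing the initial state allows intermediate assertions to refer to its contents, for instance
to a memory that the program leaves alone. -/
theorem Triple.of_forall {P Q : State → Prop} {A : Com} {T : ℕ}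
    (h : ∀ σ₀, P σ₀ → Triple s r (fun σ => σ = σ₀) A T Q) : Triple s r P A T Q :=
  fun σ hσ => h σ hσ σ rfl

/-! ### The statistic in natural numbers -/

/-- The part of the interval `[u, v)` below `h`. -/
def below (u v h : ℕ) : ℕ := (h - u) - (h - v)

/-- The squared distance of two natural numbers. -/
def sqDist (x y : ℕ) : ℕ := ((x - y) + (y - x)) * ((x - y) + (y - x))

/-- The parameters of an instance: the domain size, the number of intervals, the two parts of the
fraction that stands for the accuracy, and the weights of the domain elements. -/
structure Params where
  n : ℕ
  k : ℕ
  a : ℕ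
  b : ℕ
  weight : ℕ → ℕ

namespace Params

variable (I : Params)

/-- The sum of the first `x` weights. -/
def cum (x : ℕ) : ℕ := ∑ i ∈ Finset.range x, I.weight i

/-- The total weight. -/
def total : ℕ := I.cum I.n

/-- The least number whose square is at least `k` (for `0 < k`). -/
def root : ℕ := Nat.sqrt (I.k - 1) + 1

/-- The number of samples. -/
def draws : ℕ := 10 ^ 8 * I.root * (I.b * I.b) / (I.a * I.a) + 1

/-- The resolution with which the fractions of atoms in cells are rounded. -/
def scale : ℕ := 1024 * I.b

/-- The overlap of the atom `x` with the cell `c` among `ℓ` cells, in units in which the atom has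
length `ℓ * weight x`. -/
def overlap (ℓ c x : ℕ) : ℕ :=
  below (I.cum x * ℓ) (I.cum (x + 1) * ℓ) (c * I.total + I.total) -
    below (I.cum x * ℓ) (I.cum (x + 1) * ℓ) (c * I.total)

/-- The rounded fraction of the atom `x` in the cell `c` among `ℓ` cells, relative to `1 / ℓ`. -/
def share (ℓ c x : ℕ) : ℕ :=
  I.overlap ℓ c x * I.scale / (I.cum (x + 1) - I.cum x)

/-- The squared deviation of the total share of the samples from its mean. -/
def cellSq (ℓ : ℕ) (y : ℕ → ℕ) (c : ℕ) : ℕ :=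
  sqDist (∑ i ∈ Finset.range I.draws, I.share ℓ c (y i)) (I.draws * I.scale)

/-- The diagonal part of the squared deviation, for one sample. -/
def sampleDiag (ℓ : ℕ) (y : ℕ → ℕ) (c i : ℕ) : ℕ := sqDist (I.share ℓ c (y i)) I.scale

/-- The accumulated squared deviations of the first levels. -/
def accSq (y : ℕ → ℕ) : ℕ → ℕ
  | 0 => 0
  | j + 1 => 128 * accSq y j + ∑ c ∈ Finset.range (I.k * 16 ^ j), I.cellSq (I.k * 16 ^ j) y c

/-- The accumulated diagonal parts of the first levels, together with the threshold. -/
def accDiag (y : ℕ → ℕ) : ℕ → ℕ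
  | 0 => I.k * (I.a * I.a) * (I.draws * (I.draws - 1))
  | j + 1 => 128 * accDiag y j + ∑ c ∈ Finset.range (I.k * 16 ^ j),
      ∑ i ∈ Finset.range I.draws, I.sampleDiag (I.k * 16 ^ j) y c i

/-- The premise `0 < I.a` stands inside the statement so that the search in `levels` makes sense for
every instance; for `I.a = 0` it returns 0. -/
theorem exists_levels : ∃ j, 0 < I.a → ¬ 16 ^ j * I.a < 256 * I.b :=
  ⟨256 * I.b, fun h => by
    have := (Nat.lt_pow_self (n := 256 * I.b) (a := 16) (by norm_num))
    nlinarith⟩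

/-- The number of levels. -/
noncomputable def levels : ℕ := by
  classical exact Nat.find I.exists_levels

/-- The guard of the outer loop is monotone in `j`, so it holds in exactly the first `levels`
rounds. -/
theorem lt_levels_iff (ha : 0 < I.a) (j : ℕ) : j < I.levels ↔ 16 ^ j * I.a < 256 * I.b := by
  classical
  unfold levels
  rw [Nat.lt_find_iff]
  constructor
  · intro h
    simpa [ha] using h j le_rfl
  · intro h i hi h'
    refine h' ha (lt_of_le_of_lt ?_ h)
    exact Nat.mul_le_mul_right _ (Nat.pow_le_pow_right (by norm_num) hi)

/-- A number that bounds the intermediate results of the cells. -/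
noncomputable def cellBound : ℕ :=
  I.draws * (I.total * (I.k * 16 ^ I.levels) * I.scale)

end Params

/-! ### The program -/

open Com in
/-- Add the contribution of one sample in one cell. -/
def sampleBody : List Com :=
  [arith .add 18 15 30, load 18 18, arith .add 15 15 27, arith .add 18 18 31, load 19 18,
    arith .add 18 18 27, load 20 18, arith .sub 21 20 19, arith .mul 19 19 7, arith .mul 20 20 7,
    arith .sub 22 14 19, arith .sub 23 14 20, arith .sub 22 22 23,
    arith .sub 23 13 19, arith .sub 24 13 20, arith .sub 23 23 24,
    arith .sub 22 22 23, arith .mul 22 22 25, arith .div 22 22 21, arith .add 17 17 22,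
    arith .sub 23 22 25, arith .sub 24 25 22, arith .add 23 23 24, arith .mul 23 23 23,
    arith .add 11 11 23]

/-- Registers hold given values. -/
def Regs (l : List (ℕ × ℕ)) (σ : State) : Prop := ∀ p ∈ l, σ.reg p.1 = p.2

/-- The state in the main part of the program: the constants, the partial sums of the weights, and
the samples `y`. -/
structure Core (I : Params) (y : ℕ → ℕ) (σ : State) : Prop where
  regs : Regs [(0, 0), (2, I.k), (5, I.draws), (6, I.total), (9, 256 * I.b), (25, I.scale),
    (26, I.draws * I.scale), (27, 1), (28, 16), (29, 128), (30, 5 + I.n), (31, 4)] σ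
  cum : ∀ x ≤ I.n, σ.mem (x + 4) = I.cum x
  samples : ∀ i < I.draws, σ.mem (i + (5 + I.n)) = y i
  drawn : σ.drawn = I.draws

/-! ### Bounds on intermediate values and correctness of the main loops -/

theorem below_le (u v h : ℕ) : below u v h ≤ h := by unfold below; omega

theorem sqDist_le {x y z : ℕ} (hx : x ≤ z) (hy : y ≤ z) : sqDist x y ≤ z * z :=
  Nat.mul_le_mul (by omega) (by omega)

theorem Params.cum_mono (I : Params) {x y : ℕ} (h : x ≤ y) : I.cum x ≤ I.cum y :=
  Finset.sum_le_sum_of_subset (Finset.range_subset_range.2 h)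

theorem Params.overlap_le (I : Params) (ℓ c x : ℕ) :
    I.overlap ℓ c x ≤ c * I.total + I.total :=
  (Nat.sub_le _ _).trans (below_le _ _ _)

theorem Params.share_le (I : Params) {ℓ c : ℕ} (hc : c < ℓ) (x : ℕ) :
    I.share ℓ c x ≤ I.total * ℓ * I.scale := by
  refine (Nat.div_le_self _ _).trans (Nat.mul_le_mul_right _ ((I.overlap_le ℓ c x).trans ?_))
  calc c * I.total + I.total = I.total * (c + 1) := by ring
    _ ≤ I.total * ℓ := Nat.mul_le_mul_left _ hc

/-- Assumptions under which `X` bounds all numbers that occur in the main part. -/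
structure Params.Bounds (I : Params) (y : ℕ → ℕ) (X : ℕ) : Prop where
  total_pos : 0 < I.total
  b_pos : 0 < I.b
  addresses : I.draws + I.n + 200 ≤ X
  cells : 4 * (I.cellBound * I.cellBound) ≤ X
  counters : I.k * 16 ^ I.levels ≤ X
  guard : 256 * I.b ≤ X
  time : 16 ^ I.levels * I.a ≤ X
  accSq : I.accSq y I.levels ≤ X
  accDiag : I.accDiag y I.levels ≤ X

theorem Params.le_cellBound (I : Params) {ℓ : ℕ}
    (hℓ : ℓ ≤ I.k * 16 ^ I.levels) : I.draws * (I.total * ℓ * I.scale) ≤ I.cellBound := by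
  unfold Params.cellBound
  gcongr

theorem Params.draws_pos (I : Params) : 0 < I.draws := Nat.succ_pos _

theorem Params.Bounds.scale_pos {I : Params} {y : ℕ → ℕ} (h : I.Bounds y X) : 0 < I.scale := by
  have := h.b_pos
  unfold Params.scale
  omega

/-- Symbolic execution: `wp` leaves one size bound for every operand that is read, and the final
contents of the registers. The size bounds follow linearly from the product estimates collected
first. -/
theorem sampleBody_triple (I : Params) (y : ℕ → ℕ) (hB : I.Bounds y X)
    (hy : ∀ i < I.draws, y i < I.n) {ℓ c i : ℕ} (hc : c < ℓ)
    (hi : i < I.draws) (t Q N₀ : ℕ) (hℓ : ℓ ≤ I.k * 16 ^ I.levels)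
    (hN : N₀ + ∑ i' ∈ Finset.range (i + 1), I.sampleDiag ℓ y c i' ≤ X) :
    Triple s r
      (fun σ => Core I y σ ∧ Regs [(7, ℓ), (8, t), (10, Q),
        (11, N₀ + ∑ i' ∈ Finset.range i, I.sampleDiag ℓ y c i'),
        (12, c), (13, c * I.total), (14, c * I.total + I.total), (15, i),
        (17, ∑ i' ∈ Finset.range i, I.share ℓ c (y i'))] σ)
      (Com.block sampleBody) (26 * stepCost X)
      (fun σ => Core I y σ ∧ Regs [(7, ℓ), (8, t), (10, Q),
        (11, N₀ + ∑ i' ∈ Finset.range (i + 1), I.sampleDiag ℓ y c i'),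
        (12, c), (13, c * I.total), (14, c * I.total + I.total), (15, i + 1),
        (17, ∑ i' ∈ Finset.range (i + 1), I.share ℓ c (y i'))] σ) := by
  refine Triple.block (l := sampleBody) ?_
  rintro σ ⟨⟨h₁, h₂, h₃, h₄⟩, h₅⟩
  have hs := h₃ i hi
  have hc₀ := h₂ (y i) (hy i hi).le
  have hc₁ := h₂ (y i + 1) (hy i hi)
  rw [show y i + 1 + 4 = y i + 4 + 1 by omega] at hc₁
  have hyi := hy i hi
  have hadd := hB.addresses
  have hcell := hB.cells
  have hscale := hB.scale_pos
  have htot := hB.total_pos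
  have hCB : I.cellBound ≤ I.cellBound * I.cellBound := Nat.le_mul_self _
  have hb := I.le_cellBound hℓ
  have hm := I.draws_pos
  have h0 : I.total * ℓ * I.scale ≤ I.draws * (I.total * ℓ * I.scale) := Nat.le_mul_of_pos_left _ hm
  have h1 : I.total * ℓ ≤ I.total * ℓ * I.scale := Nat.le_mul_of_pos_right _ hscale
  have h2 : I.scale ≤ I.total * ℓ * I.scale :=
    Nat.le_mul_of_pos_left _ (Nat.mul_pos htot (by omega))
  have h3 : ℓ ≤ I.total * ℓ := Nat.le_mul_of_pos_left _ htot
  have h4 : I.cum (y i) ≤ I.total := I.cum_mono hyi.le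
  have h5 : I.cum (y i + 1) ≤ I.total := I.cum_mono hyi
  have h6 : I.cum (y i) * ℓ ≤ I.total * ℓ := Nat.mul_le_mul_right _ h4
  have h7 : I.cum (y i + 1) * ℓ ≤ I.total * ℓ := Nat.mul_le_mul_right _ h5
  have h8 : c * I.total + I.total ≤ I.total * ℓ := by
    calc c * I.total + I.total = I.total * (c + 1) := by ring
      _ ≤ I.total * ℓ := Nat.mul_le_mul_left _ hc
  have h9 : I.total ≤ I.total * ℓ := Nat.le_mul_of_pos_right _ (by omega)
  have h10 := I.share_le hc (y i)
  have h11 : I.overlap ℓ c (y i) * I.scale ≤ I.total * ℓ * I.scale :=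
    Nat.mul_le_mul_right _ ((I.overlap_le ℓ c (y i)).trans h8)
  have h12 : ∀ j ≤ I.draws, ∑ i' ∈ Finset.range j, I.share ℓ c (y i') ≤
      I.draws * (I.total * ℓ * I.scale) := by
    intro j hj
    calc _ ≤ ∑ _i' ∈ Finset.range j, I.total * ℓ * I.scale :=
          Finset.sum_le_sum fun i' _ => I.share_le hc (y i')
      _ ≤ _ := by
          rw [Finset.sum_const, Finset.card_range, smul_eq_mul]
          exact Nat.mul_le_mul_right _ hj
  have h13 := h12 i hi.le
  have h14 : I.sampleDiag ℓ y c i ≤ X := by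
    refine (sqDist_le (h10.trans (h0.trans hb)) (h2.trans (h0.trans hb))).trans ?_
    omega
  have h16 := hN
  rw [Finset.sum_range_succ] at h16
  -- The definitions of `overlap`, `share` and `sqDist` use the truncated operations of the program
  -- in the same order, so the contents of the registers agree with them by `rfl`.
  have hov : c * I.total + I.total - I.cum (y i) * ℓ -
      (c * I.total + I.total - I.cum (y i + 1) * ℓ) -
      (c * I.total - I.cum (y i) * ℓ - (c * I.total - I.cum (y i + 1) * ℓ)) =
        I.overlap ℓ c (y i) := rfl
  have hsh : I.overlap ℓ c (y i) * I.scale / (I.cum (y i + 1) - I.cum (y i)) =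
      I.share ℓ c (y i) := rfl
  have hdi : (I.share ℓ c (y i) - I.scale + (I.scale - I.share ℓ c (y i))) *
      (I.share ℓ c (y i) - I.scale + (I.scale - I.share ℓ c (y i))) =
      I.sampleDiag ℓ y c i := rfl
  simp only [Regs, List.forall_mem_cons, List.not_mem_nil, false_implies, implies_true,
    and_true] at h₁ h₅
  simp only [sampleBody, wp, State.setReg, Function.update_apply, Nat.reduceEqDiff, reduceIte, h₁,
    h₅, Op.eval, hs, hc₀, hc₁, hov, hsh, hdi]
  refine ⟨?_, ?_, ?_, ?_, ?_, ?_, ?_, ?_, ?_, ?_, ?_, ?_, ?_, ?_, ?_, ?_, ?_, ?_, ?_, ?_, ?_, ?_,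
    ?_, ?_, ?_, ?_, ?_, ?_, ?_, ?_, ?_, ?_, ?_, ?_, ?_, ?_, ?_, ?_, ?_, ?_, ?_, ?_, ?_, ?_, ?_, ?_,
    ?_, ?_, ?_, ?_, ⟨?_, h₂, h₃, h₄⟩, ?_⟩
  any_goals omega
  all_goals
    simp only [Regs, List.forall_mem_cons, List.not_mem_nil, false_implies, implies_true,
      Function.update_apply, Nat.reduceEqDiff, reduceIte, h₁, h₅, Finset.sum_range_succ,
      add_assoc, and_self]

open Com in
/-- Add the contribution of one cell. -/
def cellBody : Com :=
  .seq (block [arith .add 14 13 6, const 15 0, const 17 0])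
    (.seq (.loop 15 5 (block sampleBody))
      (block [arith .sub 22 17 26, arith .sub 23 26 17, arith .add 22 22 23, arith .mul 22 22 22,
        arith .add 10 10 22, arith .add 13 13 6, arith .add 12 12 27]))

open Com in
/-- Add the contribution of one level. -/
def levelBody : Com :=
  .seq (block [arith .mul 10 10 29, arith .mul 11 11 29, const 12 0, const 13 0])
    (.seq (.loop 12 7 cellBody) (block [arith .mul 7 7 28, arith .mul 8 8 28]))

namespace Params

variable (I : Params)

theorem cellSq_le {ℓ : ℕ} (hℓ : ℓ ≤ I.k * 16 ^ I.levels) (htot : 0 < I.total) (y : ℕ → ℕ) {c : ℕ}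
    (hc : c < ℓ) : I.cellSq ℓ y c ≤ I.cellBound * I.cellBound := by
  refine sqDist_le (le_trans ?_ (I.le_cellBound hℓ)) (le_trans ?_ (I.le_cellBound hℓ))
  · refine (Finset.sum_le_sum fun i _ => I.share_le hc (y i)).trans ?_
    simp
  · refine Nat.mul_le_mul_left _ (Nat.le_mul_of_pos_left _ (Nat.mul_pos htot (by omega)))

theorem accSq_mono (y : ℕ → ℕ) : Monotone (I.accSq y) :=
  monotone_nat_of_le_succ fun j => by rw [accSq]; omega

theorem accDiag_mono (y : ℕ → ℕ) : Monotone (I.accDiag y) :=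
  monotone_nat_of_le_succ fun j => by rw [accDiag]; omega

/-- A time bound for `cellBody`. -/
def cellTime (X : ℕ) : ℕ := 4 * stepCost X + (I.draws * (stepCost X + 26 * stepCost X) + stepCost X
    + 8 * stepCost X)

/-- A time bound for `levelBody`. -/
noncomputable def levelTime (X : ℕ) : ℕ :=
  5 * stepCost X + (I.k * 16 ^ I.levels * (stepCost X + I.cellTime X) + stepCost X + 3 * stepCost X)

end Params

theorem cellBody_triple (I : Params) (y : ℕ → ℕ) (hB : I.Bounds y X)
    (hy : ∀ i < I.draws, y i < I.n) {ℓ c : ℕ} (hc : c < ℓ)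
    (t Q N₀ : ℕ) (hℓ : ℓ ≤ I.k * 16 ^ I.levels)
    (hQ : Q + ∑ c' ∈ Finset.range (c + 1), I.cellSq ℓ y c' ≤ X)
    (hN : N₀ + ∑ c' ∈ Finset.range (c + 1), ∑ i ∈ Finset.range I.draws,
      I.sampleDiag ℓ y c' i ≤ X) :
    Triple s r
      (fun σ => Core I y σ ∧ Regs [(7, ℓ), (8, t),
        (10, Q + ∑ c' ∈ Finset.range c, I.cellSq ℓ y c'),
        (11, N₀ + ∑ c' ∈ Finset.range c, ∑ i ∈ Finset.range I.draws, I.sampleDiag ℓ y c' i),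
        (12, c), (13, c * I.total)] σ)
      cellBody (I.cellTime X)
      (fun σ => Core I y σ ∧ Regs [(7, ℓ), (8, t),
        (10, Q + ∑ c' ∈ Finset.range (c + 1), I.cellSq ℓ y c'),
        (11, N₀ + ∑ c' ∈ Finset.range (c + 1), ∑ i ∈ Finset.range I.draws, I.sampleDiag ℓ y c' i),
        (12, c + 1), (13, (c + 1) * I.total)] σ) := by
  have hadd := hB.addresses
  have hcell := hB.cells
  have hscale := hB.scale_pos
  have htot := hB.total_pos
  have hCB : I.cellBound ≤ I.cellBound * I.cellBound := Nat.le_mul_self _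
  have hb := I.le_cellBound hℓ
  have hm := I.draws_pos
  have h0 : I.total * ℓ * I.scale ≤ I.draws * (I.total * ℓ * I.scale) := Nat.le_mul_of_pos_left _ hm
  have h1 : I.total * ℓ ≤ I.total * ℓ * I.scale := Nat.le_mul_of_pos_right _ hscale
  have h3 : ℓ ≤ I.total * ℓ := Nat.le_mul_of_pos_left _ htot
  have h8 : c * I.total + I.total ≤ I.total * ℓ := by
    calc c * I.total + I.total = I.total * (c + 1) := by ring
      _ ≤ I.total * ℓ := Nat.mul_le_mul_left _ hc
  have hsq := I.cellSq_le hℓ htot y hc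
  have hsum : ∑ i' ∈ Finset.range I.draws, I.share ℓ c (y i') ≤ I.draws * (I.total * ℓ
      * I.scale) := by
    refine (Finset.sum_le_sum fun i _ => I.share_le hc (y i)).trans ?_
    simp
  have hdB : I.draws * I.scale ≤ I.draws * (I.total * ℓ * I.scale) :=
    Nat.mul_le_mul_left _ (Nat.le_mul_of_pos_left _ (Nat.mul_pos htot (by omega)))
  rw [Finset.sum_range_succ] at hN hQ
  have hloop := Triple.loop (s := s) (r := r) (X := X) (x := 15) (y := 5) (N := I.draws)
    (A := Com.block sampleBody) (T := 26 * stepCost X)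
    (Inv := fun i σ => Core I y σ ∧ Regs [(7, ℓ), (8, t),
        (10, Q + ∑ c' ∈ Finset.range c, I.cellSq ℓ y c'),
        (11, N₀ + ∑ c' ∈ Finset.range c, ∑ i ∈ Finset.range I.draws, I.sampleDiag ℓ y c' i +
          ∑ i' ∈ Finset.range i, I.sampleDiag ℓ y c i'),
        (12, c), (13, c * I.total), (14, c * I.total + I.total), (15, i),
        (17, ∑ i' ∈ Finset.range i, I.share ℓ c (y i'))] σ) ?_ ?_ ?_
  · refine Triple.seq (Triple.block (X := X) ?_) (Triple.seq hloop (Triple.block (X := X) ?_))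
    · rintro σ ⟨⟨h₁, h₂, h₃, h₄⟩, h₅⟩
      simp only [Regs, List.forall_mem_cons, List.not_mem_nil, false_implies, implies_true,
        and_true] at h₁ h₅
      simp only [wp, State.setReg, h₁,
        h₅, Op.eval]
      refine ⟨?_, ?_, ?_, ?_, ⟨?_, h₂, h₃, h₄⟩, ?_⟩
      any_goals omega
      all_goals
        simp [Regs, Function.update_apply, h₁, h₅]
    · rintro σ ⟨⟨h₁, h₂, h₃, h₄⟩, h₅⟩
      simp only [Regs, List.forall_mem_cons, List.not_mem_nil, false_implies, implies_true,
        and_true] at h₁ h₅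
      have hd : (∑ i' ∈ Finset.range I.draws, I.share ℓ c (y i') - I.draws * I.scale +
        (I.draws * I.scale - ∑ i' ∈ Finset.range I.draws, I.share ℓ c (y i'))) *
        (∑ i' ∈ Finset.range I.draws, I.share ℓ c (y i') - I.draws * I.scale +
        (I.draws * I.scale - ∑ i' ∈ Finset.range I.draws, I.share ℓ c (y i'))) =
          I.cellSq ℓ y c := rfl
      simp only [wp, State.setReg, Function.update_apply, Nat.reduceEqDiff, reduceIte, h₁,
        h₅, Op.eval, hd]
      refine ⟨?_, ?_, ?_, ?_, ?_, ?_, ?_, ?_, ?_, ?_, ?_, ?_, ?_, ?_, ⟨?_, h₂, h₃, h₄⟩, ?_⟩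
      any_goals omega
      all_goals
        simp only [Regs, List.forall_mem_cons, List.not_mem_nil, false_implies, implies_true,
          Function.update_apply, Nat.reduceEqDiff, reduceIte, h₁, h₅, Finset.sum_range_succ,
          add_assoc, and_self, add_mul, one_mul]
  · rintro i hi σ ⟨⟨h₁, h₂, h₃, h₄⟩, h₅⟩
    simp only [Regs, List.forall_mem_cons, List.not_mem_nil, false_implies, implies_true,
        and_true] at h₁ h₅
    simp only [h₁, h₅]
    omega
  · rintro i hi σ ⟨⟨h₁, h₂, h₃, h₄⟩, h₅⟩
    simp only [Regs, List.forall_mem_cons, List.not_mem_nil, false_implies, implies_true,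
        and_true] at h₁ h₅
    simp only [h₁, h₅]
  · intro i hi
    refine sampleBody_triple I y hB hy hc hi t _ _ hℓ ?_
    have : ∑ i' ∈ Finset.range (i + 1), I.sampleDiag ℓ y c i' ≤
        ∑ i' ∈ Finset.range I.draws, I.sampleDiag ℓ y c i' :=
      Finset.sum_le_sum_of_subset (Finset.range_subset_range.2 hi)
    omega

/-- The levels are combined by Horner's scheme with multiplier 128; `acc_eq` shows that this
produces the weights 2^j. -/
theorem levelBody_triple (I : Params) (y : ℕ → ℕ) (hB : I.Bounds y X)
    (hy : ∀ i < I.draws, y i < I.n) {j : ℕ} (hj : j < I.levels) :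
    Triple s r
      (fun σ => Core I y σ ∧ Regs [(7, I.k * 16 ^ j), (8, 16 ^ j * I.a), (10, I.accSq y j),
        (11, I.accDiag y j)] σ)
      levelBody (I.levelTime X)
      (fun σ => Core I y σ ∧ Regs [(7, I.k * 16 ^ (j + 1)), (8, 16 ^ (j + 1) * I.a),
        (10, I.accSq y (j + 1)), (11, I.accDiag y (j + 1))] σ) := by
  have hadd := hB.addresses
  have hcnt := hB.counters
  have htime := hB.time
  have hℓ : I.k * 16 ^ j ≤ I.k * 16 ^ I.levels :=
    Nat.mul_le_mul_left _ (Nat.pow_le_pow_right (by norm_num) hj.le)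
  have hℓ' : I.k * 16 ^ j * 16 ≤ I.k * 16 ^ I.levels := by
    rw [mul_assoc, ← pow_succ]
    exact Nat.mul_le_mul_left _ (Nat.pow_le_pow_right (by norm_num) hj)
  have ht' : 16 ^ j * I.a * 16 ≤ 16 ^ I.levels * I.a := by
    rw [mul_right_comm, ← pow_succ]
    exact Nat.mul_le_mul_right _ (Nat.pow_le_pow_right (by norm_num) hj)
  have hS : I.accSq y (j + 1) ≤ X := (I.accSq_mono y hj).trans hB.accSq
  have hD : I.accDiag y (j + 1) ≤ X := (I.accDiag_mono y hj).trans hB.accDiag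
  rw [Params.accSq] at hS
  rw [Params.accDiag] at hD
  have hloop := Triple.loop (s := s) (r := r) (X := X) (x := 12) (y := 7) (N := I.k * 16 ^ j)
    (A := cellBody) (T := I.cellTime X)
    (Inv := fun c σ => Core I y σ ∧ Regs [(7, I.k * 16 ^ j), (8, 16 ^ j * I.a),
        (10, 128 * I.accSq y j + ∑ c' ∈ Finset.range c, I.cellSq (I.k * 16 ^ j) y c'),
        (11, 128 * I.accDiag y j + ∑ c' ∈ Finset.range c, ∑ i ∈ Finset.range I.draws,
          I.sampleDiag (I.k * 16 ^ j) y c' i),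
        (12, c), (13, c * I.total)] σ) ?_ ?_ ?_
  · refine Triple.mono (T := 5 * stepCost X + (I.k * 16 ^ j * (stepCost X + I.cellTime X) +
      stepCost X + 3 * stepCost X)) (Triple.seq (Triple.block (X := X) ?_)
      (Triple.seq hloop (Triple.block (X := X) ?_))) (fun _ h => h) ?_ (fun _ h => h)
    · rintro σ ⟨⟨h₁, h₂, h₃, h₄⟩, h₅⟩
      simp only [Regs, List.forall_mem_cons, List.not_mem_nil, false_implies, implies_true,
        and_true] at h₁ h₅
      simp only [wp, State.setReg, Function.update_apply, Nat.reduceEqDiff, reduceIte, h₁,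
        h₅, Op.eval]
      refine ⟨?_, ?_, ?_, ?_, ?_, ?_, ⟨?_, h₂, h₃, h₄⟩, ?_⟩
      any_goals omega
      all_goals
        simp [Regs, Function.update_apply, h₁, h₅, mul_comm]
    · rintro σ ⟨⟨h₁, h₂, h₃, h₄⟩, h₅⟩
      simp only [Regs, List.forall_mem_cons, List.not_mem_nil, false_implies, implies_true,
        and_true] at h₁ h₅
      simp only [wp, State.setReg, Function.update_apply, Nat.reduceEqDiff, reduceIte, h₁,
        h₅, Op.eval]
      refine ⟨?_, ?_, ?_, ?_, ⟨?_, h₂, h₃, h₄⟩, ?_⟩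
      any_goals omega
      all_goals
        simp [Regs, Function.update_apply, h₁, h₅, Params.accSq, Params.accDiag, pow_succ,
            mul_assoc, mul_comm I.a]
    · unfold Params.levelTime
      gcongr
  · rintro c hc σ ⟨⟨h₁, h₂, h₃, h₄⟩, h₅⟩
    simp only [Regs, List.forall_mem_cons, List.not_mem_nil, false_implies, implies_true,
        and_true] at h₁ h₅
    simp only [h₅]
    omega
  · rintro c hc σ ⟨⟨h₁, h₂, h₃, h₄⟩, h₅⟩
    simp only [Regs, List.forall_mem_cons, List.not_mem_nil, false_implies, implies_true,
        and_true] at h₁ h₅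
    simp only [h₅]
  · intro c hc
    refine cellBody_triple I y hB hy hc _ _ _ hℓ (le_trans ?_ hS) (le_trans ?_ hD)
    · exact Nat.add_le_add_left (Finset.sum_le_sum_of_subset (Finset.range_subset_range.2 hc)) _
    · exact Nat.add_le_add_left (Finset.sum_le_sum_of_subset (Finset.range_subset_range.2 hc)) _

open Com in
/-- Compute the number of samples. -/
def countPhase : Com :=
  .seq (block [const 15 0, const 18 0])
    (.seq (.loop 18 2 (block [arith .add 15 15 27, arith .mul 18 15 15]))
      (block [const 18 (10 ^ 8), arith .mul 18 18 15, arith .mul 19 4 4, arith .mul 18 18 19,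
        arith .mul 19 3 3, arith .div 18 18 19, arith .add 5 18 27]))

open Com in
/-- Replace the weights by their partial sums. -/
def cumPhase : Com :=
  .seq (block [const 18 0, store 31 18, const 15 0, const 6 0])
    (.loop 15 1 (block [arith .add 18 15 31, arith .add 18 18 27, load 19 18, arith .add 6 6 19,
      store 18 6, arith .add 15 15 27]))

open Com in
/-- Draw and store the samples. -/
def samplePhase : Com :=
  .seq (block [const 18 5, arith .add 30 18 1, const 15 0])
    (.loop 15 5 (block [sample 18, arith .add 19 15 30, store 19 18, arith .add 15 15 27]))

open Com in
/-- Compute the remaining constants. -/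
def constPhase : Com :=
  block [const 18 1024, arith .mul 25 18 4, arith .mul 26 5 25, const 18 256, arith .mul 9 18 4,
    const 28 16, const 29 128, arith .mul 18 3 3, arith .mul 11 2 18, arith .sub 18 5 27,
    arith .mul 18 5 18, arith .mul 11 11 18, const 10 0, const 18 0, arith .add 7 2 18,
    arith .add 8 3 18]

open Com in
/-- The identity tester. -/
def tester : Com :=
  .seq (block [const 18 0, load 1 18, const 18 1, load 2 18, const 18 2, load 3 18, const 18 3,
      load 4 18, const 27 1, const 31 4, const 18 2, arith .mul 18 18 4])
    (.ite 3 18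
      (.seq countPhase (.seq cumPhase (.seq samplePhase (.seq constPhase
        (.seq (.loop 8 9 levelBody) (.ite 10 11 (block [const 0 1]) (block [])))))))
      (block [const 0 1]))

/-- Assumptions under which `X` bounds all numbers that occur in the preparatory part. -/
structure Params.SetupBounds (I : Params) (X : ℕ) : Prop where
  k_pos : 0 < I.k
  a_pos : 0 < I.a
  large : 10 ^ 8 ≤ X
  addresses : I.draws + I.n + 200 ≤ X
  total : I.total ≤ X
  numerator : 10 ^ 8 * I.root * (I.b * I.b) ≤ X
  scale : I.draws * I.scale ≤ X
  threshold : I.k * (I.a * I.a) * (I.draws * I.draws) ≤ X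
  rootSq : I.root * I.root ≤ X

/-! ### Correctness of the preparatory phases and of the whole program -/

theorem Params.root_iff (I : Params) (hk : 0 < I.k) (i : ℕ) : i * i < I.k ↔ i < I.root := by
  rw [Params.root, Nat.lt_succ_iff, Nat.le_sqrt]
  omega

/-- The root of `k` is found by linear search. This is affordable because `k ≤ n`, and `n` is at
most the length of the input. -/
theorem countPhase_triple (I : Params) (h : I.SetupBounds X) (hb : 0 < I.b)
    (mem : ℕ → ℕ) :
    Triple s r
      (fun σ => Regs [(0, 0), (1, I.n), (2, I.k), (3, I.a), (4, I.b), (27, 1), (31, 4)] σ ∧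
        σ.mem = mem ∧ σ.drawn = 0)
      countPhase (3 * stepCost X + (I.root * (stepCost X + 3 * stepCost X) + stepCost X +
        8 * stepCost X))
      (fun σ => Regs [(0, 0), (1, I.n), (2, I.k), (3, I.a), (4, I.b), (27, 1), (31, 4),
        (5, I.draws)] σ ∧ σ.mem = mem ∧ σ.drawn = 0) := by
  obtain ⟨hk, ha, hlarge, hadd, htot, hnum, hsc, hthr, hroot⟩ := h
  have hm := I.draws_pos
  have hr : 0 < I.root := Nat.succ_pos _
  have h1 : I.root ≤ I.root * I.root := Nat.le_mul_self _
  have h2 : 10 ^ 8 * I.root ≤ 10 ^ 8 * I.root * (I.b * I.b) :=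
    Nat.le_mul_of_pos_right _ (Nat.mul_pos hb hb)
  have h3 : I.b * I.b ≤ 10 ^ 8 * I.root * (I.b * I.b) :=
    Nat.le_mul_of_pos_left _ (by positivity)
  have h4 : I.b ≤ I.b * I.b := Nat.le_mul_self _
  have h5 : I.a ≤ I.a * I.a := Nat.le_mul_self _
  have h6 : I.k * (I.a * I.a) ≤ I.k * (I.a * I.a) * (I.draws * I.draws) :=
    Nat.le_mul_of_pos_right _ (by positivity)
  have h7 : I.a * I.a ≤ I.k * (I.a * I.a) := Nat.le_mul_of_pos_left _ hk
  have h8 : I.k ≤ I.k * (I.a * I.a) := Nat.le_mul_of_pos_right _ (by positivity)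
  have h9 : 10 ^ 8 * I.root * (I.b * I.b) / (I.a * I.a) + 1 = I.draws := rfl
  have hloop := Triple.loop (s := s) (r := r) (X := X) (x := 18) (y := 2) (N := I.root)
    (A := Com.block [.arith .add 15 15 27, .arith .mul 18 15 15]) (T := 3 * stepCost X)
    (Inv := fun i σ => Regs [(0, 0), (1, I.n), (2, I.k), (3, I.a), (4, I.b), (27, 1), (31, 4),
      (15, i), (18, i * i)] σ ∧ σ.mem = mem ∧ σ.drawn = 0) ?_ ?_ ?_
  · refine Triple.seq (Triple.block (X := X) ?_) (Triple.seq hloop (Triple.block (X := X) ?_))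
    · rintro σ ⟨h₁, h₂, h₃⟩
      simp only [Regs, List.forall_mem_cons, List.not_mem_nil, false_implies, implies_true,
        and_true] at h₁
      simp [wp, State.setReg, Regs, Function.update_apply, h₁, h₂, h₃]
    · rintro σ ⟨h₁, h₂, h₃⟩
      simp only [Regs, List.forall_mem_cons, List.not_mem_nil, false_implies, implies_true,
        and_true] at h₁
      simp only [wp, State.setReg, Function.update_apply, Nat.reduceEqDiff, reduceIte, h₁,
        Op.eval, h9]
      refine ⟨?_, ?_, ?_, ?_, ?_, ?_, ?_, ?_, ?_, ?_, ?_, ?_, ?_, ?_, h₂, h₃⟩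
      any_goals omega
      simp [Regs, Function.update_apply, h₁]
  · rintro i hi σ ⟨h₁, h₂, h₃⟩
    simp only [Regs, List.forall_mem_cons, List.not_mem_nil, false_implies, implies_true,
      and_true] at h₁
    have := Nat.mul_le_mul hi hi
    simp only [h₁]
    omega
  · rintro i hi σ ⟨h₁, h₂, h₃⟩
    simp only [Regs, List.forall_mem_cons, List.not_mem_nil, false_implies, implies_true,
      and_true] at h₁
    simp only [h₁]
    exact I.root_iff hk i
  · intro i hi
    refine Triple.block ?_
    rintro σ ⟨h₁, h₂, h₃⟩
    simp only [Regs, List.forall_mem_cons, List.not_mem_nil, false_implies, implies_true,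
      and_true] at h₁
    simp only [wp, State.setReg, Function.update_apply, reduceIte, h₁, Op.eval]
    refine ⟨?_, ?_, ?_, ?_, ?_, h₂, h₃⟩
    any_goals omega
    simp [Regs, Function.update_apply, h₁]

/-- The partial sum number `i + 1` replaces the weight number `i`, and `cum 0 = 0` replaces the
denominator `N` of the input in cell 4. That denominator is never read: the weights are normalized
by their own total. -/
theorem cumPhase_triple (I : Params) (h : I.SetupBounds X) :
    Triple s r
      (fun σ => Regs [(0, 0), (1, I.n), (2, I.k), (3, I.a), (4, I.b), (27, 1), (31, 4),
        (5, I.draws)] σ ∧ (∀ x < I.n, σ.mem (x + 4 + 1) = I.weight x) ∧ σ.drawn = 0)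
      cumPhase (5 * stepCost X + (I.n * (stepCost X + 7 * stepCost X) + stepCost X))
      (fun σ => Regs [(0, 0), (1, I.n), (2, I.k), (3, I.a), (4, I.b), (27, 1), (31, 4),
        (5, I.draws), (6, I.total)] σ ∧ (∀ x ≤ I.n, σ.mem (x + 4) = I.cum x) ∧ σ.drawn = 0) := by
  obtain ⟨hk, ha, hlarge, hadd, htot, hnum, hsc, hthr, hroot⟩ := h
  have hloop := Triple.loop (s := s) (r := r) (X := X) (x := 15) (y := 1) (N := I.n)
    (A := Com.block [.arith .add 18 15 31, .arith .add 18 18 27, .load 19 18, .arith .add 6 6 19,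
      .store 18 6, .arith .add 15 15 27]) (T := 7 * stepCost X)
    (Inv := fun i σ => Regs [(0, 0), (1, I.n), (2, I.k), (3, I.a), (4, I.b), (27, 1), (31, 4),
      (5, I.draws), (6, I.cum i), (15, i)] σ ∧ (∀ x ≤ i, σ.mem (x + 4) = I.cum x) ∧
      (∀ x < I.n, i ≤ x → σ.mem (x + 4 + 1) = I.weight x) ∧ σ.drawn = 0) ?_ ?_ ?_
  · refine Triple.seq (Triple.block (X := X) ?_) (hloop.mono (fun _ h => h) le_rfl ?_)
    · rintro σ ⟨h₁, h₂, h₃⟩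
      simp only [Regs, List.forall_mem_cons, List.not_mem_nil, false_implies, implies_true,
        and_true] at h₁
      simp only [wp, State.setReg, State.setMem, Function.update_apply, Nat.reduceEqDiff,
        reduceIte, h₁]
      refine ⟨?_, ?_, ?_, ?_, ?_, ?_, ?_, ?_, h₃⟩
      any_goals omega
      · simp [Regs, Function.update_apply, h₁, Params.cum]
      · intro x hx
        obtain rfl : x = 0 := by omega
        simp [Params.cum]
      · intro x hx _
        exact h₂ x hx
    · rintro σ ⟨h₁, h₂, -, h₄⟩
      refine ⟨?_, h₂, h₄⟩
      simp only [Regs, List.forall_mem_cons, List.not_mem_nil, false_implies, implies_true,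
        and_true] at h₁ ⊢
      simp [h₁, Params.total]
  · rintro i hi σ ⟨h₁, h₂, h₃⟩
    simp only [Regs, List.forall_mem_cons, List.not_mem_nil, false_implies, implies_true,
      and_true] at h₁
    simp only [h₁]
    omega
  · rintro i hi σ ⟨h₁, h₂, h₃⟩
    simp only [Regs, List.forall_mem_cons, List.not_mem_nil, false_implies, implies_true,
      and_true] at h₁
    simp only [h₁]
  · intro i hi
    refine Triple.block ?_
    rintro σ ⟨h₁, h₂, h₃, h₄⟩
    simp only [Regs, List.forall_mem_cons, List.not_mem_nil, false_implies, implies_true,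
      and_true] at h₁
    have hw := h₃ i hi le_rfl
    have h5 : I.cum i + I.weight i = I.cum (i + 1) := (Finset.sum_range_succ _ _).symm
    have h6 : I.cum (i + 1) ≤ I.total := I.cum_mono hi
    simp only [wp, State.setReg, State.setMem, Function.update_apply, Nat.reduceEqDiff, reduceIte,
      h₁, Op.eval, hw, h5]
    refine ⟨?_, ?_, ?_, ?_, ?_, ?_, ?_, ?_, ?_, ?_, ?_, ?_, ?_, ?_, ?_, h₄⟩
    any_goals omega
    · simp [Regs, Function.update_apply, h₁]
    · intro x hx
      split_ifs with hxi
      · congr 1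
        omega
      · exact h₂ x (by omega)
    · intro x hx hix
      rw [if_neg (by omega), h₃ x hx (by omega)]

/-- The samples are kept in memory because every cell of every level reads all of them again. -/
theorem samplePhase_triple (I : Params) (h : I.SetupBounds X) (hs : ∀ i < I.draws, s i < I.n) :
    Triple s r
      (fun σ => Regs [(0, 0), (1, I.n), (2, I.k), (3, I.a), (4, I.b), (27, 1), (31, 4),
        (5, I.draws), (6, I.total)] σ ∧ (∀ x ≤ I.n, σ.mem (x + 4) = I.cum x) ∧ σ.drawn = 0)
      samplePhase (4 * stepCost X + (I.draws * (stepCost X + 5 * stepCost X) + stepCost X))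
      (fun σ => Regs [(0, 0), (1, I.n), (2, I.k), (3, I.a), (4, I.b), (27, 1), (31, 4),
        (5, I.draws), (6, I.total), (30, 5 + I.n)] σ ∧ (∀ x ≤ I.n, σ.mem (x + 4) = I.cum x) ∧
        (∀ i < I.draws, σ.mem (i + (5 + I.n)) = s i) ∧ σ.drawn = I.draws) := by
  obtain ⟨hk, ha, hlarge, hadd, htot, hnum, hsc, hthr, hroot⟩ := h
  have hloop := Triple.loop (s := s) (r := r) (X := X) (x := 15) (y := 5) (N := I.draws)
    (A := Com.block [.sample 18, .arith .add 19 15 30, .store 19 18, .arith .add 15 15 27])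
    (T := 5 * stepCost X)
    (Inv := fun i σ => Regs [(0, 0), (1, I.n), (2, I.k), (3, I.a), (4, I.b), (27, 1), (31, 4),
      (5, I.draws), (6, I.total), (30, 5 + I.n), (15, i)] σ ∧
      (∀ x ≤ I.n, σ.mem (x + 4) = I.cum x) ∧
      (∀ j < i, σ.mem (j + (5 + I.n)) = s j) ∧ σ.drawn = i) ?_ ?_ ?_
  · refine Triple.seq (Triple.block (X := X) ?_) (hloop.mono (fun _ h => h) le_rfl ?_)
    · rintro σ ⟨h₁, h₂, h₃⟩
      simp only [Regs, List.forall_mem_cons, List.not_mem_nil, false_implies, implies_true,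
        and_true] at h₁
      simp only [wp, State.setReg, Function.update_apply, Nat.reduceEqDiff, Op.eval,
        reduceIte, h₁]
      refine ⟨?_, ?_, ?_, ?_, ?_, h₂, ?_, h₃⟩
      any_goals omega
      · simp [Regs, Function.update_apply, h₁]
    · rintro σ ⟨h₁, h₂, h₃, h₄⟩
      refine ⟨?_, h₂, h₃, h₄⟩
      simp only [Regs, List.forall_mem_cons, List.not_mem_nil, false_implies, implies_true,
        and_true] at h₁ ⊢
      simp [h₁]
  · rintro i hi σ ⟨h₁, h₂, h₃⟩
    simp only [Regs, List.forall_mem_cons, List.not_mem_nil, false_implies, implies_true,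
      and_true] at h₁
    simp only [h₁]
    omega
  · rintro i hi σ ⟨h₁, h₂, h₃⟩
    simp only [Regs, List.forall_mem_cons, List.not_mem_nil, false_implies, implies_true,
      and_true] at h₁
    simp only [h₁]
  · intro i hi
    refine Triple.block ?_
    rintro σ ⟨h₁, h₂, h₃, h₄⟩
    simp only [Regs, List.forall_mem_cons, List.not_mem_nil, false_implies, implies_true,
      and_true] at h₁
    have hsi := hs i hi
    simp only [wp, State.setReg, State.setMem, Function.update_apply, Nat.reduceEqDiff, reduceIte,
      h₁, h₄, Op.eval]
    refine ⟨?_, ?_, ?_, ?_, ?_, ?_, ?_, ?_, ?_, ?_, trivial⟩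
    any_goals omega
    · simp [Regs, Function.update_apply, h₁]
    · intro x hx
      rw [if_neg (by omega), h₂ x hx]
    · intro j hj
      split_ifs with hji
      · congr 1
        omega
      · exact h₃ j (by omega)

theorem constPhase_triple (I : Params) (h : I.SetupBounds X) (hB : I.Bounds s X) :
    Triple s r
      (fun σ => Regs [(0, 0), (1, I.n), (2, I.k), (3, I.a), (4, I.b), (27, 1), (31, 4),
        (5, I.draws), (6, I.total), (30, 5 + I.n)] σ ∧ (∀ x ≤ I.n, σ.mem (x + 4) = I.cum x) ∧
        (∀ i < I.draws, σ.mem (i + (5 + I.n)) = s i) ∧ σ.drawn = I.draws)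
      constPhase (17 * stepCost X)
      (fun σ => Core I s σ ∧ Regs [(7, I.k * 16 ^ 0), (8, 16 ^ 0 * I.a), (10, I.accSq s 0),
        (11, I.accDiag s 0)] σ) := by
  obtain ⟨hk, ha, hlarge, hadd, htot, hnum, hsc, hthr, hroot⟩ := h
  have hm := I.draws_pos
  have h0 := hB.guard
  have h1 : I.scale ≤ I.draws * I.scale := Nat.le_mul_of_pos_left _ hm
  have h2 : 1024 * I.b = I.scale := rfl
  have h5 : I.a ≤ I.a * I.a := Nat.le_mul_self _
  have h6 : I.k * (I.a * I.a) ≤ I.k * (I.a * I.a) * (I.draws * I.draws) :=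
    Nat.le_mul_of_pos_right _ (by positivity)
  have h7 : I.a * I.a ≤ I.k * (I.a * I.a) := Nat.le_mul_of_pos_left _ hk
  have h8 : I.k ≤ I.k * (I.a * I.a) := Nat.le_mul_of_pos_right _ (by positivity)
  have h9 : I.draws * (I.draws - 1) ≤ I.draws * I.draws := Nat.mul_le_mul_left _ (Nat.sub_le _ _)
  have h10 : I.draws * I.draws ≤ I.k * (I.a * I.a) * (I.draws * I.draws) :=
    Nat.le_mul_of_pos_left _ (by positivity)
  refine Triple.block (X := X) ?_
  rintro σ ⟨h₁, h₂, h₃, h₄⟩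
  simp only [Regs, List.forall_mem_cons, List.not_mem_nil, false_implies, implies_true,
    and_true] at h₁
  simp only [wp, State.setReg, Function.update_apply, Nat.reduceEqDiff, Op.eval,
    reduceIte, h₁, h2]
  refine ⟨?_, ?_, ?_, ?_, ?_, ?_, ?_, ?_, ?_, ?_, ?_, ?_, ?_, ?_, ?_, ?_, ?_, ?_, ?_, ?_, ?_, ?_,
    ?_, ?_, ?_, ?_, ⟨?_, h₂, h₃, h₄⟩, ?_⟩
  any_goals omega
  all_goals simp [Regs, Function.update_apply, h₁, Params.accSq, Params.accDiag]

/-- A time bound for `tester`. -/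
noncomputable def Params.testerTime (I : Params) (X : ℕ) : ℕ :=
  100 * stepCost X + I.root * (4 * stepCost X) + I.n * (8 * stepCost X) +
    I.draws * (6 * stepCost X) + I.levels * (stepCost X + I.levelTime X)

/-- If `a / b > 2`, no distribution is far from `p`, since the distance never exceeds 2; the program
then accepts without sampling. Only the other case needs the bounds in `hsetup`. -/
theorem tester_triple (I : Params) (hn : I.n ≤ X) (hk : I.k ≤ X) (ha : I.a ≤ X)
    (hb : 2 * I.b + 100 ≤ X)
    (hsetup : I.a ≤ 2 * I.b → 0 < I.b ∧ I.SetupBounds X ∧ I.Bounds s X)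
    (hs : ∀ i, s i < I.n) :
    Triple s r
      (fun σ => σ.reg 0 = 0 ∧ σ.drawn = 0 ∧ σ.mem 0 = I.n ∧ σ.mem 1 = I.k ∧ σ.mem 2 = I.a ∧
        σ.mem 3 = I.b ∧ ∀ x < I.n, σ.mem (x + 4 + 1) = I.weight x)
      tester (if I.a ≤ 2 * I.b then I.testerTime X else 100 * stepCost X)
      (fun σ => (σ.reg 0 = 1 ↔ I.a ≤ 2 * I.b → I.accSq s I.levels ≤ I.accDiag s I.levels) ∧
        σ.drawn = if I.a ≤ 2 * I.b then I.draws else 0) := by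
  have hload : Triple s r (fun σ => σ.reg 0 = 0 ∧ σ.drawn = 0 ∧ σ.mem 0 = I.n ∧ σ.mem 1 = I.k ∧
        σ.mem 2 = I.a ∧ σ.mem 3 = I.b ∧ ∀ x < I.n, σ.mem (x + 4 + 1) = I.weight x)
      (Com.block [.const 18 0, .load 1 18, .const 18 1, .load 2 18, .const 18 2, .load 3 18,
        .const 18 3, .load 4 18, .const 27 1, .const 31 4, .const 18 2, .arith .mul 18 18 4])
      (13 * stepCost X)
      (fun σ => Regs [(0, 0), (1, I.n), (2, I.k), (3, I.a), (4, I.b), (27, 1), (31, 4),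
        (18, 2 * I.b)] σ ∧ (∀ x < I.n, σ.mem (x + 4 + 1) = I.weight x) ∧ σ.drawn = 0) := by
    refine Triple.block (X := X) ?_
    rintro σ ⟨h₁, h₂, h₃, h₄, h₅, h₆, h₇⟩
    simp only [wp, State.setReg, Function.update_apply, Nat.reduceEqDiff, Op.eval,
      reduceIte, h₃, h₄, h₅, h₆]
    refine ⟨?_, ?_, ?_, ?_, ?_, ?_, ?_, ?_, ?_, ?_, ?_, ?_, ?_, ?_, ?_, ?_, ?_, ?_, h₇, h₂⟩
    any_goals omega
    simp [Regs, Function.update_apply, h₁]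
  by_cases hab : I.a ≤ 2 * I.b
  · obtain ⟨hb0, hS, hB⟩ := hsetup hab
    simp only [hab, if_true, true_implies]
    have hmain := Triple.loop (s := s) (r := r) (X := X) (x := 8) (y := 9) (N := I.levels)
      (A := levelBody) (T := I.levelTime X)
      (Inv := fun j σ => Core I s σ ∧ Regs [(7, I.k * 16 ^ j), (8, 16 ^ j * I.a),
        (10, I.accSq s j), (11, I.accDiag s j)] σ) ?_ ?_
      (fun j hj => levelBody_triple I s hB (fun i _ => hs i) hj)
    · have hcount : Triple s r (fun σ => Regs [(0, 0), (1, I.n), (2, I.k), (3, I.a), (4, I.b),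
          (27, 1), (31, 4), (18, 2 * I.b)] σ ∧ (∀ x < I.n, σ.mem (x + 4 + 1) = I.weight x) ∧
          σ.drawn = 0) countPhase (3 * stepCost X + (I.root * (stepCost X + 3 * stepCost X) +
          stepCost X + 8 * stepCost X)) (fun σ => Regs [(0, 0), (1, I.n), (2, I.k), (3, I.a),
          (4, I.b), (27, 1), (31, 4), (5, I.draws)] σ ∧
          (∀ x < I.n, σ.mem (x + 4 + 1) = I.weight x) ∧ σ.drawn = 0) := by
        -- `countPhase_triple` preserves a given memory, here the one of the initial state, and thus
        -- the weights in it.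
        refine Triple.of_forall fun σ₀ h₀ => ?_
        refine (countPhase_triple (s := s) (r := r) (X := X) I hS hb0 σ₀.mem).mono ?_ le_rfl ?_
        · rintro σ rfl
          obtain ⟨h₁, h₂, h₃⟩ := h₀
          refine ⟨?_, rfl, h₃⟩
          simp only [Regs, List.forall_mem_cons, List.not_mem_nil, false_implies, implies_true,
            and_true] at h₁ ⊢
          simp [h₁]
        · rintro σ ⟨h₁, h₂, h₃⟩
          exact ⟨h₁, by rw [h₂]; exact h₀.2.1, h₃⟩
      have hend : Triple s r (fun σ => Core I s σ ∧ Regs [(7, I.k * 16 ^ I.levels),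
          (8, 16 ^ I.levels * I.a), (10, I.accSq s I.levels), (11, I.accDiag s I.levels)] σ)
          (.ite 10 11 (Com.block [.const 0 1]) (Com.block [])) (stepCost X + 2 * stepCost X)
          (fun σ => (σ.reg 0 = 1 ↔ I.accSq s I.levels ≤ I.accDiag s I.levels) ∧
            σ.drawn = I.draws) := by
        have h1 := hB.accSq
        have h2 := hB.accDiag
        have h3 := hB.addresses
        refine Triple.ite ?_ (Triple.block ?_) (Triple.mono (T := 1 * stepCost X)
          (Triple.block ?_) (fun _ h => h) (by omega) fun _ h => h)
        · rintro σ ⟨-, h₅⟩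
          simp only [Regs, List.forall_mem_cons, List.not_mem_nil, false_implies, implies_true,
            and_true] at h₅
          omega
        · rintro σ ⟨⟨⟨h₁, h₂, h₃, h₄⟩, h₅⟩, h₆⟩
          simp only [Regs, List.forall_mem_cons, List.not_mem_nil, false_implies, implies_true,
            and_true] at h₁ h₅
          simp only [h₅] at h₆
          simp [wp, State.setReg, h₄, h₆]
          omega
        · rintro σ ⟨⟨⟨h₁, h₂, h₃, h₄⟩, h₅⟩, h₆⟩
          simp only [Regs, List.forall_mem_cons, List.not_mem_nil, false_implies, implies_true,
            and_true] at h₁ h₅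
          simp only [h₅] at h₆
          simp [wp, h₄, h₆, h₁]
      refine Triple.mono (Triple.seq hload (Triple.ite (X := X) ?_ (Triple.seq
        (hcount.mono (fun _ h => h.1) le_rfl fun _ h => h)
        (Triple.seq (cumPhase_triple I hS)
        (Triple.seq (samplePhase_triple I hS fun i _ => hs i)
        (Triple.seq (constPhase_triple I hS hB) (Triple.seq hmain hend)))))
        ?_)) (fun _ h => h) ?_ (fun _ h => h)
      · rintro σ ⟨h₁, -⟩
        simp only [Regs, List.forall_mem_cons, List.not_mem_nil, false_implies, implies_true,
          and_true] at h₁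
        omega
      · rintro σ ⟨⟨h₁, -⟩, h₂⟩
        simp only [Regs, List.forall_mem_cons, List.not_mem_nil, false_implies, implies_true,
          and_true] at h₁
        omega
      · unfold Params.testerTime
        ring_nf
        omega
    · rintro i hi σ ⟨⟨h₁, h₂, h₃, h₄⟩, h₅⟩
      simp only [Regs, List.forall_mem_cons, List.not_mem_nil, false_implies, implies_true,
        and_true] at h₁ h₅
      simp only [h₁, h₅]
      have := hB.guard
      have := hB.time
      have : 16 ^ i * I.a ≤ 16 ^ I.levels * I.a :=
        Nat.mul_le_mul_right _ (Nat.pow_le_pow_right (by norm_num) hi)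
      omega
    · rintro i hi σ ⟨⟨h₁, h₂, h₃, h₄⟩, h₅⟩
      simp only [Regs, List.forall_mem_cons, List.not_mem_nil, false_implies, implies_true,
        and_true] at h₁ h₅
      simp only [h₁, h₅]
      exact (I.lt_levels_iff hS.a_pos i).symm
  · simp only [hab, if_false, false_implies, iff_true]
    refine Triple.mono (Triple.seq hload (T := 13 * stepCost X) (U := stepCost X + 2 * stepCost X)
      (Triple.ite (X := X) ?_ ?_
      (Triple.block ?_))) (fun _ h => h) (by omega) (fun _ h => h)
    · rintro σ ⟨h₁, -⟩
      simp only [Regs, List.forall_mem_cons, List.not_mem_nil, false_implies, implies_true,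
        and_true] at h₁
      omega
    · rintro σ ⟨⟨h₁, -⟩, h₂⟩
      simp only [Regs, List.forall_mem_cons, List.not_mem_nil, false_implies, implies_true,
        and_true] at h₁
      omega
    · rintro σ ⟨⟨h₁, h₃, h₄⟩, h₂⟩
      simp [wp, State.setReg, h₄]
      omega

end Machine

/-! ### Finite product expectations and second moments of U-statistics -/

section Moments

variable {Ω : Type*} [Fintype Ω]

/-- The expectation of a function of `m` independent samples from `q`. -/
def sampleMean (q : Ω → ℝ) (m : ℕ) (F : (Fin m → Ω) → ℝ) : ℝ :=
  ∑ y : Fin m → Ω, (∏ i, q (y i)) * F y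

theorem sampleMean_succ (q : Ω → ℝ) (m : ℕ) (F : (Fin (m + 1) → Ω) → ℝ) :
    sampleMean q (m + 1) F =
      sampleMean q m fun y => ∑ x, q x * F (Fin.cons x y) := by
  unfold sampleMean
  rw [← (Fin.consEquiv fun _ => Ω).sum_comp, Fintype.sum_prod_type_right]
  refine Finset.sum_congr rfl fun y _ => ?_
  rw [Finset.mul_sum]
  refine Finset.sum_congr rfl fun x _ => ?_
  have : (Fin.consEquiv fun _ => Ω) (x, y) = Fin.cons x y := rfl
  simp only [this, Fin.prod_univ_succ, Fin.cons_zero, Fin.cons_succ]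
  ring

theorem sampleMean_zero (q : Ω → ℝ) (F : (Fin 0 → Ω) → ℝ) : sampleMean q 0 F = F Fin.elim0 := by
  simp [sampleMean, Subsingleton.elim _ (Fin.elim0 : Fin 0 → Ω)]

theorem sampleMean_add (q : Ω → ℝ) (m : ℕ) (F G : (Fin m → Ω) → ℝ) :
    sampleMean q m (fun y => F y + G y) = sampleMean q m F + sampleMean q m G := by
  simp [sampleMean, mul_add, Finset.sum_add_distrib]

theorem sampleMean_const_mul (q : Ω → ℝ) (m : ℕ) (c : ℝ) (F : (Fin m → Ω) → ℝ) :
    sampleMean q m (fun y => c * F y) = c * sampleMean q m F := by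
  simp [sampleMean, Finset.mul_sum, mul_left_comm]

theorem sampleMean_sum {ι : Type*} (t : Finset ι) (q : Ω → ℝ) (m : ℕ)
    (F : ι → (Fin m → Ω) → ℝ) :
    sampleMean q m (fun y => ∑ i ∈ t, F i y) = ∑ i ∈ t, sampleMean q m (F i) := by
  simp only [sampleMean, Finset.mul_sum]
  exact Finset.sum_comm

theorem sampleMean_const {q : Ω → ℝ} (hq : ∑ x, q x = 1) (m : ℕ) (c : ℝ) :
    sampleMean q m (fun _ => c) = c := by
  induction m with
  | zero => rw [sampleMean_zero]
  | succ m ih => simp only [sampleMean_succ, ← Finset.sum_mul, hq, one_mul, ih]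

theorem sampleMean_mono {q : Ω → ℝ} (hq : ∀ x, 0 ≤ q x) {m : ℕ} {F G : (Fin m → Ω) → ℝ}
    (h : ∀ y, F y ≤ G y) : sampleMean q m F ≤ sampleMean q m G :=
  Finset.sum_le_sum fun y _ =>
    mul_le_mul_of_nonneg_left (h y) (Finset.prod_nonneg fun i _ => hq (y i))

variable {E : Type*} [NormedAddCommGroup E] [InnerProductSpace ℝ E]

local notation "⟪" x ", " y "⟫" => inner ℝ x y

theorem sum_mul_inner_left (q : Ω → ℝ) (ξ : Ω → E) (z : E) :
    ∑ x, q x * ⟪ξ x, z⟫ = ⟪∑ x, q x • ξ x, z⟫ := by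
  simp [sum_inner, real_inner_smul_left]

/-- Each further sample adds one variance; the cross term vanishes because `ξ` is centered. -/
theorem sampleMean_inner_sq {q : Ω → ℝ} (hq : ∑ x, q x = 1) {ξ : Ω → E}
    (hξ : ∑ x, q x • ξ x = 0) (z : E) (m : ℕ) :
    sampleMean q m (fun y => ⟪∑ i, ξ (y i), z⟫ ^ 2) = m * ∑ x, q x * ⟪ξ x, z⟫ ^ 2 := by
  induction m with
  | zero => simp [sampleMean_zero]
  | succ m ih =>
    have hz : ∑ x, q x * ⟪ξ x, z⟫ = 0 := by rw [sum_mul_inner_left, hξ, inner_zero_left]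
    have : ∀ y : Fin m → Ω, ∑ x, q x * ⟪∑ i, ξ ((Fin.cons x y : Fin (m + 1) → Ω) i), z⟫ ^ 2 =
        ∑ x, q x * ⟪ξ x, z⟫ ^ 2 + ⟪∑ i, ξ (y i), z⟫ ^ 2 := by
      intro y
      simp only [Fin.sum_univ_succ, Fin.cons_zero, Fin.cons_succ, inner_add_left]
      calc _ = ∑ x, (q x * ⟪ξ x, z⟫ ^ 2 + (2 * ⟪∑ i, ξ (y i), z⟫) * (q x * ⟪ξ x, z⟫) +
            ⟪∑ i, ξ (y i), z⟫ ^ 2 * q x) := Finset.sum_congr rfl fun x _ => by ring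
        _ = _ := by
            rw [Finset.sum_add_distrib, Finset.sum_add_distrib, ← Finset.mul_sum,
              ← Finset.mul_sum, hz, hq]
            ring
    simp only [sampleMean_succ, this, sampleMean_add, ih, sampleMean_const hq]
    push_cast
    ring

/-- The sum of `⟪ψ (y i), ψ (y j)⟫` over the pairs `i ≠ j`. -/
def pairSum (ψ : Ω → E) {m : ℕ} (y : Fin m → Ω) : ℝ :=
  ‖∑ i, ψ (y i)‖ ^ 2 - ∑ i, ‖ψ (y i)‖ ^ 2

/-- A new sample `x` adds `2 * ⟪∑ i, ξ (y i), ξ x⟫` to the sum over pairs. This increment has mean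
zero given the earlier samples, so the second moments of the increments add up. -/
theorem sampleMean_pairSum_sq {q : Ω → ℝ} (hq : ∑ x, q x = 1) {ξ : Ω → E}
    (hξ : ∑ x, q x • ξ x = 0) (m : ℕ) :
    sampleMean q m (fun y => pairSum ξ y ^ 2) =
      2 * m * (m - 1) * ∑ x, q x * ∑ x', q x' * ⟪ξ x', ξ x⟫ ^ 2 := by
  induction m with
  | zero => simp [sampleMean_zero, pairSum]
  | succ m ih =>
    have hz : ∀ z, ∑ x, q x * ⟪z, ξ x⟫ = 0 := by
      intro z
      simp_rw [real_inner_comm _ z]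
      rw [sum_mul_inner_left, hξ, inner_zero_left]
    have : ∀ y : Fin m → Ω, ∑ x, q x * pairSum ξ (Fin.cons x y : Fin (m + 1) → Ω) ^ 2 =
        pairSum ξ y ^ 2 + 4 * ∑ x, q x * ⟪∑ i, ξ (y i), ξ x⟫ ^ 2 := by
      intro y
      have h : ∀ x, pairSum ξ (Fin.cons x y : Fin (m + 1) → Ω) =
          pairSum ξ y + 2 * ⟪∑ i, ξ (y i), ξ x⟫ := by
        intro x
        simp only [pairSum, Fin.sum_univ_succ, Fin.cons_zero, Fin.cons_succ]
        rw [add_comm (ξ x), norm_add_sq_real]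
        ring
      calc _ = ∑ x, (pairSum ξ y ^ 2 * q x +
            (4 * pairSum ξ y) * (q x * ⟪∑ i, ξ (y i), ξ x⟫) +
            4 * (q x * ⟪∑ i, ξ (y i), ξ x⟫ ^ 2)) :=
            Finset.sum_congr rfl fun x _ => by rw [h]; ring
        _ = _ := by
            rw [Finset.sum_add_distrib, Finset.sum_add_distrib, ← Finset.mul_sum,
              ← Finset.mul_sum, ← Finset.mul_sum, hz, hq]
            ring
    simp only [sampleMean_succ, this, sampleMean_add, ih, sampleMean_const_mul, sampleMean_sum,
      sampleMean_inner_sq hq hξ]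
    simp only [mul_left_comm _ (m : ℝ), ← Finset.mul_sum]
    push_cast
    ring

/-! ### Hilbert–Schmidt bounds and the variance of the pair statistic -/

theorem sum_mul_sq_le {ι : Type*} (t : Finset ι) {w : ι → ℝ} (hw : ∀ i ∈ t, 0 ≤ w i)
    (f g : ι → ℝ) :
    (∑ i ∈ t, w i * (f i * g i)) ^ 2 ≤ (∑ i ∈ t, w i * f i ^ 2) * ∑ i ∈ t, w i * g i ^ 2 :=
  Finset.sum_sq_le_sum_mul_sum_of_sq_le_mul t
    (fun i hi => mul_nonneg (hw i hi) (sq_nonneg _))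
    (fun i hi => mul_nonneg (hw i hi) (sq_nonneg _)) fun i _ => le_of_eq (by ring)

/-- The variance of a linear functional is bounded by the Hilbert-Schmidt norm of the covariance. -/
theorem sum_inner_sq_le {q : Ω → ℝ} (hq : ∀ x, 0 ≤ q x) (ξ : Ω → E) (z : E) :
    ∑ x, q x * ⟪ξ x, z⟫ ^ 2 ≤
      ‖z‖ ^ 2 * √(∑ x, q x * ∑ x', q x' * ⟪ξ x', ξ x⟫ ^ 2) := by
  set S := ∑ x, q x * ∑ x', q x' * ⟪ξ x', ξ x⟫ ^ 2 with hS
  set v := ∑ x, q x * ⟪ξ x, z⟫ ^ 2 with hv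
  have hv0 : 0 ≤ v := Finset.sum_nonneg fun x _ => mul_nonneg (hq x) (sq_nonneg _)
  have hS0 : 0 ≤ S := Finset.sum_nonneg fun x _ => mul_nonneg (hq x)
    (Finset.sum_nonneg fun x _ => mul_nonneg (hq x) (sq_nonneg _))
  -- `h` is the second moment operator applied to `z`, so `v = ⟪h, z⟫`. Cauchy–Schwarz over pairs of
  -- points gives `‖h‖ ^ 2 ≤ v * √S`; inserting this in `v ^ 2 ≤ ‖h‖ ^ 2 * ‖z‖ ^ 2` and cancelling
  -- `v` finishes the proof.
  set h : E := ∑ x, (q x * ⟪ξ x, z⟫) • ξ x with hh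
  have h1 : v = ⟪h, z⟫ := by
    rw [hh, sum_inner, hv]
    refine Finset.sum_congr rfl fun x _ => ?_
    rw [real_inner_smul_left]
    ring
  have h2 : ‖h‖ ^ 2 ≤ v * √S := by
    have e : ‖h‖ ^ 2 = ∑ p : Ω × Ω, (q p.1 * q p.2) *
        ((⟪ξ p.1, z⟫ * ⟪ξ p.2, z⟫) * ⟪ξ p.2, ξ p.1⟫) := by
      rw [← real_inner_self_eq_norm_sq, hh, Fintype.sum_prod_type, sum_inner]
      refine Finset.sum_congr rfl fun x _ => ?_
      rw [inner_sum]
      refine Finset.sum_congr rfl fun x' _ => ?_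
      rw [real_inner_smul_left, real_inner_smul_right, real_inner_comm (ξ x') (ξ x)]
      ring
    have hv2 : ∑ p : Ω × Ω, (q p.1 * q p.2) * (⟪ξ p.1, z⟫ * ⟪ξ p.2, z⟫) ^ 2 = v ^ 2 := by
      rw [Fintype.sum_prod_type, sq v, hv, Finset.sum_mul_sum]
      refine Finset.sum_congr rfl fun x _ => Finset.sum_congr rfl fun x' _ => by ring
    have hS2 : ∑ p : Ω × Ω, (q p.1 * q p.2) * ⟪ξ p.2, ξ p.1⟫ ^ 2 = S := by
      rw [Fintype.sum_prod_type, hS]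
      simp only [Finset.mul_sum, mul_assoc]
    have := sum_mul_sq_le (Finset.univ : Finset (Ω × Ω)) (w := fun p => q p.1 * q p.2)
      (fun p _ => mul_nonneg (hq _) (hq _)) (fun p => ⟪ξ p.1, z⟫ * ⟪ξ p.2, z⟫)
      (fun p => ⟪ξ p.2, ξ p.1⟫)
    rw [← e, hv2, hS2] at this
    refine abs_le_of_sq_le_sq' ?_ (by positivity) |>.2
    rwa [mul_pow, Real.sq_sqrt hS0]
  rcases hv0.eq_or_lt with hv1 | hv1
  · rw [← hv1]; positivity
  · have h3 : v ^ 2 ≤ ‖h‖ ^ 2 * ‖z‖ ^ 2 := by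
      rw [← mul_pow, h1]
      exact sq_le_sq' (by linarith [neg_le_of_abs_le (abs_real_inner_le_norm h z)])
        (real_inner_le_norm h z)
    have h4 : v * v ≤ v * (‖z‖ ^ 2 * √S) := by nlinarith [sq_nonneg ‖z‖]
    exact le_of_mul_le_mul_left h4 hv1

theorem sum_inner_sub_mean_sq_le {q : Ω → ℝ} (hq1 : ∑ x, q x = 1) (η : Ω → E) (z : E) :
    ∑ x, q x * ⟪η x - ∑ x', q x' • η x', z⟫ ^ 2 ≤ ∑ x, q x * ⟪η x, z⟫ ^ 2 := by
  set c := ⟪∑ x', q x' • η x', z⟫ with hc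
  have h : ∑ x, q x * ⟪η x, z⟫ = c := sum_mul_inner_left _ _ _
  have : ∑ x, q x * ⟪η x - ∑ x', q x' • η x', z⟫ ^ 2 =
      ∑ x, q x * ⟪η x, z⟫ ^ 2 - c ^ 2 := by
    calc _ = ∑ x, (q x * ⟪η x, z⟫ ^ 2 - 2 * c * (q x * ⟪η x, z⟫) + c ^ 2 * q x) :=
          Finset.sum_congr rfl fun x _ => by rw [inner_sub_left, ← hc]; ring
      _ = _ := by
          rw [Finset.sum_add_distrib, Finset.sum_sub_distrib, ← Finset.mul_sum, ← Finset.mul_sum,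
            h, hq1]
          ring
  rw [this]
  linarith [sq_nonneg c]

/-- Centering does not increase the Hilbert-Schmidt norm. -/
theorem hilbertSchmidt_center_le {q : Ω → ℝ} (hq : ∀ x, 0 ≤ q x) (hq1 : ∑ x, q x = 1)
    (η : Ω → E) :
    ∑ x, q x * ∑ x', q x' *
        ⟪η x' - ∑ y, q y • η y, η x - ∑ y, q y • η y⟫ ^ 2 ≤
      ∑ x, q x * ∑ x', q x' * ⟪η x', η x⟫ ^ 2 := by
  calc _ ≤ ∑ x, q x * ∑ x', q x' * ⟪η x', η x - ∑ y, q y • η y⟫ ^ 2 :=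
        Finset.sum_le_sum fun x _ => mul_le_mul_of_nonneg_left
          (sum_inner_sub_mean_sq_le hq1 η _) (hq x)
    -- By symmetry of the inner product, exchanging the sums lets the second argument be treated
    -- like the first.
    _ = ∑ x', q x' * ∑ x, q x * ⟪η x - ∑ y, q y • η y, η x'⟫ ^ 2 := by
        simp only [Finset.mul_sum]
        rw [Finset.sum_comm]
        refine Finset.sum_congr rfl fun x' _ => Finset.sum_congr rfl fun x _ => ?_
        rw [real_inner_comm]
        ring
    _ ≤ _ := Finset.sum_le_sum fun x _ => mul_le_mul_of_nonneg_left
          (sum_inner_sub_mean_sq_le hq1 η _) (hq x)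

/-- The variance of the sum over pairs. -/
theorem sampleMean_pairSum_sub_sq_le {q : Ω → ℝ} (hq : ∀ x, 0 ≤ q x) (hq1 : ∑ x, q x = 1)
    (ψ : Ω → E) {D S : ℝ} (hD : ‖∑ x, q x • ψ x‖ ^ 2 = D)
    (hS : ∑ x, q x * ∑ x', q x' *
        ⟪ψ x' - ∑ y, q y • ψ y, ψ x - ∑ y, q y • ψ y⟫ ^ 2 ≤ S ^ 2) (hS0 : 0 ≤ S) (m : ℕ) :
    sampleMean q m (fun y => (pairSum ψ y - m * (m - 1) * D) ^ 2) ≤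
      8 * m ^ 3 * D * S + 4 * m ^ 2 * S ^ 2 := by
  set μ := ∑ x, q x • ψ x with hμ
  set ξ : Ω → E := fun x => ψ x - μ with hξ
  have hξ0 : ∑ x, q x • ξ x = 0 := by
    simp only [hξ, smul_sub, Finset.sum_sub_distrib, ← Finset.sum_smul, hq1, one_smul, ← hμ,
      sub_self]
  -- Hoeffding decomposition into a degenerate quadratic part and a linear part; their second
  -- moments are bounded separately.
  have hdec : ∀ y : Fin m → Ω, pairSum ψ y - m * (m - 1) * D =
      pairSum ξ y + 2 * (m - 1) * ⟪∑ i, ξ (y i), μ⟫ := by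
    intro y
    have hψ : ∀ x, ψ x = ξ x + μ := fun x => by simp [hξ]
    simp only [pairSum, hψ, Finset.sum_add_distrib, norm_add_sq_real, Finset.sum_const,
      Finset.card_univ, Fintype.card_fin, ← Finset.mul_sum, ← sum_inner, ← hD]
    rw [← Nat.cast_smul_eq_nsmul ℝ, norm_smul, real_inner_smul_right, Real.norm_natCast]
    simp only [nsmul_eq_mul]
    ring
  set S2 := ∑ x, q x * ∑ x', q x' * ⟪ξ x', ξ x⟫ ^ 2 with hS2
  have hS20 : 0 ≤ S2 := Finset.sum_nonneg fun x _ => mul_nonneg (hq x)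
    (Finset.sum_nonneg fun x _ => mul_nonneg (hq x) (sq_nonneg _))
  have hv : ∑ x, q x * ⟪ξ x, μ⟫ ^ 2 ≤ D * S := by
    refine (sum_inner_sq_le hq ξ μ).trans ?_
    rw [hD]
    refine mul_le_mul_of_nonneg_left ?_ (hD ▸ sq_nonneg _)
    exact Real.sqrt_le_iff.2 ⟨hS0, hS⟩
  have hD0 : 0 ≤ D := hD ▸ sq_nonneg _
  calc _ ≤ sampleMean q m (fun y => 2 * pairSum ξ y ^ 2 +
          (8 * (m - 1) ^ 2) * ⟪∑ i, ξ (y i), μ⟫ ^ 2) := by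
        refine sampleMean_mono hq fun y => ?_
        rw [hdec]
        nlinarith [sq_nonneg (pairSum ξ y - 2 * (m - 1) * ⟪∑ i, ξ (y i), μ⟫)]
    _ = 2 * (2 * m * (m - 1) * S2) +
          (8 * (m - 1) ^ 2) * (m * ∑ x, q x * ⟪ξ x, μ⟫ ^ 2) := by
        rw [sampleMean_add, sampleMean_const_mul, sampleMean_const_mul,
          sampleMean_pairSum_sq hq1 hξ0, sampleMean_inner_sq hq1 hξ0]
    _ ≤ _ := by
        rcases Nat.eq_zero_or_pos m with rfl | hm
        · simp
        have hm1 : (1 : ℝ) ≤ m := by exact_mod_cast hm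
        have h1 : 2 * (2 * m * (m - 1) * S2) ≤ 4 * m ^ 2 * S ^ 2 := by
          have : (m : ℝ) * (m - 1) * S2 ≤ m * m * S ^ 2 := by gcongr; linarith
          linarith
        have h2 : (8 * ((m : ℝ) - 1) ^ 2) * (m * ∑ x, q x * ⟪ξ x, μ⟫ ^ 2) ≤
            8 * m ^ 3 * D * S := by
          have h3 : ((m : ℝ) - 1) ^ 2 ≤ m ^ 2 := by nlinarith
          have h4 : 0 ≤ ∑ x, q x * ⟪ξ x, μ⟫ ^ 2 :=
            Finset.sum_nonneg fun x _ => mul_nonneg (hq x) (sq_nonneg _)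
          calc _ ≤ (8 * (m : ℝ) ^ 2) * (m * (D * S)) := by gcongr
            _ = _ := by ring
        linarith

/-- Chebyshev's inequality for finite samples. -/
theorem sampleMean_indicator_le {q : Ω → ℝ} (hq : ∀ x, 0 ≤ q x) {m : ℕ}
    {F : (Fin m → Ω) → ℝ} (p : (Fin m → Ω) → Prop) [DecidablePred p] {T : ℝ} (hT : 0 < T)
    (hp : ∀ y, p y → T ^ 2 ≤ F y ^ 2) :
    sampleMean q m (fun y => if p y then 1 else 0) ≤ sampleMean q m (fun y => F y ^ 2) / T ^ 2 := by
  rw [div_eq_inv_mul, ← sampleMean_const_mul]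
  refine sampleMean_mono hq fun y => ?_
  split_ifs with h
  · rw [inv_mul_eq_div, le_div_iff₀ (by positivity), one_mul]
    exact hp y h
  · positivity

end Moments

/-! ### Cells of equal weight and their masses -/

theorem below_mono {u v h h' : ℕ} (huv : u ≤ v) (hh : h ≤ h') : below u v h ≤ below u v h' := by
  unfold below; omega

namespace Params

variable (I : Params)

theorem cum_succ (x : ℕ) : I.cum (x + 1) = I.cum x + I.weight x := Finset.sum_range_succ _ _

/-- For a fixed atom the overlaps are increments of `below` between consecutive cell boundaries, so
they telescope. -/
theorem sum_range_overlap {ℓ x : ℕ} (hx : x < I.n) :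
    ∑ c ∈ Finset.range ℓ, I.overlap ℓ c x = I.weight x * ℓ := by
  have hmono : Monotone fun c => below (I.cum x * ℓ) (I.cum (x + 1) * ℓ) (c * I.total) :=
    fun c c' h => below_mono (Nat.mul_le_mul_right _ (I.cum_mono (Nat.le_succ x)))
      (Nat.mul_le_mul_right _ h)
  have h := Finset.sum_range_tsub hmono ℓ
  have h1 : I.cum (x + 1) * ℓ ≤ I.total * ℓ := Nat.mul_le_mul_right _ (I.cum_mono hx)
  have h2 : I.cum (x + 1) * ℓ = I.cum x * ℓ + I.weight x * ℓ := by rw [cum_succ, add_mul]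
  calc _ = ∑ c ∈ Finset.range ℓ, (below (I.cum x * ℓ) (I.cum (x + 1) * ℓ) ((c + 1) * I.total) -
        below (I.cum x * ℓ) (I.cum (x + 1) * ℓ) (c * I.total)) :=
        Finset.sum_congr rfl fun c _ => by rw [overlap, add_mul, one_mul]
    _ = _ := by
        rw [h, mul_comm ℓ]
        unfold below
        omega

/-- For a fixed height `h` the parts of the first atoms below `h` add up to the minimum of `h` and
their total length. Subtracting this at the two boundaries of the cell leaves the length of the
cell. -/
theorem sum_overlap {ℓ c : ℕ} (hc : c < ℓ) : ∑ x : Fin I.n, I.overlap ℓ c x = I.total := by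
  have key : ∀ h, ∀ m ≤ I.n, ∑ x ∈ Finset.range m, below (I.cum x * ℓ) (I.cum (x + 1) * ℓ) h =
      h - (h - I.cum m * ℓ) := by
    intro h m hm
    induction m with
    | zero => simp [cum]
    | succ m ih =>
      have h1 : I.cum m * ℓ ≤ I.cum (m + 1) * ℓ := Nat.mul_le_mul_right _ (I.cum_mono (by omega))
      rw [Finset.sum_range_succ, ih (by omega)]
      unfold below
      omega
  have h1 : c * I.total + I.total ≤ I.cum I.n * ℓ := by
    calc c * I.total + I.total = I.total * (c + 1) := by ring
      _ ≤ I.total * ℓ := Nat.mul_le_mul_left _ hc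
  rw [Fin.sum_univ_eq_sum_range (fun x => I.overlap ℓ c x)]
  unfold overlap
  rw [← Nat.cast_inj (R := ℤ), Nat.cast_sum]
  have h2 : ∀ x, ((below (I.cum x * ℓ) (I.cum (x + 1) * ℓ) (c * I.total + I.total) -
      below (I.cum x * ℓ) (I.cum (x + 1) * ℓ) (c * I.total) : ℕ) : ℤ) =
      (below (I.cum x * ℓ) (I.cum (x + 1) * ℓ) (c * I.total + I.total) : ℤ) -
        (below (I.cum x * ℓ) (I.cum (x + 1) * ℓ) (c * I.total) : ℤ) := fun x =>
    Nat.cast_sub (below_mono (Nat.mul_le_mul_right _ (I.cum_mono (by omega))) (by omega))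
  simp only [h2, Finset.sum_sub_distrib]
  rw [← Nat.cast_sum, ← Nat.cast_sum, key _ _ le_rfl, key _ _ le_rfl]
  omega

/-- The sum telescopes over the sixteen subcells. The factor arises because one unit of length at
the coarser level is sixteen units at the finer one. -/
theorem sum_overlap_children (ℓ c x : ℕ) :
    ∑ i ∈ Finset.range 16, I.overlap (16 * ℓ) (16 * c + i) x = 16 * I.overlap ℓ c x := by
  have hle : I.cum x ≤ I.cum (x + 1) := I.cum_mono (by omega)
  have hmono : Monotone fun i => below (I.cum x * (16 * ℓ)) (I.cum (x + 1) * (16 * ℓ))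
      ((16 * c + i) * I.total) :=
    fun i i' h => below_mono (Nat.mul_le_mul_right _ hle)
      (Nat.mul_le_mul_right _ (Nat.add_le_add_left h _))
  have h := Finset.sum_range_tsub hmono 16
  have h3 : I.cum x * (16 * ℓ) = 16 * (I.cum x * ℓ) := by ring
  have h4 : I.cum (x + 1) * (16 * ℓ) = 16 * (I.cum (x + 1) * ℓ) := by ring
  have h5 : (16 * c + 16) * I.total = 16 * (c * I.total + I.total) := by ring
  have h6 : (16 * c + 0) * I.total = 16 * (c * I.total) := by ring
  calc _ = ∑ i ∈ Finset.range 16, (below (I.cum x * (16 * ℓ)) (I.cum (x + 1) * (16 * ℓ))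
        ((16 * c + (i + 1)) * I.total) -
        below (I.cum x * (16 * ℓ)) (I.cum (x + 1) * (16 * ℓ)) ((16 * c + i) * I.total)) :=
        Finset.sum_congr rfl fun i _ => by
          rw [overlap, ← add_assoc (16 * c) i 1, add_mul _ 1, one_mul]
    _ = _ := by
        rw [h, h3, h4, h5, h6]
        unfold overlap below
        omega

/-- The fraction of the atom `x` in the cell `c` among `ℓ` cells. -/
noncomputable def frac (ℓ c x : ℕ) : ℝ := I.overlap ℓ c x / (I.weight x * ℓ)

theorem frac_nonneg (ℓ c x : ℕ) : 0 ≤ I.frac ℓ c x := by unfold frac; positivity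

/-- Equality can fail: an atom of weight zero has the fraction `0 / 0 = 0` in every cell, so its
mass is lost. Later arguments need only the upper bound. -/
theorem sum_range_frac_le {ℓ x : ℕ} (hx : x < I.n) :
    ∑ c ∈ Finset.range ℓ, I.frac ℓ c x ≤ 1 := by
  unfold frac
  rw [← Finset.sum_div, ← Nat.cast_sum, I.sum_range_overlap hx]
  push_cast
  exact div_self_le_one _

theorem sum_frac_children (ℓ c x : ℕ) :
    ∑ i ∈ Finset.range 16, I.frac (16 * ℓ) (16 * c + i) x = I.frac ℓ c x := by
  unfold frac
  rw [← Finset.sum_div, ← Nat.cast_sum, I.sum_overlap_children]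
  push_cast
  rw [mul_left_comm, mul_div_mul_left _ _ (by norm_num)]

/-- The mass of a cell under `q`. -/
noncomputable def cellMass (q : Fin I.n → ℝ) (ℓ c : ℕ) : ℝ := ∑ x, q x * I.frac ℓ c x

/-- The deficit of the mass of a cell under `q`. -/
noncomputable def deficit (q : Fin I.n → ℝ) (ℓ c : ℕ) : ℝ := 1 / ℓ - I.cellMass q ℓ c

theorem overlap_eq_zero_of_weight {x : ℕ} (h : I.weight x = 0) (ℓ c : ℕ) :
    I.overlap ℓ c x = 0 := by
  unfold overlap below
  rw [cum_succ, h, add_zero]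
  omega

/-- This is the purpose of the cells: they turn the distribution given by the weights into the
uniform one. -/
theorem cellMass_weight {ℓ c : ℕ} (hc : c < ℓ) (hA : 0 < I.total) :
    I.cellMass (fun x => I.weight x / I.total) ℓ c = 1 / ℓ := by
  have hℓ : (ℓ : ℝ) ≠ 0 := by exact_mod_cast (show ℓ ≠ 0 by omega)
  have hA' : (I.total : ℝ) ≠ 0 := by positivity
  have : ∀ x : Fin I.n, (I.weight x : ℝ) / I.total * I.frac ℓ c x =
      I.overlap ℓ c x / (I.total * ℓ) := by
    intro x
    by_cases hw : I.weight x = 0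
    · simp [hw, I.overlap_eq_zero_of_weight hw]
    · have : (I.weight x : ℝ) ≠ 0 := by exact_mod_cast hw
      unfold frac
      field_simp
  unfold cellMass
  simp only [this]
  rw [← Finset.sum_div, ← Nat.cast_sum, I.sum_overlap hc]
  field_simp

theorem sum_deficit_children (q : Fin I.n → ℝ) (ℓ c : ℕ) :
    ∑ i ∈ Finset.range 16, I.deficit q (16 * ℓ) (16 * c + i) = I.deficit q ℓ c := by
  unfold deficit cellMass
  rw [Finset.sum_sub_distrib, Finset.sum_comm]
  simp only [← Finset.mul_sum, I.sum_frac_children]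
  simp only [Finset.sum_const, Finset.card_range, nsmul_eq_mul]
  push_cast
  congr 1
  rw [one_div, mul_inv]
  ring

/-! ### Cells inside a block of consecutive atoms -/

/-- The cells among `ℓ` cells inside the union of the atoms `x, …, y - 1`. -/
def inside (x y ℓ : ℕ) : Finset ℕ :=
  {c ∈ Finset.range ℓ | I.cum x * ℓ ≤ c * I.total ∧ (c + 1) * I.total ≤ I.cum y * ℓ}

/-- The cells inside the union of the atoms `x, …, y - 1` whose parents are not. -/
def maximalInside (x y ℓ : ℕ) : Finset ℕ :=
  {c ∈ I.inside x y (16 * ℓ) | c / 16 ∉ I.inside x y ℓ}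

variable {I}

theorem mem_inside {x y ℓ c : ℕ} : c ∈ I.inside x y ℓ ↔
    c < ℓ ∧ I.cum x * ℓ ≤ c * I.total ∧ (c + 1) * I.total ≤ I.cum y * ℓ := by
  simp [inside]

theorem overlap_eq_zero {x y z ℓ c : ℕ} (hc : c ∈ I.inside x y ℓ) (hz : z < x ∨ y ≤ z) :
    I.overlap ℓ c z = 0 := by
  obtain ⟨-, h₁, h₂⟩ := mem_inside.1 hc
  rw [add_mul, one_mul] at h₂
  have h₃ : I.cum z * ℓ ≤ I.cum (z + 1) * ℓ := Nat.mul_le_mul_right _ (I.cum_mono (by omega))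
  unfold overlap below
  rcases hz with hz | hz
  · have : I.cum (z + 1) * ℓ ≤ I.cum x * ℓ := Nat.mul_le_mul_right _ (I.cum_mono hz)
    omega
  · have : I.cum y * ℓ ≤ I.cum z * ℓ := Nat.mul_le_mul_right _ (I.cum_mono hz)
    omega

/-- Cells inside the block meet no other atoms. Mass at the uncovered ends is dropped, which is
harmless because the blocks of interest have too little mass. -/
theorem sum_cellMass_inside_le {q : Fin I.n → ℝ} (hq : ∀ x, 0 ≤ q x) (x y ℓ : ℕ) :
    ∑ c ∈ I.inside x y ℓ, I.cellMass q ℓ c ≤ ∑ z : Fin I.n with x ≤ z.1 ∧ z.1 < y, q z := by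
  unfold cellMass
  rw [Finset.sum_comm, Finset.sum_filter]
  refine Finset.sum_le_sum fun z _ => ?_
  rw [← Finset.mul_sum]
  split_ifs with hz
  · refine mul_le_of_le_one_right (hq z) ?_
    refine le_trans (Finset.sum_le_sum_of_subset_of_nonneg (Finset.filter_subset _ _) ?_)
      (I.sum_range_frac_le z.2)
    exact fun c _ _ => I.frac_nonneg _ _ _
  · rw [Finset.sum_eq_zero, mul_zero]
    intro c hc
    rw [frac, overlap_eq_zero hc (by omega), Nat.cast_zero, zero_div]

/-- At each end of the block at most one cell is cut off. -/
theorem le_card_inside {x y ℓ : ℕ} (hA : 0 < I.total) (hy : y ≤ I.n) :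
    ((I.cum y : ℝ) - I.cum x) / I.total * ℓ - 2 ≤ (I.inside x y ℓ).card := by
  have hsub : Finset.Ico (I.cum x * ℓ / I.total + 1) (I.cum y * ℓ / I.total) ⊆
      I.inside x y ℓ := by
    intro c hc
    obtain ⟨h₁, h₂⟩ := Finset.mem_Ico.1 hc
    have h₃ : (c + 1) * I.total ≤ I.cum y * ℓ := by
      rw [← Nat.le_div_iff_mul_le hA]; exact h₂
    refine mem_inside.2 ⟨?_, ?_, h₃⟩
    · have h₄ : (c + 1) * I.total ≤ ℓ * I.total :=
        h₃.trans (by rw [mul_comm ℓ]; exact Nat.mul_le_mul_right _ (I.cum_mono hy))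
      exact Nat.le_of_mul_le_mul_right h₄ hA
    · have := (Nat.div_lt_iff_lt_mul hA).1 (Nat.lt_of_succ_le h₁)
      exact this.le
  have hcard := Finset.card_le_card hsub
  rw [Nat.card_Ico] at hcard
  have h₁ : I.cum y * ℓ < (I.cum y * ℓ / I.total + 1) * I.total := by
    rw [mul_comm _ I.total]; exact Nat.lt_mul_div_succ _ hA
  have h₂ : I.cum x * ℓ / I.total * I.total ≤ I.cum x * ℓ := Nat.div_mul_le_self _ _
  have hA' : (0 : ℝ) < I.total := by exact_mod_cast hA
  have h₁' : (I.cum y : ℝ) * ℓ / I.total ≤ (I.cum y * ℓ / I.total : ℕ) + 1 := by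
    rw [div_le_iff₀ hA']
    exact_mod_cast h₁.le
  have h₂' : ((I.cum x * ℓ / I.total : ℕ) : ℝ) ≤ (I.cum x : ℝ) * ℓ / I.total := by
    rw [le_div_iff₀ hA']
    exact_mod_cast h₂
  have hcard' : ((I.cum y * ℓ / I.total : ℕ) : ℝ) ≤
      (I.cum x * ℓ / I.total : ℕ) + 1 + (I.inside x y ℓ).card := by
    have : I.cum y * ℓ / I.total ≤ I.cum x * ℓ / I.total + 1 + (I.inside x y ℓ).card := by omega
    exact_mod_cast this
  have e : ((I.cum y : ℝ) - I.cum x) / I.total * ℓ =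
      (I.cum y : ℝ) * ℓ / I.total - (I.cum x : ℝ) * ℓ / I.total := by ring
  rw [e]
  linarith

theorem disjoint_inside {x y x' y' ℓ : ℕ} (hA : 0 < I.total) (h : y ≤ x' ∨ y' ≤ x) :
    Disjoint (I.inside x y ℓ) (I.inside x' y' ℓ) := by
  rw [Finset.disjoint_left]
  intro c hc hc'
  obtain ⟨-, h₁, h₂⟩ := mem_inside.1 hc
  obtain ⟨-, h₃, h₄⟩ := mem_inside.1 hc'
  rw [add_mul] at h₂ h₄
  rcases h with h | h
  · have : I.cum y * ℓ ≤ I.cum x' * ℓ := Nat.mul_le_mul_right _ (I.cum_mono h)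
    omega
  · have : I.cum y' * ℓ ≤ I.cum x * ℓ := Nat.mul_le_mul_right _ (I.cum_mono h)
    omega

/-- If a cell lies inside the block and its parent does not, an end of the block falls into the
parent. Each of the two ends determines one parent, which has sixteen children. -/
theorem card_maximalInside_le (x y ℓ : ℕ) (hA : 0 < I.total) :
    (I.maximalInside x y ℓ).card ≤ 32 := by
  have hsub : I.maximalInside x y ℓ ⊆
      (Finset.range 16).image (fun i => 16 * (I.cum x * ℓ / I.total) + i) ∪
        (Finset.range 16).image (fun i => 16 * (I.cum y * ℓ / I.total) + i) := by
    intro c hc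
    obtain ⟨hc, hn⟩ := Finset.mem_filter.1 hc
    obtain ⟨h₀, h₁, h₂⟩ := mem_inside.1 hc
    have hmod := Nat.div_add_mod c 16
    have hlt := Nat.mod_lt c (show 0 < 16 by norm_num)
    set d := c / 16
    have hA₁ : 16 * (I.cum x * ℓ) ≤ c * I.total := by linarith
    have hA₂ : (c + 1) * I.total ≤ 16 * (I.cum y * ℓ) := by linarith
    have hcase : I.cum x * ℓ / I.total = d ∨ I.cum y * ℓ / I.total = d := by
      by_contra! hne
      apply hn
      refine mem_inside.2 ⟨by omega, ?_, ?_⟩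
      · by_contra! hlt'
        apply hne.1
        rw [Nat.div_eq_iff hA]
        have : c * I.total < (16 * (d + 1)) * I.total := Nat.mul_lt_mul_of_pos_right (by omega) hA
        constructor
        · exact hlt'.le
        · have : 16 * (I.cum x * ℓ) < 16 * (d * I.total + I.total) := by linarith
          omega
      · by_contra! hlt'
        apply hne.2
        rw [Nat.div_eq_iff hA]
        have : (16 * d) * I.total ≤ c * I.total := Nat.mul_le_mul_right _ (by omega)
        have h5 : 16 * (d * I.total) + I.total ≤ 16 * (I.cum y * ℓ) := by linarith
        rw [add_mul] at hlt'
        constructor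
        · omega
        · omega
    rw [Finset.mem_union]
    rcases hcase with h | h
    · exact Or.inl (Finset.mem_image.2 ⟨c % 16, Finset.mem_range.2 hlt, by rw [h]; exact hmod⟩)
    · exact Or.inr (Finset.mem_image.2 ⟨c % 16, Finset.mem_range.2 hlt, by rw [h]; exact hmod⟩)
  refine (Finset.card_le_card hsub).trans ((Finset.card_union_le _ _).trans ?_)
  have h₁ := Finset.card_image_le (s := Finset.range 16)
    (f := fun i => 16 * (I.cum x * ℓ / I.total) + i)
  have h₂ := Finset.card_image_le (s := Finset.range 16)
    (f := fun i => 16 * (I.cum y * ℓ / I.total) + i)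
  rw [Finset.card_range] at h₁ h₂
  omega

/-- Finer cells with a parent inside the block come in complete families of sixteen, whose deficits
add up to that of the parent. The remaining ones are the maximal cells. -/
theorem sum_deficit_inside (q : Fin I.n → ℝ) (x y ℓ : ℕ) :
    ∑ c ∈ I.inside x y (16 * ℓ), I.deficit q (16 * ℓ) c =
      ∑ c ∈ I.inside x y ℓ, I.deficit q ℓ c +
        ∑ c ∈ I.maximalInside x y ℓ, I.deficit q (16 * ℓ) c := by
  rw [maximalInside, ← Finset.sum_filter_add_sum_filter_not (I.inside x y (16 * ℓ))
    (fun c => c / 16 ∈ I.inside x y ℓ)]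
  congr 1
  simp only [← I.sum_deficit_children q ℓ]
  rw [← Finset.sum_product']
  refine Finset.sum_nbij' (fun c => (c / 16, c % 16)) (fun p => 16 * p.1 + p.2) ?_ ?_ ?_ ?_ ?_
  · intro c hc
    exact Finset.mem_product.2 ⟨(Finset.mem_filter.1 hc).2,
      Finset.mem_range.2 (Nat.mod_lt _ (by norm_num))⟩
  · rintro ⟨d, i⟩ hp
    obtain ⟨hd, hi⟩ := Finset.mem_product.1 hp
    simp only [Finset.mem_range] at hi hd ⊢
    have hdiv : (16 * d + i) / 16 = d := by omega
    refine Finset.mem_filter.2 ⟨?_, by rwa [hdiv]⟩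
    obtain ⟨h₀, h₁, h₂⟩ := mem_inside.1 hd
    refine mem_inside.2 ⟨by omega, ?_, ?_⟩
    · have : 16 * d * I.total ≤ (16 * d + i) * I.total := Nat.mul_le_mul_right _ (by omega)
      linarith
    · have : (16 * d + i + 1) * I.total ≤ (16 * (d + 1)) * I.total :=
        Nat.mul_le_mul_right _ (by omega)
      linarith
  · intro c _
    exact Nat.div_add_mod c 16
  · rintro ⟨d, i⟩ hp
    obtain ⟨hd, hi⟩ := Finset.mem_product.1 hp
    simp only [Finset.mem_range] at hi
    simp only [Prod.mk.injEq]
    omega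
  · intro c _
    rw [Nat.div_add_mod]

theorem sum_weight_block {x y : ℕ} (hxy : x ≤ y) (hy : y ≤ I.n) :
    ∑ z : Fin I.n with x ≤ z.1 ∧ z.1 < y, (I.weight z : ℝ) = (I.cum y : ℝ) - I.cum x := by
  rw [Finset.sum_filter, Fin.sum_univ_eq_sum_range (fun z => if x ≤ z ∧ z < y then
    (I.weight z : ℝ) else 0), ← Finset.sum_filter]
  have : (Finset.range I.n).filter (fun z => x ≤ z ∧ z < y) = Finset.Ico x y := by
    ext z
    simp only [Finset.mem_filter, Finset.mem_range, Finset.mem_Ico]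
    omega
  rw [this, Finset.sum_Ico_eq_sub _ hxy, cum, cum]
  push_cast
  rfl

end Params

/-! ### Many disjoint blocks -/

namespace Params

variable {I : Params}

theorem sq_sum_maximal_le {ι : Type*} {t : Finset ι} (C : ι → Finset ℕ) {ℓ N : ℕ}
    (hC : ∀ i ∈ t, C i ⊆ Finset.range ℓ)
    (hdisj : (t : Set ι).PairwiseDisjoint C) (hcard : ∑ i ∈ t, (C i).card ≤ N) (g : ℕ → ℝ) :
    (∑ i ∈ t, ∑ c ∈ C i, |g c|) ^ 2 ≤ N * ∑ c ∈ Finset.range ℓ, g c ^ 2 := by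
  classical
  rw [← Finset.sum_biUnion hdisj]
  refine (sq_sum_le_card_mul_sum_sq).trans ?_
  simp only [sq_abs]
  refine mul_le_mul ?_ ?_ (Finset.sum_nonneg fun _ _ => sq_nonneg _) (by positivity)
  · rw [Finset.card_biUnion hdisj]
    exact_mod_cast hcard
  · exact Finset.sum_le_sum_of_subset_of_nonneg (Finset.biUnion_subset.2 hC)
      fun _ _ _ => sq_nonneg _

/-- The weighted squared distance of `q` and the weights on all levels. -/
noncomputable def energy (I : Params) (q : Fin I.n → ℝ) (N : ℕ) : ℝ :=
  ∑ j ∈ Finset.range N, 2 ^ j * ∑ c ∈ Finset.range (I.k * 16 ^ j), I.deficit q (I.k * 16 ^ j) c ^ 2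

/-- The new cells of a level inside a block. -/
def newCells (I : Params) (x y : ℕ) : ℕ → Finset ℕ
  | 0 => I.inside x y I.k
  | j + 1 => I.maximalInside x y (I.k * 16 ^ j)

theorem sum_deficit_inside_eq (q : Fin I.n → ℝ) (x y j : ℕ) :
    ∑ c ∈ I.inside x y (I.k * 16 ^ j), I.deficit q (I.k * 16 ^ j) c =
      ∑ i ∈ Finset.range (j + 1), ∑ c ∈ I.newCells x y i, I.deficit q (I.k * 16 ^ i) c := by
  induction j with
  | zero => simp [newCells]
  | succ j ih =>
    have e : I.k * 16 ^ (j + 1) = 16 * (I.k * 16 ^ j) := by ring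
    rw [Finset.sum_range_succ, ← ih, e, sum_deficit_inside, newCells]

theorem newCells_subset (x y j : ℕ) : I.newCells x y j ⊆ I.inside x y (I.k * 16 ^ j) := by
  cases j with
  | zero => simp [newCells]
  | succ j =>
    have e : I.k * 16 ^ (j + 1) = 16 * (I.k * 16 ^ j) := by ring
    rw [e]
    exact Finset.filter_subset _ _

theorem sum_two_inv_pow_le (N : ℕ) : ∑ j ∈ Finset.range N, ((2 : ℝ) ^ j)⁻¹ ≤ 2 := by
  simp only [← inv_pow]
  rw [inv_eq_one_div]
  exact sum_geometric_two_le N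

/-- The cells of the finest level inside a block fill it up to weight `2 / ℓ`, and their total
deficit equals that of the new cells of all levels. At most `32 * k` new cells occur on a level,
however many cells that level has, so Cauchy–Schwarz loses only a factor of order `k`. -/
theorem sum_le_of_blocks {q : Fin I.n → ℝ} (hq : ∀ x, 0 ≤ q x) (hA : 0 < I.total)
    {ι : Type*} (t : Finset ι) (ht : t.card ≤ I.k) (hk : 0 < I.k) (lo hi : ι → ℕ)
    (hlohi : ∀ i ∈ t, lo i ≤ hi i) (hhi : ∀ i ∈ t, hi i ≤ I.n)
    (hdisj : ∀ i ∈ t, ∀ j ∈ t, i ≠ j → hi i ≤ lo j ∨ hi j ≤ lo i) (J : ℕ) :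
    ∑ i ∈ t, (∑ z : Fin I.n with lo i ≤ z.1 ∧ z.1 < hi i,
      ((I.weight z : ℝ) / I.total - q z)) ≤
      √(64 * I.k * I.energy q (J + 1)) + 2 / 16 ^ J := by
  set ℓ := I.k * 16 ^ J with hℓ
  have hℓ0 : (0 : ℝ) < ℓ := by rw [hℓ]; positivity
  have step : ∀ i ∈ t, (∑ z : Fin I.n with lo i ≤ z.1 ∧ z.1 < hi i,
      ((I.weight z : ℝ) / I.total - q z)) ≤
      ∑ j ∈ Finset.range (J + 1), ∑ c ∈ I.newCells (lo i) (hi i) j,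
        |I.deficit q (I.k * 16 ^ j) c| + 2 / ℓ := by
    intro i hit
    rw [Finset.sum_sub_distrib, ← Finset.sum_div, sum_weight_block (hlohi i hit) (hhi i hit)]
    have h1 := sum_cellMass_inside_le hq (lo i) (hi i) ℓ
    have h2 := le_card_inside (x := lo i) (ℓ := ℓ) hA (hhi i hit)
    have h3 := sum_deficit_inside_eq q (lo i) (hi i) J
    rw [← hℓ] at h3
    have h4 : ∑ j ∈ Finset.range (J + 1), ∑ c ∈ I.newCells (lo i) (hi i) j,
        I.deficit q (I.k * 16 ^ j) c ≤ ∑ j ∈ Finset.range (J + 1),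
          ∑ c ∈ I.newCells (lo i) (hi i) j, |I.deficit q (I.k * 16 ^ j) c| :=
      Finset.sum_le_sum fun j _ => Finset.sum_le_sum fun c _ => le_abs_self _
    have h5 : ∑ c ∈ I.inside (lo i) (hi i) ℓ, I.deficit q ℓ c =
        (I.inside (lo i) (hi i) ℓ).card / ℓ -
          ∑ c ∈ I.inside (lo i) (hi i) ℓ, I.cellMass q ℓ c := by
      simp only [deficit, Finset.sum_sub_distrib, Finset.sum_const, nsmul_eq_mul, mul_one_div]
    have h6 : ((I.cum (hi i) : ℝ) - I.cum (lo i)) / I.total ≤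
        (I.inside (lo i) (hi i) ℓ).card / ℓ + 2 / ℓ := by
      rw [← add_div, le_div_iff₀ hℓ0]
      linarith
    linarith
  set T : ℕ → ℝ := fun j => ∑ i ∈ t, ∑ c ∈ I.newCells (lo i) (hi i) j,
    |I.deficit q (I.k * 16 ^ j) c| with hT
  have hpd : ∀ j, (t : Set ι).PairwiseDisjoint fun i => I.newCells (lo i) (hi i) j :=
    fun j i hi' i' hi'' hne => (disjoint_inside hA (hdisj i hi' i' hi'' hne)).mono
      (newCells_subset _ _ _) (newCells_subset _ _ _)
  have hTj : ∀ j, T j ^ 2 ≤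
      32 * I.k * ∑ c ∈ Finset.range (I.k * 16 ^ j), I.deficit q (I.k * 16 ^ j) c ^ 2 := by
    intro j
    have hsub : ∀ i ∈ t, I.newCells (lo i) (hi i) j ⊆ Finset.range (I.k * 16 ^ j) :=
      fun i _ => (newCells_subset _ _ _).trans (Finset.filter_subset _ _)
    -- On the coarsest level there are only `k` cells in total; on later levels each of the at most
    -- `k` blocks has at most 32 new ones.
    have hcard : ∑ i ∈ t, (I.newCells (lo i) (hi i) j).card ≤ 32 * I.k := by
      classical
      cases j with
      | zero =>
        rw [← Finset.card_biUnion (hpd 0)]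
        refine (Finset.card_le_card (Finset.biUnion_subset.2 hsub)).trans ?_
        rw [Finset.card_range]
        omega
      | succ j =>
        refine (Finset.sum_le_card_nsmul _ _ 32 fun i _ => card_maximalInside_le _ _ _ hA).trans ?_
        rw [smul_eq_mul]
        omega
    have := sq_sum_maximal_le _ hsub (hpd j) hcard (I.deficit q (I.k * 16 ^ j))
    push_cast at this
    exact this
  have hsum : (∑ j ∈ Finset.range (J + 1), T j) ^ 2 ≤ 64 * I.k * I.energy q (J + 1) := by
    -- Cauchy–Schwarz across the levels: the weights 2^(-j) have sum at most 2, and their inverses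
    -- are the weights in `energy`.
    have h1 := Finset.sum_sq_le_sum_mul_sum_of_sq_le_mul (Finset.range (J + 1)) (r := T)
      (f := fun j => ((2 : ℝ) ^ j)⁻¹) (g := fun j => 2 ^ j * T j ^ 2) (fun j _ => by positivity)
      (fun j _ => by positivity) (fun j _ => by
        rw [← mul_assoc, inv_mul_cancel₀ (by positivity), one_mul])
    have h2 : ∑ j ∈ Finset.range (J + 1), 2 ^ j * T j ^ 2 ≤ 32 * I.k * I.energy q (J + 1) := by
      rw [energy, Finset.mul_sum]
      refine Finset.sum_le_sum fun j _ => ?_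
      calc _ ≤ (2 : ℝ) ^ j * (32 * I.k * _) := mul_le_mul_of_nonneg_left (hTj j) (by positivity)
        _ = _ := by ring
    have h3 : 0 ≤ ∑ j ∈ Finset.range (J + 1), (2 : ℝ) ^ j * T j ^ 2 := by positivity
    have h4 := mul_le_mul_of_nonneg_right (sum_two_inv_pow_le (J + 1)) h3
    linarith
  calc _ ≤ ∑ i ∈ t, (∑ j ∈ Finset.range (J + 1), ∑ c ∈ I.newCells (lo i) (hi i) j,
        |I.deficit q (I.k * 16 ^ j) c| + 2 / (ℓ : ℝ)) := Finset.sum_le_sum step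
    _ = ∑ j ∈ Finset.range (J + 1), T j + t.card * (2 / (ℓ : ℝ)) := by
        rw [Finset.sum_add_distrib, Finset.sum_comm, Finset.sum_const, nsmul_eq_mul]
    _ ≤ _ := by
        refine add_le_add (Real.le_sqrt_of_sq_le hsum) ?_
        have : (t.card : ℝ) ≤ I.k := by exact_mod_cast ht
        have hk' : (0 : ℝ) < I.k := by exact_mod_cast hk
        calc (t.card : ℝ) * (2 / ℓ) ≤ I.k * (2 / ℓ) := by gcongr
          _ = 2 / 16 ^ J := by
            rw [hℓ]
            push_cast
            field_simp

end Params

namespace Params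

variable (I : Params)

/-! ### Rounded fractions -/

/-- The fraction of the atom `x` in the cell `c` among `ℓ` cells, after rounding. -/
noncomputable def roundedFrac (ℓ c x : ℕ) : ℝ := I.share ℓ c x / (I.scale * ℓ)

theorem roundedFrac_nonneg (ℓ c x : ℕ) : 0 ≤ I.roundedFrac ℓ c x := by
  unfold roundedFrac; positivity

theorem share_eq (ℓ c x : ℕ) : I.share ℓ c x = I.overlap ℓ c x * I.scale / I.weight x := by
  rw [share, cum_succ, Nat.add_sub_cancel_left]

theorem roundedFrac_le (hb : 0 < I.scale) {ℓ : ℕ} (hℓ : 0 < ℓ) (c x : ℕ) :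
    I.roundedFrac ℓ c x ≤ I.frac ℓ c x := by
  have hb' : (0 : ℝ) < I.scale := by exact_mod_cast hb
  have hℓ' : (0 : ℝ) < ℓ := by exact_mod_cast hℓ
  have h : (I.share ℓ c x : ℝ) ≤ I.overlap ℓ c x * I.scale / I.weight x := by
    rw [share_eq]
    exact_mod_cast Nat.cast_div_le (α := ℝ) (m := I.overlap ℓ c x * I.scale) (n := I.weight x)
  unfold roundedFrac frac
  rw [div_le_iff₀ (by positivity)]
  calc _ ≤ _ := h
    _ = _ := by field_simp

theorem frac_le_roundedFrac_add (hb : 0 < I.scale) {ℓ : ℕ} (hℓ : 0 < ℓ) (c x : ℕ) :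
    I.frac ℓ c x ≤ I.roundedFrac ℓ c x + 1 / (I.scale * ℓ) := by
  have hb' : (0 : ℝ) < I.scale := by exact_mod_cast hb
  have hℓ' : (0 : ℝ) < ℓ := by exact_mod_cast hℓ
  have h : (I.overlap ℓ c x : ℝ) * I.scale / I.weight x ≤ I.share ℓ c x + 1 := by
    rcases Nat.eq_zero_or_pos (I.weight x) with hw | hw
    · rw [hw, Nat.cast_zero, div_zero]
      positivity
    · rw [share_eq, div_le_iff₀ (by exact_mod_cast hw)]
      have := Nat.lt_mul_div_succ (I.overlap ℓ c x * I.scale) hw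
      rw [mul_comm (I.weight x)] at this
      exact_mod_cast this.le
  unfold roundedFrac frac
  rw [← add_div, le_div_iff₀ (by positivity)]
  calc _ = (I.overlap ℓ c x : ℝ) * I.scale / I.weight x := by field_simp
    _ ≤ _ := h

/-- The deficit of the mass of a cell under `q`, computed from rounded fractions. -/
noncomputable def roundedDeficit (q : Fin I.n → ℝ) (ℓ c : ℕ) : ℝ :=
  1 / ℓ - ∑ x, q x * I.roundedFrac ℓ c x

/-- The weighted squared distance of `q` and the weights on all levels, computed from rounded
fractions. -/
noncomputable def roundedEnergy (q : Fin I.n → ℝ) (N : ℕ) : ℝ :=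
  ∑ j ∈ Finset.range N,
    2 ^ j * ∑ c ∈ Finset.range (I.k * 16 ^ j), I.roundedDeficit q (I.k * 16 ^ j) c ^ 2

variable {I}

theorem abs_deficit_sub_le {q : Fin I.n → ℝ} (hq : ∀ x, 0 ≤ q x) (hq1 : ∑ x, q x = 1)
    (hb : 0 < I.scale) {ℓ : ℕ} (hℓ : 0 < ℓ) (c : ℕ) :
    |I.deficit q ℓ c - I.roundedDeficit q ℓ c| ≤ 1 / (I.scale * ℓ) := by
  have e : I.deficit q ℓ c - I.roundedDeficit q ℓ c =
      -∑ x, q x * (I.frac ℓ c x - I.roundedFrac ℓ c x) := by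
    simp only [deficit, roundedDeficit, cellMass, mul_sub, Finset.sum_sub_distrib]
    ring
  rw [e, abs_neg, abs_of_nonneg (Finset.sum_nonneg fun x _ => mul_nonneg (hq x)
    (sub_nonneg.2 (I.roundedFrac_le hb hℓ c x)))]
  calc _ ≤ ∑ x, q x * (1 / (I.scale * ℓ)) := Finset.sum_le_sum fun x _ =>
        mul_le_mul_of_nonneg_left
          (by linarith [I.frac_le_roundedFrac_add hb hℓ c x]) (hq x)
    _ = _ := by rw [← Finset.sum_mul, hq1, one_mul]

/-- By u² ≤ 2v² + 2(u-v)², the rounding errors of level j contribute at most 2/(scale²·k)·(2/16)^j,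
which is summable. The form with `u` and `v` serves both directions of the comparison. -/
theorem levels_sum_sq_le (hk : 0 < I.k) (hb : 0 < I.scale) {u v : ℕ → ℕ → ℝ} (N : ℕ)
    (h : ∀ j c, |u (I.k * 16 ^ j) c - v (I.k * 16 ^ j) c| ≤ 1 / (I.scale * (I.k * 16 ^ j : ℕ))) :
    ∑ j ∈ Finset.range N, 2 ^ j * ∑ c ∈ Finset.range (I.k * 16 ^ j), u (I.k * 16 ^ j) c ^ 2 ≤
      2 * ∑ j ∈ Finset.range N, 2 ^ j * ∑ c ∈ Finset.range (I.k * 16 ^ j),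
        v (I.k * 16 ^ j) c ^ 2 + 4 / (I.scale ^ 2 * I.k) := by
  have hb' : (0 : ℝ) < I.scale := by exact_mod_cast hb
  have hk' : (0 : ℝ) < I.k := by exact_mod_cast hk
  have hj : ∀ j, (2 : ℝ) ^ j * ∑ c ∈ Finset.range (I.k * 16 ^ j), u (I.k * 16 ^ j) c ^ 2 ≤
      2 * (2 ^ j * ∑ c ∈ Finset.range (I.k * 16 ^ j), v (I.k * 16 ^ j) c ^ 2) +
        2 / (I.scale ^ 2 * I.k) * ((2 : ℝ) ^ j)⁻¹ := by
    intro j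
    have h1 : ∑ c ∈ Finset.range (I.k * 16 ^ j), u (I.k * 16 ^ j) c ^ 2 ≤
        ∑ c ∈ Finset.range (I.k * 16 ^ j), (2 * v (I.k * 16 ^ j) c ^ 2 +
          2 * (1 / (I.scale * (I.k * 16 ^ j : ℕ))) ^ 2) := by
      refine Finset.sum_le_sum fun c _ => ?_
      have := sq_le_sq' (neg_le_of_abs_le (h j c)) (le_of_abs_le (h j c))
      nlinarith [sq_nonneg (u (I.k * 16 ^ j) c - 2 * v (I.k * 16 ^ j) c)]
    rw [Finset.sum_add_distrib, ← Finset.mul_sum, Finset.sum_const, Finset.card_range,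
      nsmul_eq_mul] at h1
    have h2 : (2 : ℝ) ^ j * ((I.k * 16 ^ j : ℕ) * (2 * (1 / (I.scale * (I.k * 16 ^ j : ℕ))) ^ 2))
        ≤ 2 / (I.scale ^ 2 * I.k) * ((2 : ℝ) ^ j)⁻¹ := by
      have e : (2 : ℝ) ^ j * ((I.k * 16 ^ j : ℕ) *
          (2 * (1 / (I.scale * (I.k * 16 ^ j : ℕ))) ^ 2)) =
          2 / (I.scale ^ 2 * I.k) * ((2 : ℝ) ^ j / 16 ^ j) := by
        push_cast
        field_simp
      rw [e]
      refine mul_le_mul_of_nonneg_left ?_ (by positivity)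
      rw [div_le_iff₀ (by positivity), inv_mul_eq_div, le_div_iff₀ (by positivity), ← mul_pow]
      exact pow_le_pow_left₀ (by norm_num) (by norm_num) j
    calc _ ≤ (2 : ℝ) ^ j * _ := mul_le_mul_of_nonneg_left h1 (by positivity)
      _ ≤ _ := by rw [mul_add]; linarith
  refine (Finset.sum_le_sum fun j _ => hj j).trans ?_
  rw [Finset.sum_add_distrib, ← Finset.mul_sum, ← Finset.mul_sum]
  have := mul_le_mul_of_nonneg_left (sum_two_inv_pow_le N)
    (show 0 ≤ 2 / ((I.scale : ℝ) ^ 2 * I.k) by positivity)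
  have e : 2 / ((I.scale : ℝ) ^ 2 * I.k) * 2 = 4 / (I.scale ^ 2 * I.k) := by ring
  linarith

theorem energy_le_roundedEnergy {q : Fin I.n → ℝ} (hq : ∀ x, 0 ≤ q x) (hq1 : ∑ x, q x = 1)
    (hk : 0 < I.k) (hb : 0 < I.scale) (N : ℕ) :
    I.energy q N ≤ 2 * I.roundedEnergy q N + 4 / (I.scale ^ 2 * I.k) :=
  levels_sum_sq_le hk hb N fun j c => abs_deficit_sub_le hq hq1 hb (by positivity) c

theorem roundedEnergy_le_energy {q : Fin I.n → ℝ} (hq : ∀ x, 0 ≤ q x) (hq1 : ∑ x, q x = 1)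
    (hk : 0 < I.k) (hb : 0 < I.scale) (N : ℕ) :
    I.roundedEnergy q N ≤ 2 * I.energy q N + 4 / (I.scale ^ 2 * I.k) :=
  levels_sum_sq_le hk hb N fun j c => by
    rw [abs_sub_comm]
    exact abs_deficit_sub_le hq hq1 hb (by positivity) c

/-- On each level the absolute deficits add up to at most `θ`, and the sum of their squares is at
most the square of their sum. The factor `2 ^ N` is affordable because it is only of order `b / a`.
-/
theorem energy_le_of_close {p : Fin I.n → ℝ} {θ : ℝ} (hA : 0 < I.total)
    (hθ : ∑ x, |p x - I.weight x / I.total| ≤ θ) (N : ℕ) : I.energy p N ≤ 2 ^ N * θ ^ 2 := by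
  have hj : ∀ j, ∑ c ∈ Finset.range (I.k * 16 ^ j), I.deficit p (I.k * 16 ^ j) c ^ 2 ≤ θ ^ 2 := by
    intro j
    set ℓ := I.k * 16 ^ j
    have h1 : ∀ c ∈ Finset.range ℓ, |I.deficit p ℓ c| ≤
        ∑ x : Fin I.n, |p x - I.weight x / I.total| * I.frac ℓ c x := by
      intro c hc
      rw [deficit, ← I.cellMass_weight (Finset.mem_range.1 hc) hA, cellMass, cellMass,
        ← Finset.sum_sub_distrib]
      refine (Finset.abs_sum_le_sum_abs _ _).trans (Finset.sum_le_sum fun x _ => ?_)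
      rw [← sub_mul, abs_mul, abs_of_nonneg (I.frac_nonneg _ _ _), abs_sub_comm]
    have h2 : ∑ c ∈ Finset.range ℓ, |I.deficit p ℓ c| ≤ θ := by
      refine (Finset.sum_le_sum h1).trans (le_trans ?_ hθ)
      rw [Finset.sum_comm]
      refine Finset.sum_le_sum fun x _ => ?_
      rw [← Finset.mul_sum]
      exact mul_le_of_le_one_right (abs_nonneg _) (I.sum_range_frac_le x.2)
    calc _ = ∑ c ∈ Finset.range ℓ, |I.deficit p ℓ c| ^ 2 := by simp only [sq_abs]
      _ ≤ (∑ c ∈ Finset.range ℓ, |I.deficit p ℓ c|) ^ 2 :=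
          Finset.sum_sq_le_sq_sum_of_nonneg fun c _ => abs_nonneg _
      _ ≤ θ ^ 2 := pow_le_pow_left₀ (Finset.sum_nonneg fun c _ => abs_nonneg _) h2 2
  calc _ ≤ ∑ j ∈ Finset.range N, (2 : ℝ) ^ j * θ ^ 2 :=
        Finset.sum_le_sum fun j _ => mul_le_mul_of_nonneg_left (hj j) (by positivity)
    _ ≤ _ := by
        rw [← Finset.sum_mul, geom_sum_eq (by norm_num)]
        refine mul_le_mul_of_nonneg_right ?_ (sq_nonneg _)
        norm_num

/-! ### The features of the atoms -/

/-- The indices of the cells of all levels. -/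
abbrev Cell (I : Params) (N : ℕ) : Type := Σ j : Fin N, Fin (I.k * 16 ^ (j : ℕ))

/-- The weighted rounded fractions of an atom in all cells. -/
noncomputable def feature (I : Params) (N : ℕ) (x : Fin I.n) : EuclideanSpace ℝ (I.Cell N) :=
  WithLp.toLp 2 fun c => √(2 ^ (c.1 : ℕ)) * I.roundedFrac (I.k * 16 ^ (c.1 : ℕ)) c.2 x

/-- The mean of `feature` under the weights. -/
noncomputable def featureMean (I : Params) (N : ℕ) : EuclideanSpace ℝ (I.Cell N) :=
  WithLp.toLp 2 fun c => √(2 ^ (c.1 : ℕ)) * (1 / (I.k * 16 ^ (c.1 : ℕ) : ℕ))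

theorem sum_cell (N : ℕ) (f : ℕ → ℕ → ℝ) :
    ∑ c : I.Cell N, f c.1 c.2 =
      ∑ j ∈ Finset.range N, ∑ c ∈ Finset.range (I.k * 16 ^ j), f j c := by
  rw [Fintype.sum_sigma]
  rw [← Fin.sum_univ_eq_sum_range (fun j => ∑ c ∈ Finset.range (I.k * 16 ^ j), f j c)]
  exact Finset.sum_congr rfl fun j _ => Fin.sum_univ_eq_sum_range (fun c => f j c) _

theorem norm_sq_of_levels {N : ℕ} (v : EuclideanSpace ℝ (I.Cell N)) (f : ℕ → ℕ → ℝ)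
    (h : ∀ c : I.Cell N, v c = √(2 ^ (c.1 : ℕ)) * f c.1 c.2) :
    ‖v‖ ^ 2 = ∑ j ∈ Finset.range N, 2 ^ j * ∑ c ∈ Finset.range (I.k * 16 ^ j), f j c ^ 2 := by
  rw [EuclideanSpace.norm_sq_eq]
  simp only [Finset.mul_sum]
  rw [← sum_cell N fun j c => 2 ^ j * f j c ^ 2]
  refine Finset.sum_congr rfl fun c _ => ?_
  rw [h, Real.norm_eq_abs, sq_abs, mul_pow, Real.sq_sqrt (by positivity)]

/-- This makes the tested quantity the squared norm of a mean, which the sum over pairs estimates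
without bias. -/
theorem norm_sq_mean_feature {q : Fin I.n → ℝ} (hq1 : ∑ x, q x = 1) (N : ℕ) :
    ‖∑ x, q x • (I.feature N x - I.featureMean N)‖ ^ 2 = I.roundedEnergy q N := by
  rw [norm_sq_of_levels _ fun j c => - I.roundedDeficit q (I.k * 16 ^ j) c]
  · simp only [neg_sq, roundedEnergy]
  · intro c
    simp only [smul_sub, Finset.sum_sub_distrib, ← Finset.sum_smul, hq1, one_smul]
    simp [feature, featureMean, roundedDeficit, mul_sub, Finset.mul_sum, mul_left_comm]

/-- The kernels `κ j` of the levels lie in [0,1], so Cauchy–Schwarz and κ² ≤ κ give (Σ 2^j κ_j)² ≤ 2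
Σ 8^j κ_j. The mean of κ_j is the sum of the squared cell masses, at most 2/(k·16^j) + 2 Σ deficit².
The first parts form a convergent series since 8 < 16; the second contribute 4·4^j times the j-th
term of the energy. No bound on the atoms of q is needed. -/
theorem sum_inner_feature_sq_le {q : Fin I.n → ℝ} (hq : ∀ x, 0 ≤ q x)
    (hk : 0 < I.k) (hb : 0 < I.scale) (N : ℕ) :
    ∑ x, q x * ∑ x', q x' * inner ℝ (I.feature N x') (I.feature N x) ^ 2 ≤
      8 / I.k + 4 * 4 ^ (N - 1) * I.roundedEnergy q N := by
  set κ : ℕ → Fin I.n → Fin I.n → ℝ := fun j x x' =>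
    ∑ c ∈ Finset.range (I.k * 16 ^ j), I.roundedFrac (I.k * 16 ^ j) c x *
      I.roundedFrac (I.k * 16 ^ j) c x' with hκ
  have hk' : (0 : ℝ) < I.k := by exact_mod_cast hk
  have hκ0 : ∀ j x x', 0 ≤ κ j x x' := fun j x x' => Finset.sum_nonneg fun c _ =>
    mul_nonneg (I.roundedFrac_nonneg _ _ _) (I.roundedFrac_nonneg _ _ _)
  have hsum : ∀ j (x : Fin I.n), ∑ c ∈ Finset.range (I.k * 16 ^ j),
      I.roundedFrac (I.k * 16 ^ j) c x ≤ 1 := fun j x =>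
    (Finset.sum_le_sum fun c _ => I.roundedFrac_le hb (by positivity) c x).trans
      (I.sum_range_frac_le x.2)
  have hκ1 : ∀ j x x', κ j x x' ≤ 1 := by
    intro j x x'
    refine le_trans (Finset.sum_le_sum fun c hc => ?_) (hsum j x)
    refine mul_le_of_le_one_right (I.roundedFrac_nonneg _ _ _) (le_trans ?_ (hsum j x'))
    exact Finset.single_le_sum (f := fun c => I.roundedFrac (I.k * 16 ^ j) c x')
      (fun c _ => I.roundedFrac_nonneg _ _ _) hc
  have hinner : ∀ x x', inner ℝ (I.feature N x') (I.feature N x) =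
      ∑ j ∈ Finset.range N, 2 ^ j * κ j x x' := by
    intro x x'
    simp only [hκ, Finset.mul_sum]
    rw [← sum_cell N fun j c => 2 ^ j * (I.roundedFrac (I.k * 16 ^ j) c x *
      I.roundedFrac (I.k * 16 ^ j) c x'), PiLp.inner_apply]
    refine Finset.sum_congr rfl fun c _ => ?_
    simp only [feature, RCLike.inner_apply, conj_trivial]
    rw [mul_mul_mul_comm, Real.mul_self_sqrt (by positivity)]
  have hsq : ∀ x x', inner ℝ (I.feature N x') (I.feature N x) ^ 2 ≤
      2 * ∑ j ∈ Finset.range N, 8 ^ j * κ j x x' := by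
    intro x x'
    rw [hinner]
    have h1 := Finset.sum_sq_le_sum_mul_sum_of_sq_le_mul (Finset.range N)
      (r := fun j => 2 ^ j * κ j x x')
      (f := fun j => ((2 : ℝ) ^ j)⁻¹) (g := fun j => 8 ^ j * κ j x x') (fun j _ => by positivity)
      (fun j _ => mul_nonneg (by positivity) (hκ0 _ _ _)) (fun j _ => by
        have e : (8 : ℝ) ^ j = 2 ^ j * 2 ^ j * 2 ^ j := by
          rw [← mul_pow, ← mul_pow]
          norm_num
        rw [e]
        have e2 : ((2 : ℝ) ^ j)⁻¹ * (2 ^ j * 2 ^ j * 2 ^ j * κ j x x') =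
            2 ^ j * 2 ^ j * κ j x x' := by
          field_simp
        rw [e2, sq]
        have := mul_le_mul_of_nonneg_left (hκ1 j x x') (hκ0 j x x')
        have h0 : (0 : ℝ) ≤ 2 ^ j * 2 ^ j := by positivity
        nlinarith)
    exact h1.trans (mul_le_mul_of_nonneg_right (sum_two_inv_pow_le N)
      (Finset.sum_nonneg fun j _ => mul_nonneg (by positivity) (hκ0 _ _ _)))
  have hE : ∀ j, ∑ x, q x * ∑ x', q x' * κ j x x' =
      ∑ c ∈ Finset.range (I.k * 16 ^ j),
        (∑ x, q x * I.roundedFrac (I.k * 16 ^ j) c x) ^ 2 := by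
    intro j
    set ℓ := I.k * 16 ^ j
    calc _ = ∑ x, ∑ c ∈ Finset.range ℓ, q x * I.roundedFrac ℓ c x *
          ∑ x', q x' * I.roundedFrac ℓ c x' := by
          refine Finset.sum_congr rfl fun x _ => ?_
          simp only [hκ, Finset.mul_sum]
          rw [Finset.sum_comm]
          refine Finset.sum_congr rfl fun c _ => Finset.sum_congr rfl fun x' _ => ?_
          ring
      _ = _ := by
          rw [Finset.sum_comm]
          refine Finset.sum_congr rfl fun c _ => ?_
          rw [← Finset.sum_mul, sq]
  have hE2 : ∀ j, ∑ x, q x * ∑ x', q x' * κ j x x' ≤ 2 / (I.k * 16 ^ j) +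
      2 * ∑ c ∈ Finset.range (I.k * 16 ^ j), I.roundedDeficit q (I.k * 16 ^ j) c ^ 2 := by
    intro j
    rw [hE, Finset.mul_sum]
    calc _ ≤ ∑ c ∈ Finset.range (I.k * 16 ^ j), (2 * (1 / (I.k * 16 ^ j : ℕ)) ^ 2 +
          2 * I.roundedDeficit q (I.k * 16 ^ j) c ^ 2) := by
          refine Finset.sum_le_sum fun c _ => ?_
          rw [roundedDeficit]
          nlinarith [sq_nonneg (2 * (1 / ((I.k * 16 ^ j : ℕ) : ℝ)) -
            ∑ x, q x * I.roundedFrac (I.k * 16 ^ j) c x)]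
      _ = _ := by
          rw [Finset.sum_add_distrib, Finset.sum_const, Finset.card_range, nsmul_eq_mul]
          push_cast
          congr 1
          field_simp
  calc _ ≤ ∑ x, q x * ∑ x', q x' * (2 * ∑ j ∈ Finset.range N, 8 ^ j * κ j x x') :=
        Finset.sum_le_sum fun x _ => mul_le_mul_of_nonneg_left (Finset.sum_le_sum fun x' _ =>
          mul_le_mul_of_nonneg_left (hsq x x') (hq x')) (hq x)
    _ = ∑ j ∈ Finset.range N, 2 * (8 ^ j * ∑ x, q x * ∑ x', q x' * κ j x x') := by
        simp only [Finset.mul_sum]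
        rw [Finset.sum_comm' (t' := Finset.univ) (s' := fun _ => Finset.univ) (by simp)]
        rw [Finset.sum_congr rfl fun x _ => Finset.sum_comm]
        rw [Finset.sum_comm]
        refine Finset.sum_congr rfl fun j _ => ?_
        rw [Finset.sum_comm]
        refine Finset.sum_congr rfl fun x _ => Finset.sum_congr rfl fun x' _ => ?_
        ring
    _ ≤ ∑ j ∈ Finset.range N, (4 / I.k * ((2 : ℝ) ^ j)⁻¹ + 4 * 4 ^ (N - 1) * (2 ^ j *
          ∑ c ∈ Finset.range (I.k * 16 ^ j), I.roundedDeficit q (I.k * 16 ^ j) c ^ 2)) := by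
        refine Finset.sum_le_sum fun j hj => ?_
        have h0 : 0 ≤ ∑ c ∈ Finset.range (I.k * 16 ^ j),
          I.roundedDeficit q (I.k * 16 ^ j) c ^ 2 := Finset.sum_nonneg fun _ _ => sq_nonneg _
        have h8 : (8 : ℝ) ^ j = 4 ^ j * 2 ^ j := by rw [← mul_pow]; norm_num
        have h16 : (16 : ℝ) ^ j = 4 ^ j * 2 ^ j * 2 ^ j := by
          rw [← mul_pow, ← mul_pow]; norm_num
        have h4 : (4 : ℝ) ^ j ≤ 4 ^ (N - 1) :=
          pow_le_pow_right₀ (by norm_num) (by have := Finset.mem_range.1 hj; omega)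
        have h5 := mul_le_mul_of_nonneg_right h4 (mul_nonneg (pow_nonneg zero_le_two j) h0)
        calc _ ≤ 2 * (8 ^ j * (2 / (I.k * 16 ^ j) +
              2 * ∑ c ∈ Finset.range (I.k * 16 ^ j),
                I.roundedDeficit q (I.k * 16 ^ j) c ^ 2)) := by
              gcongr
              exact hE2 j
          _ = 4 / I.k * ((2 : ℝ) ^ j)⁻¹ + 4 * (4 ^ j * (2 ^ j *
              ∑ c ∈ Finset.range (I.k * 16 ^ j), I.roundedDeficit q (I.k * 16 ^ j) c ^ 2)) := by
              rw [h8, h16]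
              field_simp
              ring
          _ ≤ _ := by rw [mul_assoc 4]; linarith
    _ ≤ _ := by
        rw [Finset.sum_add_distrib, ← Finset.mul_sum, ← Finset.mul_sum, roundedEnergy]
        refine add_le_add ?_ le_rfl
        have := mul_le_mul_of_nonneg_left (sum_two_inv_pow_le N)
          (show 0 ≤ 4 / (I.k : ℝ) by positivity)
        calc _ ≤ _ := this
          _ = _ := by ring

/-! ### The program computes the sum over pairs -/

theorem cast_sqDist (x y : ℕ) : (sqDist x y : ℝ) = ((x : ℝ) - y) ^ 2 := by
  unfold sqDist
  rcases le_total x y with h | h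
  · rw [Nat.sub_eq_zero_of_le h, zero_add]
    push_cast [Nat.cast_sub h]
    ring
  · rw [Nat.sub_eq_zero_of_le h, add_zero]
    push_cast [Nat.cast_sub h]
    ring

/-- The contribution of a level to the sum over pairs. -/
noncomputable def levelPairs (I : Params) (m : ℕ) (y : ℕ → ℕ) (ℓ : ℕ) : ℝ :=
  ∑ c ∈ Finset.range ℓ, ((∑ i ∈ Finset.range m, (I.roundedFrac ℓ c (y i) - 1 / ℓ)) ^ 2 -
    ∑ i ∈ Finset.range m, (I.roundedFrac ℓ c (y i) - 1 / ℓ) ^ 2)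

theorem pairSum_feature (N m : ℕ) (y : ℕ → Fin I.n) :
    pairSum (fun x => I.feature N x - I.featureMean N) (fun i : Fin m => y i) =
      ∑ j ∈ Finset.range N, 2 ^ j * I.levelPairs m (fun i => y i) (I.k * 16 ^ j) := by
  have h1 : ‖∑ i : Fin m, (I.feature N (y i) - I.featureMean N)‖ ^ 2 =
      ∑ j ∈ Finset.range N, 2 ^ j * ∑ c ∈ Finset.range (I.k * 16 ^ j),
        (∑ i ∈ Finset.range m, (I.roundedFrac (I.k * 16 ^ j) c (y i) -
          1 / (I.k * 16 ^ j : ℕ))) ^ 2 := by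
    refine norm_sq_of_levels _ (fun j c => ∑ i ∈ Finset.range m,
      (I.roundedFrac (I.k * 16 ^ j) c (y i) - 1 / (I.k * 16 ^ j : ℕ))) fun c => ?_
    rw [← Fin.sum_univ_eq_sum_range (fun i => I.roundedFrac (I.k * 16 ^ (c.1 : ℕ)) c.2 (y i) -
      1 / (I.k * 16 ^ (c.1 : ℕ) : ℕ)), Finset.mul_sum]
    simp [feature, featureMean, mul_sub]
  have h2 : ∀ x, ‖I.feature N x - I.featureMean N‖ ^ 2 =
      ∑ j ∈ Finset.range N, 2 ^ j * ∑ c ∈ Finset.range (I.k * 16 ^ j),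
        (I.roundedFrac (I.k * 16 ^ j) c x - 1 / (I.k * 16 ^ j : ℕ)) ^ 2 := fun x =>
    norm_sq_of_levels _ (fun j c => I.roundedFrac (I.k * 16 ^ j) c x - 1 / (I.k * 16 ^ j : ℕ))
      fun c => by simp [feature, featureMean, mul_sub]
  simp only [pairSum, h1, h2]
  rw [Finset.sum_comm, ← Finset.sum_sub_distrib]
  refine Finset.sum_congr rfl fun j _ => ?_
  rw [levelPairs, ← Finset.mul_sum, ← mul_sub, Finset.sum_comm, ← Finset.sum_sub_distrib]
  congr 1
  refine Finset.sum_congr rfl fun c _ => ?_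
  rw [← Fin.sum_univ_eq_sum_range (fun i => (I.roundedFrac (I.k * 16 ^ j) c (y i) -
      1 / (I.k * 16 ^ j : ℕ)) ^ 2)]

theorem level_eq (hb : 0 < I.scale) {ℓ : ℕ} (hℓ : 0 < ℓ) (y : ℕ → ℕ) :
    ((∑ c ∈ Finset.range ℓ, I.cellSq ℓ y c : ℕ) : ℝ) -
      (∑ c ∈ Finset.range ℓ, ∑ i ∈ Finset.range I.draws, I.sampleDiag ℓ y c i : ℕ) =
      I.scale ^ 2 * ℓ ^ 2 * I.levelPairs I.draws y ℓ := by
  have hb' : (I.scale : ℝ) ≠ 0 := by positivity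
  have hℓ' : (ℓ : ℝ) ≠ 0 := by positivity
  have h : ∀ c x, (I.share ℓ c x : ℝ) - I.scale =
      I.scale * ℓ * (I.roundedFrac ℓ c x - 1 / ℓ) := by
    intro c x
    unfold roundedFrac
    field_simp
  push_cast
  rw [levelPairs, ← Finset.sum_sub_distrib, Finset.mul_sum]
  refine Finset.sum_congr rfl fun c _ => ?_
  have h1 : (I.cellSq ℓ y c : ℝ) = (I.scale * ℓ *
      ∑ i ∈ Finset.range I.draws, (I.roundedFrac ℓ c (y i) - 1 / ℓ)) ^ 2 := by
    rw [cellSq, cast_sqDist, Finset.mul_sum]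
    simp only [← h]
    simp
  have h2 : ∀ i, (I.sampleDiag ℓ y c i : ℝ) =
      (I.scale * ℓ) ^ 2 * (I.roundedFrac ℓ c (y i) - 1 / ℓ) ^ 2 := by
    intro i
    rw [sampleDiag, cast_sqDist, h, mul_pow]
  simp only [h1, h2, ← Finset.mul_sum]
  ring

/-- Integer squares on level j carry the factor (scale·k·16^j)², and 16^(2j) = 128^j·2^j.
Multiplying the accumulators by 128 at each level evens out 128^j and leaves the weight 2^j. The
factor 128 on the left avoids the exponent `N - 1`. -/
theorem acc_eq (hk : 0 < I.k) (hb : 0 < I.scale) (y : ℕ → ℕ) (N : ℕ) :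
    128 * ((I.accSq y N : ℝ) - I.accDiag y N) =
      I.k ^ 2 * I.scale ^ 2 * 128 ^ N *
        ∑ j ∈ Finset.range N, 2 ^ j * I.levelPairs I.draws y (I.k * 16 ^ j) -
      128 ^ (N + 1) * (I.k * I.a ^ 2 * (I.draws * (I.draws - 1))) := by
  induction N with
  | zero =>
    simp only [accSq, accDiag]
    push_cast [Nat.cast_sub (Nat.one_le_iff_ne_zero.2 I.draws_pos.ne')]
    simp only [Finset.range_zero, Finset.sum_empty]
    ring
  | succ N ih =>
    have h := level_eq hb (ℓ := I.k * 16 ^ N) (by positivity) y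
    simp only [accSq, accDiag]
    rw [Nat.cast_add, Nat.cast_add, Finset.sum_range_succ]
    push_cast at h ⊢
    have e : (16 : ℝ) ^ N * 16 ^ N = 128 ^ N * 2 ^ N := by
      rw [← mul_pow, ← mul_pow]
      norm_num
    have e2 : (I.k * (16 : ℝ) ^ N) ^ 2 = I.k ^ 2 * (128 ^ N * 2 ^ N) := by
      rw [← e]
      ring
    rw [e2] at h
    linear_combination 128 * ih + 128 * h

/-- The initial value of `accDiag` supplies the threshold. Its constant is 8192 = 1024²/128, from
`scale = 1024 * b` and the multiplier 128. -/
theorem accept_iff (hk : 0 < I.k) (hb : 0 < I.b) (y : ℕ → Fin I.n) (N : ℕ) :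
    I.accSq (fun i => y i) N ≤ I.accDiag (fun i => y i) N ↔
      pairSum (fun x => I.feature N x - I.featureMean N) (fun i : Fin I.draws => y i) ≤
        I.draws * (I.draws - 1) * (((I.a : ℝ) / I.b) ^ 2 / (8192 * I.k)) := by
  have hscale : 0 < I.scale := by unfold scale; omega
  have hk' : (0 : ℝ) < I.k := by exact_mod_cast hk
  have hb' : (0 : ℝ) < I.b := by exact_mod_cast hb
  have h := acc_eq hk hscale (fun i => y i) N
  rw [← pairSum_feature] at h
  set Z := pairSum (fun x => I.feature N x - I.featureMean N) (fun i : Fin I.draws => y i)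
  have h1 : I.accSq (fun i => y i) N ≤ I.accDiag (fun i => y i) N ↔
      128 * ((I.accSq (fun i => y i) N : ℝ) - I.accDiag (fun i => y i) N) ≤ 0 := by
    rw [← Nat.cast_le (α := ℝ)]
    constructor <;> intro <;> linarith
  have h2 : (I.k : ℝ) ^ 2 * I.scale ^ 2 * 128 ^ N * Z -
      128 ^ (N + 1) * (I.k * I.a ^ 2 * (I.draws * (I.draws - 1))) =
      (I.k ^ 2 * I.scale ^ 2 * 128 ^ N) *
        (Z - I.draws * (I.draws - 1) * (((I.a : ℝ) / I.b) ^ 2 / (8192 * I.k))) := by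
    unfold scale
    push_cast
    field_simp
    ring
  have h3 : (0 : ℝ) < I.k ^ 2 * I.scale ^ 2 * 128 ^ N := by
    have : (0 : ℝ) < I.scale := by exact_mod_cast hscale
    positivity
  rw [h1, h, h2, ← sub_nonpos (a := Z)]
  exact ⟨fun h => nonpos_of_mul_nonpos_right h h3, fun h => mul_nonpos_of_nonneg_of_nonpos h3.le h⟩

end Params

/-! ### Concentration of the pair statistic -/

namespace Params

variable {I : Params}

theorem sqrt_le_root (hk : 0 < I.k) : √(I.k : ℝ) ≤ I.root := by
  rw [Real.sqrt_le_left (by positivity)]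
  have := (I.root_iff hk I.root).not.2 (lt_irrefl _)
  push Not at this
  rw [sq]
  exact_mod_cast this

theorem root_le (hk : 0 < I.k) : (I.root : ℝ) ≤ 2 * √(I.k : ℝ) := by
  have h1 : (1 : ℝ) ≤ √(I.k : ℝ) := by
    rw [Real.one_le_sqrt]
    exact_mod_cast hk
  have h2 : (Nat.sqrt (I.k - 1) : ℝ) ≤ √(I.k : ℝ) := by
    refine Real.le_sqrt_of_sq_le ?_
    have := Nat.sqrt_le (I.k - 1)
    rw [sq]
    exact_mod_cast this.trans (Nat.sub_le _ _)
  rw [root]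
  push_cast
  linarith

theorem le_draws (ha : 0 < I.a) :
    10 ^ 8 * (I.root : ℝ) / ((I.a : ℝ) / I.b) ^ 2 ≤ I.draws := by
  have ha' : (0 : ℝ) < I.a := by exact_mod_cast ha
  have h := Nat.lt_mul_div_succ (10 ^ 8 * I.root * (I.b * I.b))
    (show 0 < I.a * I.a from Nat.mul_pos ha ha)
  have h' : (10 ^ 8 * I.root * (I.b * I.b) : ℝ) ≤ I.a * I.a * I.draws := by exact_mod_cast h.le
  have e : 10 ^ 8 * (I.root : ℝ) / ((I.a : ℝ) / I.b) ^ 2 =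
      10 ^ 8 * I.root * (I.b * I.b) / (I.a * I.a) := by
    rw [div_pow, div_div_eq_mul_div]
    ring
  rw [e, div_le_iff₀ (by positivity)]
  linarith

theorem draws_le : (I.draws : ℝ) ≤ 10 ^ 8 * (I.root : ℝ) / ((I.a : ℝ) / I.b) ^ 2 + 1 := by
  have h : ((10 ^ 8 * I.root * (I.b * I.b) / (I.a * I.a) : ℕ) : ℝ) ≤
      ((10 ^ 8 * I.root * (I.b * I.b) : ℕ) : ℝ) / ((I.a * I.a : ℕ) : ℝ) := Nat.cast_div_le
  have e : 10 ^ 8 * (I.root : ℝ) / ((I.a : ℝ) / I.b) ^ 2 =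
      10 ^ 8 * I.root * (I.b * I.b) / (I.a * I.a) := by
    rw [div_pow, div_div_eq_mul_div]
    ring
  rw [e, draws]
  push_cast at h ⊢
  linarith

theorem levels_pos (ha : 0 < I.a) (hab : I.a ≤ 2 * I.b) : 0 < I.levels := by
  rw [I.lt_levels_iff ha]
  omega

theorem pow_levels_le (ha : 0 < I.a) (hab : I.a ≤ 2 * I.b) :
    (16 : ℝ) ^ (I.levels - 1) ≤ 256 / ((I.a : ℝ) / I.b) := by
  have ha' : (0 : ℝ) < I.a := by exact_mod_cast ha
  have hb' : (0 : ℝ) < I.b := by exact_mod_cast (show 0 < I.b by omega)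
  have h := (I.lt_levels_iff ha (I.levels - 1)).1 (by have := levels_pos ha hab; omega)
  rw [div_div_eq_mul_div, le_div_iff₀ ha']
  exact_mod_cast h.le

/-- The guard `16 ^ j * a < 256 * b` fails at `levels`; removing one factor 16 gives the bound. -/
theorem le_pow_levels (ha : 0 < I.a) (hab : I.a ≤ 2 * I.b) :
    16 / ((I.a : ℝ) / I.b) ≤ (16 : ℝ) ^ (I.levels - 1) := by
  have ha' : (0 : ℝ) < I.a := by exact_mod_cast ha
  have h := (I.lt_levels_iff ha I.levels).not.1 (lt_irrefl _)
  rw [div_div_eq_mul_div, div_le_iff₀ ha']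
  obtain ⟨N, hN⟩ : ∃ N, I.levels = N + 1 := ⟨I.levels - 1, by have := levels_pos ha hab; omega⟩
  rw [hN] at h ⊢
  rw [Nat.add_sub_cancel]
  rw [pow_succ] at h
  have h' : 16 * I.b ≤ 16 ^ N * I.a := by
    rw [mul_right_comm] at h
    omega
  exact_mod_cast h'

/-- The statistic concentrates. -/
theorem sampleMean_deviation_le {q : Fin I.n → ℝ} (hq : ∀ x, 0 ≤ q x) (hq1 : ∑ x, q x = 1)
    (hk : 2 ≤ I.k) (ha : 0 < I.a) (hab : I.a ≤ 2 * I.b) {M : ℝ}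
    (hM : ((I.a : ℝ) / I.b) ^ 2 / (4096 * I.k) ≤ M) (hD : I.roundedEnergy q I.levels ≤ M)
    (p : (Fin I.draws → Fin I.n) → Prop) [DecidablePred p]
    (hp : ∀ y, p y → 3 / 8 * (I.draws * (I.draws - 1)) * M ≤
      |pairSum (fun x => I.feature I.levels x - I.featureMean I.levels) y -
        I.draws * (I.draws - 1) * I.roundedEnergy q I.levels|) :
    sampleMean q I.draws (fun y => if p y then 1 else 0) ≤ 1 / 3 := by
  set D := I.roundedEnergy q I.levels with hDdef
  set e := (I.a : ℝ) / I.b with he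
  have hb : 0 < I.b := by omega
  have ha' : (0 : ℝ) < I.a := by exact_mod_cast ha
  have hb' : (0 : ℝ) < I.b := by exact_mod_cast hb
  have hk' : (0 : ℝ) < I.k := by exact_mod_cast (show 0 < I.k by omega)
  have he0 : 0 < e := by positivity
  have he2 : e ≤ 2 := by
    rw [he, div_le_iff₀ hb']
    exact_mod_cast hab
  have hD0 : 0 ≤ D := Finset.sum_nonneg fun j _ => mul_nonneg (by positivity)
    (Finset.sum_nonneg fun c _ => sq_nonneg _)
  have hM0 : 0 < M := lt_of_lt_of_le (by positivity) hM
  have hroot := sqrt_le_root (I := I) (by omega)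
  have hm := le_draws (I := I) ha
  rw [← he] at hm
  generalize I.draws = m at *
  have hsq : √(I.k : ℝ) ^ 2 = I.k := Real.sq_sqrt hk'.le
  have hs1 : 1 ≤ √(I.k : ℝ) := by
    rw [Real.one_le_sqrt]
    exact_mod_cast (show 1 ≤ I.k by omega)
  have hm1 : 10 ^ 8 * √(I.k : ℝ) / e ^ 2 ≤ m := le_trans (by gcongr) hm
  have hm2 : (2 : ℝ) ≤ m := by
    refine le_trans ?_ hm1
    rw [le_div_iff₀ (by positivity)]
    nlinarith
  -- Multiply the lower bounds on `m` and `M`; 10^8/4096 exceeds 24000.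
  have hmM : 24000 / √(I.k : ℝ) ≤ m * M := by
    calc 24000 / √(I.k : ℝ) ≤ (10 ^ 8 * √(I.k : ℝ) / e ^ 2) * (e ^ 2 / (4096 * I.k)) := by
          have : (10 ^ 8 * √(I.k : ℝ) / e ^ 2) * (e ^ 2 / (4096 * I.k)) =
              10 ^ 8 / 4096 / √(I.k : ℝ) := by
            nth_rewrite 2 [← hsq]
            field_simp
          rw [this]
          gcongr
          norm_num
      _ ≤ m * M := by gcongr
  have hmM2 : (24000 : ℝ) ^ 2 / I.k ≤ (m * M) ^ 2 := by
    calc (24000 : ℝ) ^ 2 / I.k = (24000 / √(I.k : ℝ)) ^ 2 := by rw [div_pow, hsq]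
      _ ≤ _ := by gcongr
  have hmmM : 2 * 10 ^ 12 / e ^ 2 ≤ m * (m * M) := by
    calc 2 * 10 ^ 12 / e ^ 2 ≤ (10 ^ 8 * √(I.k : ℝ) / e ^ 2) * (24000 / √(I.k : ℝ)) := by
          have : (10 ^ 8 * √(I.k : ℝ) / e ^ 2) * (24000 / √(I.k : ℝ)) =
            10 ^ 8 * 24000 / e ^ 2 := by field_simp
          rw [this]
          exact div_le_div_of_nonneg_right (by norm_num) (by positivity)
      _ ≤ _ := by gcongr
  have hS : 8 / (I.k : ℝ) + 4 * 4 ^ (I.levels - 1) * D ≤ (m * M / 1000) ^ 2 := by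
    have h1 : (4 : ℝ) ^ (I.levels - 1) ≤ 256 / e :=
      (pow_le_pow_left₀ (by norm_num) (by norm_num) _).trans (pow_levels_le ha hab)
    have h2 : 8 / (I.k : ℝ) ≤ (m * M) ^ 2 / 2000000 := by
      rw [div_le_iff₀ hk'] at hmM2 ⊢
      linarith
    have h3 : 4 * 4 ^ (I.levels - 1) * D ≤ (m * M) ^ 2 / 2000000 := by
      have h4 : 4 * (256 / e) ≤ m * (m * M) / 2000000 := by
        refine le_trans ?_ (div_le_div_of_nonneg_right hmmM (by norm_num))
        rw [mul_div_assoc', div_div, div_le_div_iff₀ he0 (by positivity)]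
        nlinarith
      calc 4 * 4 ^ (I.levels - 1) * D ≤ 4 * (256 / e) * M := by gcongr
        _ ≤ m * (m * M) / 2000000 * M := by gcongr
        _ = _ := by ring
    have h5 : (m * M / 1000) ^ 2 = (m * M) ^ 2 / 2000000 + (m * M) ^ 2 / 2000000 := by ring
    linarith
  have hscale : 0 < I.scale := by unfold scale; omega
  have hHS : ∑ x, q x * ∑ x', q x' *
      inner ℝ (I.feature I.levels x' - I.featureMean I.levels -
        ∑ y, q y • (I.feature I.levels y - I.featureMean I.levels))
        (I.feature I.levels x - I.featureMean I.levels -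
        ∑ y, q y • (I.feature I.levels y - I.featureMean I.levels)) ^ 2 ≤ (m * M / 1000) ^ 2 := by
    have e1 : ∀ x, I.feature I.levels x - I.featureMean I.levels -
        ∑ y, q y • (I.feature I.levels y - I.featureMean I.levels) =
        I.feature I.levels x - ∑ y, q y • I.feature I.levels y := by
      intro x
      simp only [smul_sub, Finset.sum_sub_distrib, ← Finset.sum_smul, hq1, one_smul]
      abel
    simp only [e1]
    exact (hilbertSchmidt_center_le hq hq1 _).trans
      ((sum_inner_feature_sq_le hq (by omega) hscale _).trans hS)
  have hvar := sampleMean_pairSum_sub_sq_le hq hq1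
    (fun x => I.feature I.levels x - I.featureMean I.levels)
    (norm_sq_mean_feature hq1 I.levels) hHS (by positivity) m
  rw [← hDdef] at hvar
  have hT : 0 < 3 / 8 * ((m : ℝ) * (m - 1)) * M := by
    have : (0 : ℝ) < m - 1 := by linarith
    positivity
  have hcheb := sampleMean_indicator_le hq (m := m)
    (F := fun y => pairSum (fun x => I.feature I.levels x - I.featureMean I.levels) y -
        m * (m - 1) * D) p hT (fun y hy => by
      rw [← sq_abs (pairSum _ y - _)]
      exact pow_le_pow_left₀ hT.le (hp y hy) 2)
  refine hcheb.trans ?_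
  rw [div_le_iff₀ (by positivity)]
  refine hvar.trans ?_
  -- The variance is at most (8/1000 + 4/10^6)·m⁴M². A third of the squared threshold is at least
  -- (3/16)²/3 = 3/256 times m⁴M², which is larger.
  have h1 : 8 * (m : ℝ) ^ 3 * D * (m * M / 1000) ≤ 8 * (m : ℝ) ^ 3 * M * (m * M / 1000) := by
    gcongr
  have h2 : (m : ℝ) / 2 ≤ m - 1 := by linarith
  have h3 : 3 / 8 * ((m : ℝ) * (m / 2)) * M ≤ 3 / 8 * ((m : ℝ) * (m - 1)) * M := by gcongr
  have h4 := pow_le_pow_left₀ (by positivity) h3 2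
  have h5 : 0 ≤ (m : ℝ) ^ 4 * M ^ 2 := by positivity
  nlinarith

/-- With `M = e ^ 2 / (4096 * k)` the normalized threshold is M/2 and the mean is at most M/8, which
leaves the gap 3M/8. -/
theorem sampleMean_reject_le {q : Fin I.n → ℝ} (hq : ∀ x, 0 ≤ q x) (hq1 : ∑ x, q x = 1)
    (hk : 2 ≤ I.k) (ha : 0 < I.a) (hab : I.a ≤ 2 * I.b)
    (hD : I.roundedEnergy q I.levels ≤ ((I.a : ℝ) / I.b) ^ 2 / (32768 * I.k))
    (p : (Fin I.draws → Fin I.n) → Prop) [DecidablePred p]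
    (hp : ∀ y, p y → I.draws * (I.draws - 1) * (((I.a : ℝ) / I.b) ^ 2 / (8192 * I.k)) ≤
      pairSum (fun x => I.feature I.levels x - I.featureMean I.levels) y) :
    sampleMean q I.draws (fun y => if p y then 1 else 0) ≤ 1 / 3 := by
  set M := ((I.a : ℝ) / I.b) ^ 2 / (4096 * I.k) with hM
  have e1 : ((I.a : ℝ) / I.b) ^ 2 / (32768 * I.k) = M / 8 := by rw [hM]; ring
  have e2 : ((I.a : ℝ) / I.b) ^ 2 / (8192 * I.k) = M / 2 := by rw [hM]; ring
  have hM0 : 0 ≤ M := by positivity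
  rw [e1] at hD
  refine sampleMean_deviation_le hq hq1 hk ha hab (M := M) le_rfl (by linarith) p fun y hy => ?_
  have h := hp y hy
  rw [e2] at h
  refine le_trans ?_ (le_abs_self _)
  have hm : (1 : ℝ) ≤ I.draws := by exact_mod_cast I.draws_pos
  generalize (I.draws : ℝ) = m at *
  have h1 : 0 ≤ m * (m - 1) := mul_nonneg (by linarith) (by linarith)
  have h2 := mul_le_mul_of_nonneg_left hD h1
  linarith

/-- Here the energy itself plays the role of `M` in the concentration bound. The normalized
threshold is at most half of it, so the gap is more than large enough. -/
theorem sampleMean_accept_le {q : Fin I.n → ℝ} (hq : ∀ x, 0 ≤ q x) (hq1 : ∑ x, q x = 1)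
    (hk : 2 ≤ I.k) (ha : 0 < I.a) (hab : I.a ≤ 2 * I.b)
    (hD : ((I.a : ℝ) / I.b) ^ 2 / (4096 * I.k) ≤ I.roundedEnergy q I.levels)
    (p : (Fin I.draws → Fin I.n) → Prop) [DecidablePred p]
    (hp : ∀ y, p y → pairSum (fun x => I.feature I.levels x - I.featureMean I.levels) y ≤
      I.draws * (I.draws - 1) * (((I.a : ℝ) / I.b) ^ 2 / (8192 * I.k))) :
    sampleMean q I.draws (fun y => if p y then 1 else 0) ≤ 1 / 3 := by
  set M := ((I.a : ℝ) / I.b) ^ 2 / (4096 * I.k) with hM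
  have e2 : ((I.a : ℝ) / I.b) ^ 2 / (8192 * I.k) = M / 2 := by rw [hM]; ring
  have hM0 : 0 ≤ M := by positivity
  refine sampleMean_deviation_le hq hq1 hk ha hab hD le_rfl p fun y hy => ?_
  have h := hp y hy
  rw [e2] at h
  refine le_trans ?_ (neg_le_abs _)
  have hm : (1 : ℝ) ≤ I.draws := by exact_mod_cast I.draws_pos
  generalize (I.draws : ℝ) = m at *
  have h1 : 0 ≤ m * (m - 1) := mul_nonneg (by linarith) (by linarith)
  have h2 := mul_le_mul_of_nonneg_left hD h1
  linarith [mul_nonneg h1 hM0]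

end Params

/-! ### The `𝒜_k`-distance and blocks -/

theorem PMF.sum_toReal {n : ℕ} (p : PMF (Fin n)) : ∑ x, (p x).toReal = 1 := by
  have h := p.tsum_coe
  rw [tsum_fintype] at h
  rw [← ENNReal.toReal_sum fun x _ => p.apply_ne_top x, h, ENNReal.toReal_one]

theorem Finpartition.sum_parts {α : Type*} [DecidableEq α] {s : Finset α} (I : Finpartition s)
    (f : α → ℝ) : ∑ J ∈ I.parts, ∑ i ∈ J, f i = ∑ i ∈ s, f i := by
  conv_rhs => rw [← I.biUnion_parts]
  rw [Finset.sum_biUnion I.supIndep.pairwiseDisjoint]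
  rfl

theorem akDist_le_two {n : ℕ} (k : ℕ) (p q : PMF (Fin n)) : akDist k p q ≤ 2 := by
  refine Real.iSup_le (fun I => ?_) zero_le_two
  calc _ ≤ ∑ J ∈ I.1.parts, ((∑ i ∈ J, (p i).toReal) + ∑ i ∈ J, (q i).toReal) := by
        refine Finset.sum_le_sum fun J _ => (abs_sub _ _).trans ?_
        rw [abs_of_nonneg (Finset.sum_nonneg fun _ _ => ENNReal.toReal_nonneg),
          abs_of_nonneg (Finset.sum_nonneg fun _ _ => ENNReal.toReal_nonneg)]
    _ = 2 := by
        rw [Finset.sum_add_distrib, I.1.sum_parts, I.1.sum_parts, p.sum_toReal, q.sum_toReal]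
        norm_num

/-- Distributions at `𝒜_k`-distance at least `e` differ in mass by `e / 2` on at most `k` disjoint
blocks on which `q` has too little mass. -/
theorem exists_blocks {n k : ℕ} {p q : PMF (Fin n)} {e : ℝ} (he : 0 < e)
    (h : e ≤ akDist k q p) :
    ∃ (t : Finset (Finset (Fin n))) (lo hi : Finset (Fin n) → ℕ), t.card ≤ k ∧
      (∀ J ∈ t, lo J ≤ hi J) ∧ (∀ J ∈ t, hi J ≤ n) ∧
      (∀ J ∈ t, ∀ J' ∈ t, J ≠ J' → hi J ≤ lo J' ∨ hi J' ≤ lo J) ∧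
      (t : Set (Finset (Fin n))).PairwiseDisjoint id ∧
      (∀ J ∈ t, ({z : Fin n | lo J ≤ z.1 ∧ z.1 < hi J} : Finset (Fin n)) = J) ∧
      e / 2 ≤ ∑ J ∈ t, ∑ z ∈ J, ((p z).toReal - (q z).toReal) := by
  classical
  unfold akDist at h
  obtain ⟨I, hI⟩ : ∃ I : {I : Finpartition (Finset.univ : Finset (Fin n)) //
      I.parts.card = k ∧ ∀ J ∈ I.parts, (J : Set (Fin n)).OrdConnected},
      e ≤ ∑ J ∈ I.1.parts, |(∑ i ∈ J, (q i).toReal) - ∑ i ∈ J, (p i).toReal| := by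
    -- The supremum over an empty family is 0 by convention, which `0 < e` excludes; over a nonempty
    -- finite family it is attained.
    by_contra! hlt
    rcases isEmpty_or_nonempty {I : Finpartition (Finset.univ : Finset (Fin n)) //
      I.parts.card = k ∧ ∀ J ∈ I.parts, (J : Set (Fin n)).OrdConnected} with hE | hE
    · rw [Real.iSup_of_isEmpty] at h
      linarith
    · obtain ⟨I, hI⟩ := exists_eq_ciSup_of_finite (f := fun I : {I : Finpartition
        (Finset.univ : Finset (Fin n)) //
        I.parts.card = k ∧ ∀ J ∈ I.parts, (J : Set (Fin n)).OrdConnected} =>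
        ∑ J ∈ I.1.parts, |(∑ i ∈ J, (q i).toReal) - ∑ i ∈ J, (p i).toReal|)
      have := hlt I
      rw [← hI] at h
      linarith
  obtain ⟨⟨I, hcard, hord⟩, hI⟩ := I, hI
  set d : Finset (Fin n) → ℝ := fun J => (∑ i ∈ J, (p i).toReal) - ∑ i ∈ J, (q i).toReal with hd
  set t := I.parts.filter fun J => 0 < d J with ht
  have htI : ∀ J ∈ t, J ∈ I.parts := fun J hJ => (Finset.mem_filter.1 hJ).1
  set lo : Finset (Fin n) → ℕ := fun J => if hJ : J.Nonempty then (J.min' hJ).1 else 0 with hlo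
  set hi : Finset (Fin n) → ℕ := fun J => if hJ : J.Nonempty then (J.max' hJ).1 + 1 else 0 with hhi
  have hlo' : ∀ J (hJ : J.Nonempty), lo J = (J.min' hJ).1 := fun J hJ => by simp [hlo, hJ]
  have hhi' : ∀ J (hJ : J.Nonempty), hi J = (J.max' hJ).1 + 1 := fun J hJ => by simp [hhi, hJ]
  have hblock : ∀ J ∈ t, ({z : Fin n | lo J ≤ z.1 ∧ z.1 < hi J} : Finset (Fin n)) = J := by
    intro J hJ
    have hne := I.nonempty_of_mem_parts (htI J hJ)
    have hoc := hord J (htI J hJ)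
    ext z
    rw [Finset.mem_filter, hlo' J hne, hhi' J hne]
    constructor
    · rintro ⟨-, h₁, h₂⟩
      have : z ∈ (J : Set (Fin n)) := hoc.out (J.min'_mem hne) (J.max'_mem hne)
        ⟨Fin.le_def.2 h₁, Fin.le_def.2 (Nat.lt_succ_iff.1 h₂)⟩
      exact this
    · intro hz
      exact ⟨Finset.mem_univ _, Fin.le_def.1 (J.min'_le z hz),
        Nat.lt_succ_iff.2 (Fin.le_def.1 (J.le_max' z hz))⟩
  refine ⟨t, lo, hi, ?_, ?_, ?_, ?_, ?_, hblock, ?_⟩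
  · rw [← hcard]
    exact Finset.card_filter_le _ _
  · intro J hJ
    have hne := I.nonempty_of_mem_parts (htI J hJ)
    rw [hlo' J hne, hhi' J hne]
    have := Fin.le_def.1 (J.min'_le _ (J.max'_mem hne))
    omega
  · intro J hJ
    have hne := I.nonempty_of_mem_parts (htI J hJ)
    rw [hhi' J hne]
    omega
  · intro J hJ J' hJ' hne'
    have hne := I.nonempty_of_mem_parts (htI J hJ)
    have hne2 := I.nonempty_of_mem_parts (htI J' hJ')
    have hdis : Disjoint J J' := I.disjoint (htI J hJ) (htI J' hJ') hne'
    by_contra! hcon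
    rw [hlo' J hne, hhi' J hne, hlo' J' hne2, hhi' J' hne2] at hcon
    -- If the two intervals overlapped, the larger of their minima would lie in both.
    rcases le_total (J.min' hne) (J'.min' hne2) with hle | hle
    · have : J'.min' hne2 ∈ (J : Set (Fin n)) := (hord J (htI J hJ)).out (J.min'_mem hne)
        (J.max'_mem hne) ⟨hle, Fin.le_def.2 (by omega)⟩
      exact Finset.disjoint_left.1 hdis this (J'.min'_mem hne2)
    · have : J.min' hne ∈ (J' : Set (Fin n)) := (hord J' (htI J' hJ')).out (J'.min'_mem hne2)
        (J'.max'_mem hne2) ⟨hle, Fin.le_def.2 (by omega)⟩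
      exact Finset.disjoint_left.1 hdis (J.min'_mem hne) this
  · exact I.supIndep.pairwiseDisjoint.subset fun J hJ => htI J hJ
  -- The differences add up to zero, so the positive ones carry half of the sum of the absolute
  -- values.
  · have h0 : ∑ J ∈ I.parts, d J = 0 := by
      rw [hd, Finset.sum_sub_distrib, I.sum_parts, I.sum_parts, p.sum_toReal, q.sum_toReal,
        sub_self]
    have h1 : ∑ J ∈ I.parts, |d J| = 2 * ∑ J ∈ t, d J - ∑ J ∈ I.parts, d J := by
      rw [ht, Finset.sum_filter, Finset.mul_sum, ← Finset.sum_sub_distrib]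
      refine Finset.sum_congr rfl fun J _ => ?_
      split_ifs with hJ
      · rw [abs_of_pos hJ]
        ring
      · rw [abs_of_nonpos (not_lt.1 hJ)]
        ring
    have h2 : ∑ J ∈ I.parts, |(∑ i ∈ J, (q i).toReal) - ∑ i ∈ J, (p i).toReal| =
        ∑ J ∈ I.parts, |d J| := Finset.sum_congr rfl fun J _ => abs_sub_comm _ _
    have h3 : ∑ J ∈ t, ∑ z ∈ J, ((p z).toReal - (q z).toReal) = ∑ J ∈ t, d J :=
      Finset.sum_congr rfl fun J _ => Finset.sum_sub_distrib _ _
    rw [h3]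
    simp only [h2, h1, h0] at hI
    linarith

/-! ### The energy gap between close and far distributions -/

namespace Params

variable {I : Params}

/-- Distributions far from the weights have large energy. -/
theorem le_roundedEnergy {p q : PMF (Fin I.n)} (hk : 2 ≤ I.k) (ha : 0 < I.a)
    (hab : I.a ≤ 2 * I.b) (hA : 0 < I.total)
    (hθ : ∑ x : Fin I.n, |(p x).toReal - I.weight x / I.total| ≤ ((I.a : ℝ) / I.b) / 8)
    (h : (I.a : ℝ) / I.b ≤ akDist I.k q p) :
    ((I.a : ℝ) / I.b) ^ 2 / (4096 * I.k) ≤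
      I.roundedEnergy (fun x => (q x).toReal) I.levels := by
  set e := (I.a : ℝ) / I.b with he
  have hb : 0 < I.b := by omega
  have ha' : (0 : ℝ) < I.a := by exact_mod_cast ha
  have hb' : (0 : ℝ) < I.b := by exact_mod_cast hb
  have hk' : (0 : ℝ) < I.k := by exact_mod_cast (show 0 < I.k by omega)
  have he0 : 0 < e := by positivity
  obtain ⟨t, lo, hi, hcard, hlohi, hhi, hdis, hpd, hblock, hsum⟩ := exists_blocks he0 h
  have hmain := sum_le_of_blocks (I := I) (q := fun x => (q x).toReal)
    (fun x => ENNReal.toReal_nonneg) hA t hcard (by omega) lo hi hlohi hhi hdis (I.levels - 1)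
  have h1 : I.levels - 1 + 1 = I.levels := Nat.sub_add_cancel (levels_pos ha hab)
  rw [h1, Finset.sum_congr rfl fun J hJ => by rw [hblock J hJ]] at hmain
  have h2 : ∑ J ∈ t, ∑ z ∈ J, ((p z).toReal - I.weight z / I.total) ≤ e / 8 := by
    refine le_trans ?_ hθ
    have h3 : ∑ J ∈ t, ∑ z ∈ J, |(p z).toReal - I.weight z / I.total| =
        ∑ z ∈ t.biUnion id, |(p z).toReal - I.weight z / I.total| := (Finset.sum_biUnion hpd).symm
    calc _ ≤ ∑ J ∈ t, ∑ z ∈ J, |(p z).toReal - I.weight z / I.total| :=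
          Finset.sum_le_sum fun J _ => Finset.sum_le_sum fun z _ => le_abs_self _
      _ ≤ _ := by
          rw [h3]
          exact Finset.sum_le_sum_of_subset_of_nonneg (Finset.subset_univ _)
            fun _ _ _ => abs_nonneg _
  have h4 : ∑ J ∈ t, ∑ z ∈ J, ((p z).toReal - (q z).toReal) =
      ∑ J ∈ t, ∑ z ∈ J, ((p z).toReal - I.weight z / I.total) +
        ∑ J ∈ t, ∑ z ∈ J, ((I.weight z : ℝ) / I.total - (q z).toReal) := by
    rw [← Finset.sum_add_distrib]
    refine Finset.sum_congr rfl fun J _ => ?_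
    rw [← Finset.sum_add_distrib]
    exact Finset.sum_congr rfl fun z _ => by ring
  have h5 : 2 / (16 : ℝ) ^ (I.levels - 1) ≤ e / 8 := by
    have := le_pow_levels (I := I) ha hab
    rw [← he, div_le_iff₀ he0] at this
    rw [div_le_iff₀ (by positivity)]
    linarith
  -- From the missing mass `e / 2`, one `e / 8` is lost by replacing `p` with the weights and
  -- another by stopping at the finest level.
  have h6 : e / 4 ≤ √(64 * I.k * I.energy (fun x => (q x).toReal) I.levels) := by linarith
  have h7 := Real.le_sqrt' (by positivity) |>.1 h6
  have hscale : 0 < I.scale := by unfold scale; omega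
  have h8 := energy_le_roundedEnergy (I := I) (q := fun x => (q x).toReal)
    (fun x => ENNReal.toReal_nonneg) q.sum_toReal (by omega) hscale I.levels
  -- As `1 ≤ a`, the resolution `1024 * b` of the rounding is fine enough for the accuracy `e = a /
  -- b`.
  have h9 : 4 / ((I.scale : ℝ) ^ 2 * I.k) ≤ e ^ 2 / (2 ^ 18 * I.k) := by
    have h10 : 1 / (I.b : ℝ) ≤ e := by
      rw [he]
      gcongr
      exact_mod_cast ha
    calc 4 / ((I.scale : ℝ) ^ 2 * I.k) = (1 / (I.b : ℝ)) ^ 2 / (2 ^ 18 * I.k) := by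
          unfold scale
          push_cast
          field_simp
          norm_num
      _ ≤ _ := by gcongr
  have h11 : e ^ 2 / (1024 * I.k) ≤ I.energy (fun x => (q x).toReal) I.levels := by
    rw [div_le_iff₀ (by positivity)]
    linarith
  have e1 : e ^ 2 / (1024 * I.k) = 4 * (e ^ 2 / (4096 * I.k)) := by ring
  have e2 : e ^ 2 / (2 ^ 18 * I.k) = (e ^ 2 / (4096 * I.k)) / 64 := by ring
  have e3 : 0 ≤ e ^ 2 / (4096 * I.k) := by positivity
  linarith

/-- Distributions close to the weights have small energy. -/
theorem roundedEnergy_le {p : PMF (Fin I.n)} (hk : 2 ≤ I.k) (ha : 0 < I.a)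
    (hab : I.a ≤ 2 * I.b) (hA : 0 < I.total) {c : ℝ} (hc : 0 ≤ c) (hc' : c ≤ 1 / 10 ^ 5)
    (hθ : ∑ x : Fin I.n, |(p x).toReal - I.weight x / I.total| ≤
      c * ((I.a : ℝ) / I.b) ^ 2 / √(I.k : ℝ)) :
    I.roundedEnergy (fun x => (p x).toReal) I.levels ≤
      ((I.a : ℝ) / I.b) ^ 2 / (32768 * I.k) := by
  set e := (I.a : ℝ) / I.b with he
  have hb : 0 < I.b := by omega
  have ha' : (0 : ℝ) < I.a := by exact_mod_cast ha
  have hb' : (0 : ℝ) < I.b := by exact_mod_cast hb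
  have hk' : (0 : ℝ) < I.k := by exact_mod_cast (show 0 < I.k by omega)
  have he0 : 0 < e := by positivity
  have he2 : e ≤ 2 := by
    rw [he, div_le_iff₀ hb']
    exact_mod_cast hab
  have hscale : 0 < I.scale := by unfold scale; omega
  have h8 := roundedEnergy_le_energy (I := I) (q := fun x => (p x).toReal)
    (fun x => ENNReal.toReal_nonneg) p.sum_toReal (by omega) hscale I.levels
  have h9 : 4 / ((I.scale : ℝ) ^ 2 * I.k) ≤ e ^ 2 / (2 ^ 18 * I.k) := by
    have h10 : 1 / (I.b : ℝ) ≤ e := by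
      rw [he]
      gcongr
      exact_mod_cast ha
    calc 4 / ((I.scale : ℝ) ^ 2 * I.k) = (1 / (I.b : ℝ)) ^ 2 / (2 ^ 18 * I.k) := by
          unfold scale
          push_cast
          field_simp
          norm_num
      _ ≤ _ := by gcongr
  have h1 := energy_le_of_close (I := I) hA hθ I.levels
  have h2 : (2 : ℝ) ^ I.levels ≤ 512 / e := by
    obtain ⟨N, hN⟩ : ∃ N, I.levels = N + 1 :=
      ⟨I.levels - 1, by have := levels_pos (I := I) ha hab; omega⟩
    have h3 := pow_levels_le (I := I) ha hab
    rw [hN, Nat.add_sub_cancel, ← he] at h3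
    have h4 : (2 : ℝ) ^ N ≤ 16 ^ N := pow_le_pow_left₀ (by norm_num) (by norm_num) _
    rw [hN, pow_succ]
    calc (2 : ℝ) ^ N * 2 ≤ 256 / e * 2 := by linarith
      _ = _ := by ring
  -- The factor `512 / e` uses up one power of `e` in e⁴, and `e ≤ 2` reduces the remaining e³ to
  -- 2e².
  have h3 : (2 : ℝ) ^ I.levels * (c * e ^ 2 / √(I.k : ℝ)) ^ 2 ≤ e ^ 2 / (10 ^ 6 * I.k) := by
    have hsq : √(I.k : ℝ) ^ 2 = I.k := Real.sq_sqrt hk'.le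
    calc _ ≤ 512 / e * ((1 / 10 ^ 5) * e ^ 2 / √(I.k : ℝ)) ^ 2 := by gcongr
      _ = (512 / 10 ^ 10 * e) * (e ^ 2 / I.k) := by
          rw [div_pow, hsq]
          field_simp
      _ ≤ (1 / 10 ^ 6) * (e ^ 2 / I.k) := by
          gcongr
          linarith
      _ = _ := by ring
  have e1 : e ^ 2 / (32768 * I.k) = e ^ 2 / I.k / 32768 := by ring
  have e2 : e ^ 2 / (2 ^ 18 * I.k) = e ^ 2 / I.k / 2 ^ 18 := by ring
  have e3 : e ^ 2 / (10 ^ 6 * I.k) = e ^ 2 / I.k / 10 ^ 6 := by ring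
  have e4 : 0 ≤ e ^ 2 / (I.k : ℝ) := by positivity
  rw [e1]
  rw [e2] at h9
  rw [e3] at h3
  linarith

end Params

/-! ### The running time is polynomial -/

/-- The quantity `f j + V` grows at most by the factor 129 in each step. -/
theorem le_pow_mul_of_step {f : ℕ → ℕ} {D V : ℕ} (h0 : f 0 ≤ D) {N : ℕ}
    (h : ∀ j < N, f (j + 1) ≤ 128 * f j + V) : f N ≤ 129 ^ N * (D + V) := by
  have key : ∀ j ≤ N, f j + V ≤ 129 ^ j * (D + V) := by
    intro j
    induction j with
    | zero => intro _; simpa using h0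
    | succ j ih =>
      intro hj
      have h1 := h j hj
      have h2 := ih (by omega)
      rw [pow_succ]
      calc _ ≤ 129 * (f j + V) := by omega
        _ ≤ 129 * (129 ^ j * (D + V)) := Nat.mul_le_mul_left _ h2
        _ = _ := by ring
  exact (Nat.le_add_right _ _).trans (key N le_rfl)

namespace Params

variable {I : Params}

/-- The parameters are polynomially bounded in `Y` in value or in length. -/
structure Sized (I : Params) (Y : ℕ) : Prop where
  n_le : I.n + 5 ≤ Y
  k_le : I.k ≤ I.n
  k_pos : 2 ≤ I.k
  a_pos : 0 < I.a
  b_le : I.b ≤ 2 * Y * I.a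
  a_lt : I.a ≤ 2 ^ Y
  b_lt : I.b ≤ 2 ^ Y
  weight_le : ∀ x, I.weight x ≤ 2 ^ Y

variable {Y : ℕ}

theorem Sized.root_le (h : I.Sized Y) : I.root ≤ Y := by
  have h1 := h.k_pos
  have h2 := h.k_le
  have h3 := h.n_le
  have := Nat.sqrt_le_self (I.k - 1)
  unfold root
  omega

/-- The ratio `b / a` is at most `2 * Y` and the root is at most `Y`, so the number of samples is
cubic in `Y`. -/
theorem Sized.draws_le (h : I.Sized Y) : I.draws ≤ 10 ^ 9 * Y ^ 3 := by
  have hY : 1 ≤ Y := by have := h.n_le; omega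
  have h1 : 10 ^ 8 * I.root * (I.b * I.b) / (I.a * I.a) ≤ 10 ^ 8 * Y * (2 * Y * (2 * Y)) := by
    refine Nat.div_le_of_le_mul ?_
    calc 10 ^ 8 * I.root * (I.b * I.b) ≤ 10 ^ 8 * Y * ((2 * Y * I.a) * (2 * Y * I.a)) :=
          Nat.mul_le_mul (Nat.mul_le_mul_left _ h.root_le) (Nat.mul_le_mul h.b_le h.b_le)
      _ = _ := by ring
  have h2 : 1 ≤ Y ^ 3 := Nat.one_le_pow _ _ hY
  have h3 : 10 ^ 8 * Y * (2 * Y * (2 * Y)) = 4 * 10 ^ 8 * Y ^ 3 := by ring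
  unfold draws
  omega

theorem Sized.pow_levels_le (h : I.Sized Y) : 16 ^ I.levels ≤ 8192 * Y := by
  have hY : 1 ≤ Y := by have := h.n_le; omega
  rcases Nat.eq_zero_or_pos I.levels with h0 | h0
  · rw [h0]
    omega
  · have h1 := (I.lt_levels_iff h.a_pos (I.levels - 1)).1 (by omega)
    have h2 : 16 ^ (I.levels - 1) * I.a ≤ 512 * Y * I.a := by
      have := h.b_le
      have e : 512 * Y * I.a = 256 * (2 * Y * I.a) := by ring
      omega
    have h3 := Nat.le_of_mul_le_mul_right h2 h.a_pos
    obtain ⟨N, hN⟩ : ∃ N, I.levels = N + 1 := ⟨I.levels - 1, by omega⟩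
    rw [hN] at h3 ⊢
    rw [Nat.add_sub_cancel] at h3
    rw [pow_succ]
    omega

theorem Sized.levels_le (h : I.Sized Y) : I.levels ≤ 8192 * Y :=
  (Nat.lt_pow_self (by norm_num)).le.trans h.pow_levels_le

theorem Sized.testerTime_le (h : I.Sized Y) (X : ℕ) :
    I.testerTime X ≤ 10 ^ 21 * Y ^ 6 * stepCost X := by
  have hY : 1 ≤ Y := by have := h.n_le; omega
  have hpow : ∀ i j, i ≤ j → Y ^ i ≤ Y ^ j := fun i j hij => Nat.pow_le_pow_right hY hij
  set w := stepCost X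
  have hw : ∀ i j, i ≤ j → Y ^ i * w ≤ Y ^ j * w := fun i j hij =>
    Nat.mul_le_mul_right _ (hpow i j hij)
  have h1 : I.cellTime X ≤ 10 ^ 11 * (Y ^ 3 * w) := by
    have := Nat.mul_le_mul_right (27 * w) h.draws_le
    have := hw 0 3 (by norm_num)
    have e : I.cellTime X = 13 * (Y ^ 0 * w) + I.draws * (27 * w) := by
      simp only [cellTime]
      ring
    rw [e]
    have e2 : 10 ^ 9 * Y ^ 3 * (27 * w) = 27 * 10 ^ 9 * (Y ^ 3 * w) := by ring
    omega
  have hk : I.k * 16 ^ I.levels ≤ 8192 * Y ^ 2 := by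
    calc I.k * 16 ^ I.levels ≤ Y * (8192 * Y) := Nat.mul_le_mul
          (by have := h.n_le; have := h.k_le; omega) h.pow_levels_le
      _ = _ := by ring
  have h2 : I.levelTime X ≤ 10 ^ 16 * (Y ^ 5 * w) := by
    have h3 : I.k * 16 ^ I.levels * (w + I.cellTime X) ≤
        8192 * Y ^ 2 * (Y ^ 3 * w + 10 ^ 11 * (Y ^ 3 * w)) := by
      refine Nat.mul_le_mul hk (Nat.add_le_add ?_ h1)
      simpa using hw 0 3 (by norm_num)
    have e2 : 8192 * Y ^ 2 * (Y ^ 3 * w + 10 ^ 11 * (Y ^ 3 * w)) =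
      (8192 + 8192 * 10 ^ 11) * (Y ^ 5 * w) := by ring
    have := hw 0 5 (by norm_num)
    have e : I.levelTime X = 9 * (Y ^ 0 * w) + I.k * 16 ^ I.levels * (w + I.cellTime X) := by
      simp only [levelTime]
      ring
    omega
  have h3 : I.levels * (w + I.levelTime X) ≤ 8192 * Y * (Y ^ 5 * w + 10 ^ 16 * (Y ^ 5 * w)) := by
    refine Nat.mul_le_mul h.levels_le (Nat.add_le_add ?_ h2)
    simpa using hw 0 5 (by norm_num)
  have e3 : 8192 * Y * (Y ^ 5 * w + 10 ^ 16 * (Y ^ 5 * w)) =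
    (8192 + 8192 * 10 ^ 16) * (Y ^ 6 * w) := by ring
  have h4 : I.root * (4 * w) ≤ 4 * (Y ^ 6 * w) := by
    have := Nat.mul_le_mul_right (4 * w) h.root_le
    have h5 := hw 1 6 (by norm_num)
    have e : Y * (4 * w) = 4 * (Y ^ 1 * w) := by ring
    omega
  have h5 : I.n * (8 * w) ≤ 8 * (Y ^ 6 * w) := by
    have := Nat.mul_le_mul_right (8 * w) (show I.n ≤ Y by have := h.n_le; omega)
    have h5 := hw 1 6 (by norm_num)
    have e : Y * (8 * w) = 8 * (Y ^ 1 * w) := by ring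
    omega
  have h6 : I.draws * (6 * w) ≤ 6 * 10 ^ 9 * (Y ^ 6 * w) := by
    have := Nat.mul_le_mul_right (6 * w) h.draws_le
    have h5 := hw 3 6 (by norm_num)
    have e : 10 ^ 9 * Y ^ 3 * (6 * w) = 6 * 10 ^ 9 * (Y ^ 3 * w) := by ring
    omega
  have h7 := hw 0 6 (by norm_num)
  have e4 : I.testerTime X = 100 * (Y ^ 0 * w) + I.root * (4 * w) + I.n * (8 * w) +
      I.draws * (6 * w) + I.levels * (w + I.levelTime X) := by
    simp only [testerTime]
    ring
  rw [e4, mul_assoc]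
  omega

/-- A bound for all numbers that occur during the computation. -/
def sizeBound (Y : ℕ) : ℕ := (2 ^ Y) ^ 60

theorem stepCost_sizeBound_le (hY : 1 ≤ Y) : stepCost (sizeBound Y) ≤ 123 * Y := by
  have : (sizeBound Y).size ≤ 60 * Y + 1 := by
    rw [Nat.size_le, sizeBound, ← pow_mul, mul_comm]
    exact Nat.pow_lt_pow_right (by norm_num) (by omega)
  unfold stepCost
  omega

theorem Sized.bounds (h : I.Sized Y) (hab : I.a ≤ 2 * I.b) (hA : 0 < I.total) (y : ℕ → ℕ) :
    I.SetupBounds (sizeBound Y) ∧ I.Bounds y (sizeBound Y) := by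
  have hY7 : 7 ≤ Y := by have := h.n_le; have := h.k_le; have := h.k_pos; omega
  set W := 2 ^ Y with hW
  have hb : 0 < I.b := by have := h.a_pos; omega
  have hW1 : 1 ≤ W := Nat.one_le_two_pow
  have hYW : Y ≤ W := Nat.lt_two_pow_self.le
  have hpow : ∀ {i j}, i ≤ j → W ^ i ≤ W ^ j := fun hij => Nat.pow_le_pow_right hW1 hij
  -- Since `Y ≥ 7`, every factor `W` absorbs seven factors 2; numerical constants are converted to
  -- powers of `W` in this way.
  have h2W : ∀ i j, i ≤ 7 * j → 2 ^ i ≤ W ^ j := by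
    intro i j hij
    rw [hW, ← pow_mul]
    exact Nat.pow_le_pow_right (by norm_num) (hij.trans (Nat.mul_le_mul_right _ hY7))
  have hmul : ∀ {x z i j : ℕ}, x ≤ W ^ i → z ≤ W ^ j → x * z ≤ W ^ (i + j) := fun hx hz => by
    rw [pow_add]
    exact Nat.mul_le_mul hx hz
  have hYW1 : Y ≤ W ^ 1 := by rwa [pow_one]
  have hn : I.n ≤ W ^ 1 := by have := h.n_le; omega
  have hk : I.k ≤ W ^ 1 := h.k_le.trans hn
  have ha : I.a ≤ W ^ 1 := by rw [pow_one]; exact h.a_lt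
  have hb' : I.b ≤ W ^ 1 := by rw [pow_one]; exact h.b_lt
  have hroot : I.root ≤ W ^ 1 := h.root_le.trans hYW1
  have hdraws : I.draws ≤ W ^ 8 := by
    refine h.draws_le.trans (hmul (i := 5) (j := 3) ?_ ?_)
    · exact le_trans (by norm_num) (h2W 30 5 (by norm_num))
    · exact Nat.pow_le_pow_left hYW _
  have hlev : 16 ^ I.levels ≤ W ^ 3 := by
    refine h.pow_levels_le.trans (hmul (i := 2) (j := 1) ?_ hYW1)
    exact le_trans (by norm_num) (h2W 13 2 (by norm_num))
  have hkl : I.k * 16 ^ I.levels ≤ W ^ 4 := hmul hk hlev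
  have htot : I.total ≤ W ^ 2 := by
    unfold total cum
    refine (Finset.sum_le_card_nsmul _ _ W fun x _ => h.weight_le x).trans ?_
    rw [Finset.card_range, smul_eq_mul]
    exact hmul (i := 1) (j := 1) hn (by rw [pow_one])
  have hscale : I.scale ≤ W ^ 3 :=
    hmul (i := 2) (j := 1) (le_trans (by norm_num) (h2W 10 2 (by norm_num))) hb'
  have hscale0 : 0 < I.scale := by unfold scale; omega
  have hcell : I.cellBound ≤ W ^ 17 := hmul hdraws (hmul (hmul htot hkl) hscale)
  have hcell2 : I.cellBound * I.cellBound ≤ W ^ 34 := hmul hcell hcell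
  have hthr : I.k * (I.a * I.a) * (I.draws * I.draws) ≤ W ^ 19 :=
    hmul (hmul hk (hmul ha ha)) (hmul hdraws hdraws)
  -- As 129 ≤ 16², the repeated multiplication of the accumulators costs at most the square of `16 ^
  -- I.levels`.
  have h129 : 129 ^ I.levels ≤ W ^ 6 := by
    calc 129 ^ I.levels ≤ (16 * 16) ^ I.levels := Nat.pow_le_pow_left (by norm_num) _
      _ = 16 ^ I.levels * 16 ^ I.levels := mul_pow _ _ _
      _ ≤ _ := hmul hlev hlev
  have htwo : 2 ≤ W ^ 1 := le_trans (by norm_num) (h2W 1 1 (by norm_num))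
  -- The exponent 46 is 4 + 8 + 34, for the cells of a level, the samples and the square of
  -- `cellBound`.
  have hacc : ∀ f : ℕ → ℕ, f 0 ≤ W ^ 46 →
      (∀ j < I.levels, f (j + 1) ≤ 128 * f j + W ^ 46) → f I.levels ≤ sizeBound Y := by
    intro f h0 hf
    refine (le_pow_mul_of_step h0 hf).trans ((hmul (j := 47) h129 ?_).trans (hpow (by norm_num)))
    rw [← two_mul, show W ^ 47 = W ^ 1 * W ^ 46 by rw [← pow_add]]
    exact Nat.mul_le_mul_right _ htwo
  have hlevel : ∀ j < I.levels, I.k * 16 ^ j ≤ I.k * 16 ^ I.levels := fun j hj =>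
    Nat.mul_le_mul_left _ (Nat.pow_le_pow_right (by norm_num) hj.le)
  have hX : ∀ {z i}, z ≤ W ^ i → i ≤ 60 → z ≤ sizeBound Y := fun hz hi => hz.trans (hpow hi)
  have hm := I.draws_pos
  have hadd : I.draws + I.n + 200 ≤ sizeBound Y := by
    have h1 : I.draws ≤ W ^ 9 := hdraws.trans (hpow (by norm_num))
    have h2 : I.n ≤ W ^ 9 := hn.trans (hpow (by norm_num))
    have h3 : 2 ^ 63 ≤ W ^ 9 := h2W 63 9 (by norm_num)
    have h4 : W ^ 9 * 4 ≤ W ^ 10 :=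
      hmul (i := 9) (j := 1) le_rfl (le_trans (by norm_num) (h2W 2 1 (by norm_num)))
    have h5 : W ^ 10 ≤ sizeBound Y := hpow (by norm_num)
    omega
  refine ⟨⟨by have := h.k_pos; omega, h.a_pos, ?_, hadd, hX htot (by norm_num), ?_, ?_, ?_, ?_⟩,
    ⟨hA, hb, hadd, ?_, ?_, ?_, ?_, ?_, ?_⟩⟩
  · exact hX (i := 5) (le_trans (by norm_num) (h2W 30 5 (by norm_num))) (by norm_num)
  · refine hX (hmul (hmul (i := 5) ?_ hroot) (hmul hb' hb')) (by norm_num)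
    exact le_trans (by norm_num) (h2W 30 5 (by norm_num))
  · exact hX (hmul hdraws hscale) (by norm_num)
  · exact hX hthr (by norm_num)
  · exact hX (hmul hroot hroot) (by norm_num)
  · exact hX (hmul (i := 1) (le_trans (by norm_num) (h2W 2 1 (by norm_num))) hcell2) (by norm_num)
  · exact hX hkl (by norm_num)
  · exact hX (hmul (i := 2) (le_trans (by norm_num) (h2W 8 2 (by norm_num))) hb') (by norm_num)
  · exact hX (hmul hlev ha) (by norm_num)
  · refine hacc _ (Nat.zero_le _) fun j hj => ?_
    rw [accSq]
    refine Nat.add_le_add_left ?_ _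
    refine (Finset.sum_le_card_nsmul _ _ (I.cellBound * I.cellBound) fun c hc =>
      I.cellSq_le (hlevel j hj) hA y (Finset.mem_range.1 hc)).trans ?_
    rw [Finset.card_range, smul_eq_mul]
    exact (hmul ((hlevel j hj).trans hkl) hcell2).trans (hpow (by norm_num))
  · refine hacc _ ?_ fun j hj => ?_
    · rw [accDiag]
      refine le_trans (Nat.mul_le_mul_left _ (Nat.mul_le_mul_left _ (Nat.sub_le _ _))) ?_
      exact hthr.trans (hpow (by norm_num))
    · rw [accDiag]
      refine Nat.add_le_add_left ?_ _
      have hdiag : ∀ c ∈ Finset.range (I.k * 16 ^ j), ∑ i ∈ Finset.range I.draws,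
          I.sampleDiag (I.k * 16 ^ j) y c i ≤ I.draws * (I.cellBound * I.cellBound) := by
        intro c hc
        have hc' := Finset.mem_range.1 hc
        have hcb := I.le_cellBound (hlevel j hj)
        have h0 : I.total * (I.k * 16 ^ j) * I.scale ≤ I.cellBound :=
          (Nat.le_mul_of_pos_left _ hm).trans hcb
        refine (Finset.sum_le_card_nsmul _ _ (I.cellBound * I.cellBound) fun i _ =>
          sqDist_le ((I.share_le hc' _).trans h0) (le_trans ?_ h0)).trans ?_
        · exact Nat.le_mul_of_pos_left _ (Nat.mul_pos hA (by omega))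
        · rw [Finset.card_range, smul_eq_mul]
      refine (Finset.sum_le_card_nsmul _ _ _ hdiag).trans ?_
      rw [Finset.card_range, smul_eq_mul]
      exact hmul ((hlevel j hj).trans hkl) (hmul hdraws hcell2)

/-- The time that the tester is allowed. -/
noncomputable def timePoly : Polynomial ℕ := Polynomial.C (10 ^ 24) * Polynomial.X ^ 7

theorem Sized.exec_tester {s : ℕ → ℕ} {r : ℕ → Bool} (h : I.Sized Y)
    (hA : I.a ≤ 2 * I.b → 0 < I.total) (hs : ∀ i, s i < I.n) {σ : State}
    (hσ : σ.reg 0 = 0 ∧ σ.drawn = 0 ∧ σ.mem 0 = I.n ∧ σ.mem 1 = I.k ∧ σ.mem 2 = I.a ∧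
        σ.mem 3 = I.b ∧ ∀ x < I.n, σ.mem (x + 4 + 1) = I.weight x) :
    ∃ t τ, Exec s r tester σ t τ ∧ t ≤ timePoly.eval Y ∧
      (τ.reg 0 = 1 ↔ I.a ≤ 2 * I.b → I.accSq s I.levels ≤ I.accDiag s I.levels) ∧
        τ.drawn = if I.a ≤ 2 * I.b then I.draws else 0 := by
  have hY7 : 7 ≤ Y := by have := h.n_le; have := h.k_le; have := h.k_pos; omega
  have hX : ∀ {z i : ℕ}, z ≤ (2 ^ Y) ^ i → i ≤ 60 → z ≤ sizeBound Y := fun hz hi =>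
    hz.trans (Nat.pow_le_pow_right Nat.one_le_two_pow hi)
  have hYW : Y ≤ 2 ^ Y := Nat.lt_two_pow_self.le
  have hn : I.n ≤ sizeBound Y := hX (i := 1) (by have := h.n_le; rw [pow_one]; omega) (by norm_num)
  have h128 : 2 ^ 7 ≤ 2 ^ Y := Nat.pow_le_pow_right (by norm_num) hY7
  have hb : 2 * I.b + 100 ≤ sizeBound Y := by
    refine hX (i := 2) ?_ (by norm_num)
    have := h.b_lt
    have h1 : 2 ^ 7 * 2 ^ Y ≤ 2 ^ Y * 2 ^ Y := Nat.mul_le_mul_right _ h128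
    rw [sq]
    omega
  obtain ⟨t, τ, he, ht, hτ⟩ := tester_triple (s := s) (r := r) (X := sizeBound Y) I hn
    (h.k_le.trans hn) (hX (i := 1) (by rw [pow_one]; exact h.a_lt) (by norm_num)) hb
    (fun hab => ⟨by have := h.a_pos; omega, h.bounds hab (hA hab) s⟩) hs σ hσ
  refine ⟨t, τ, he, ht.trans ?_, hτ⟩
  have h1 := h.testerTime_le (sizeBound Y)
  have h2 := stepCost_sizeBound_le (Y := Y) (by omega)
  have h3 : 10 ^ 21 * Y ^ 6 * stepCost (sizeBound Y) ≤ 10 ^ 21 * Y ^ 6 * (123 * Y) :=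
    Nat.mul_le_mul_left _ h2
  have h4 : 10 ^ 21 * Y ^ 6 * (123 * Y) = 123 * 10 ^ 21 * Y ^ 7 := by ring
  have h5 : Y ≤ Y ^ 7 := Nat.le_self_pow (by norm_num) Y
  rw [timePoly, Polynomial.eval_mul, Polynomial.eval_C, Polynomial.eval_pow, Polynomial.eval_X]
  split_ifs <;> omega

end Params

/-! ### Finite samples and the law of a run -/

theorem measurable_restrict_samples {n : ℕ} (m : ℕ) :
    Measurable fun ω : (ℕ → Fin n) × (ℕ → Bool) => fun i : Fin m => ω.1 i :=
  measurable_pi_lambda _ fun i => (measurable_pi_apply (i : ℕ)).comp measurable_fst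

instance runLaw_isProbabilityMeasure {n : ℕ} (q : PMF (Fin n)) :
    IsProbabilityMeasure (runLaw q) := by
  unfold runLaw
  infer_instance

theorem runLaw_real_samples_eq {n : ℕ} (q : PMF (Fin n)) {m : ℕ} (y : Fin m → Fin n) :
    (runLaw q).real {ω | (fun i : Fin m => ω.1 i) = y} = ∏ i, (q (y i)).toReal := by
  have hset : {ω : (ℕ → Fin n) × (ℕ → Bool) | (fun i : Fin m => ω.1 i) = y} =
      (Set.pi (Finset.range m : Set ℕ)
        fun i => if h : i < m then {y ⟨i, h⟩} else Set.univ) ×ˢ Set.univ := by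
    ext ω
    simp only [Set.mem_ofPred_eq, Set.mem_prod, Set.mem_pi, Set.mem_univ, and_true,
      Finset.coe_range, Set.mem_Iio, funext_iff]
    constructor
    · intro h i hi
      simpa [hi] using h ⟨i, hi⟩
    · intro h i
      simpa using h i i.2
  rw [hset, runLaw, Measure.real, Measure.prod_prod, measure_univ, mul_one,
    Measure.infinitePi_pi, ENNReal.toReal_prod]
  · rw [← Fin.prod_univ_eq_prod_range (fun i => (q.toMeasure
      (if h : i < m then {y ⟨i, h⟩} else Set.univ)).toReal)]
    refine Finset.prod_congr rfl fun i _ => ?_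
    simp
  · intro i _
    exact MeasurableSet.of_discrete

theorem runLaw_real_samples {n : ℕ} (q : PMF (Fin n)) {m : ℕ} (p : (Fin m → Fin n) → Prop)
    [DecidablePred p] :
    (runLaw q).real {ω | p fun i : Fin m => ω.1 i} =
      sampleMean (fun x => (q x).toReal) m fun y => if p y then 1 else 0 := by
  have hf := measurable_restrict_samples (n := n) m
  have h1 : (runLaw q).real {ω | p fun i : Fin m => ω.1 i} =
      ((runLaw q).map fun ω => fun i : Fin m => ω.1 i).real
        (Finset.univ.filter p : Finset (Fin m → Fin n)) := by
    rw [map_measureReal_apply hf MeasurableSet.of_discrete]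
    congr 1
    ext ω
    simp
  rw [h1, ← sum_measureReal_singleton, Finset.sum_filter, sampleMean]
  refine Finset.sum_congr rfl fun y _ => ?_
  split_ifs with hp
  · rw [map_measureReal_apply hf MeasurableSet.of_discrete, mul_one, ← runLaw_real_samples_eq]
    rfl
  · rw [mul_zero]

/-- `S` need not be measurable: it contains the measurable event that `p` fails on the first `m`
samples, and monotonicity holds for all sets. -/
theorem le_runLaw_real {n : ℕ} (q : PMF (Fin n)) {m : ℕ} (p : (Fin m → Fin n) → Prop)
    [DecidablePred p] (S : Set ((ℕ → Fin n) × (ℕ → Bool)))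
    (hS : ∀ ω, ¬ p (fun i : Fin m => ω.1 i) → ω ∈ S)
    (h : sampleMean (fun x => (q x).toReal) m (fun y => if p y then 1 else 0) ≤ 1 / 3) :
    2 / 3 ≤ (runLaw q).real S := by
  have h1 : (runLaw q).real {ω | ¬ p fun i : Fin m => ω.1 i} ≤ (runLaw q).real S :=
    measureReal_mono hS (measure_ne_top _ _)
  have h2 : MeasurableSet {ω : (ℕ → Fin n) × (ℕ → Bool) | p fun i : Fin m => ω.1 i} :=
    measurable_restrict_samples m (MeasurableSet.of_discrete (s := {y | p y}))
  have h3 := probReal_add_probReal_compl (μ := runLaw q) h2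
  rw [runLaw_real_samples] at h3
  have h4 : {ω : (ℕ → Fin n) × (ℕ → Bool) | p fun i : Fin m => ω.1 i}ᶜ =
      {ω | ¬ p fun i : Fin m => ω.1 i} := rfl
  rw [h4] at h3
  linarith

/-! ### Inputs -/

/-- The parameters of an input. -/
def inputParams {n : ℕ} (k a b : ℕ) (α : Fin n → ℕ) : Params where
  n := n
  k := k
  a := a
  b := b
  weight x := if h : x < n then α ⟨x, h⟩ else 0

theorem size_lt_bitLength {l : List ℕ} {x : ℕ} (h : x ∈ l) : x.size < bitLength l := by
  have : x.size + 1 ∈ l.map fun x => x.size + 1 := List.mem_map.2 ⟨x, h, rfl⟩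
  exact List.single_le_sum (by simp) _ this

theorem length_le_bitLength (l : List ℕ) : l.length ≤ bitLength l := by
  induction l with
  | nil => simp
  | cons x l ih =>
    simp only [bitLength, List.map_cons, List.sum_cons, List.length_cons] at ih ⊢
    omega

section Input

variable {n k a b N : ℕ} {α : Fin n → ℕ}

theorem inputParams_sized {η ε : ℝ} {p : PMF (Fin n)} (hk : 2 ≤ k) (hkn : k ≤ n) (hε : 0 < ε)
    (h : Describes η ε p a b N α) :
    (inputParams k a b α).Sized (bitLength (testerInput k a b N α) + ⌈1 / ε⌉₊) := by
  obtain ⟨h1, h2, h3, h4⟩ := h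
  have hpos : 0 < (a : ℝ) / b := by linarith
  have hb : 0 < b := by
    rcases Nat.eq_zero_or_pos b with rfl | hb
    · simp at hpos
    · exact hb
  have ha : 0 < a := by
    rcases Nat.eq_zero_or_pos a with rfl | ha
    · simp at hpos
    · exact ha
  set Y := bitLength (testerInput k a b N α) + ⌈1 / ε⌉₊
  have hsize : ∀ x ∈ testerInput k a b N α, x ≤ 2 ^ Y := fun x hx =>
    (Nat.lt_size_self x).le.trans (Nat.pow_le_pow_right (by norm_num)
      ((size_lt_bitLength hx).le.trans (Nat.le_add_right _ _)))
  refine ⟨?_, hkn, hk, ha, ?_, hsize a (by simp [testerInput]), hsize b (by simp [testerInput]), ?_⟩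
  · have := length_le_bitLength (testerInput k a b N α)
    simp only [testerInput, List.length_append, List.length_ofFn, List.length_cons,
      List.length_nil] at this
    simp only [inputParams]
    change bitLength (testerInput k a b N α) ≥ _ at this
    omega
  · have hb' : (0 : ℝ) < b := by exact_mod_cast hb
    have h5 : 1 / ε ≤ Y := (Nat.le_ceil _).trans (by exact_mod_cast Nat.le_add_left _ _)
    -- This is where ⌈1/ε⌉ enters the size: ε ≤ 2a/b and 1/ε ≤ Y.
    have h6 : (b : ℝ) ≤ 2 * Y * a := by
      rw [div_le_iff₀ hε] at h5
      have h7 : ε * b ≤ 2 * a := by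
        calc ε * b ≤ 2 * (a / b) * b := by gcongr
          _ = 2 * a := by field_simp
      have h8 : (b : ℝ) ≤ Y * ε * b := by
        have := mul_le_mul_of_nonneg_right h5 hb'.le
        linarith
      have h9 : (Y : ℝ) * (ε * b) ≤ Y * (2 * a) := by gcongr
      linarith
    simp only [inputParams]
    exact_mod_cast h6
  · intro x
    simp only [inputParams]
    split_ifs with hx
    · exact hsize _ (by simp [testerInput])
    · exact Nat.zero_le _

theorem init_testerInput :
    (State.init (testerInput k a b N α)).reg 0 = 0 ∧
    (State.init (testerInput k a b N α)).drawn = 0 ∧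
    (State.init (testerInput k a b N α)).mem 0 = n ∧
    (State.init (testerInput k a b N α)).mem 1 = k ∧
    (State.init (testerInput k a b N α)).mem 2 = a ∧
    (State.init (testerInput k a b N α)).mem 3 = b ∧
    ∀ x < n, (State.init (testerInput k a b N α)).mem (x + 4 + 1) =
      (inputParams k a b α).weight x := by
  refine ⟨rfl, rfl, rfl, rfl, rfl, rfl, fun x hx => ?_⟩
  simp [State.init, testerInput, inputParams, hx, List.getD_eq_getElem?_getD]

theorem total_inputParams : (inputParams k a b α).total = ∑ x, α x := by
  have := Fin.sum_univ_eq_sum_range (inputParams k a b α).weight n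
  rw [Params.total, Params.cum]
  change ∑ i ∈ Finset.range n, _ = _
  rw [← this]
  exact Finset.sum_congr rfl fun x _ => by simp [inputParams]

theorem abs_total_sub_le {η ε : ℝ} {p : PMF (Fin n)} (h : Describes η ε p a b N α) :
    |((inputParams k a b α).total : ℝ) / N - 1| ≤ n * η := by
  have e : ((inputParams k a b α).total : ℝ) / N - 1 = ∑ x, ((α x : ℝ) / N - (p x).toReal) := by
    rw [Finset.sum_sub_distrib, p.sum_toReal, ← Finset.sum_div, total_inputParams]
    push_cast
    rfl
  rw [e]
  refine (Finset.abs_sum_le_sum_abs _ _).trans ((Finset.sum_le_card_nsmul _ _ η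
    fun x _ => h.close x).trans ?_)
  simp

/-- One error `n * η` comes from the fractions `α i / N`, the other from replacing `N` by the total
weight. -/
theorem sum_abs_sub_weight_le {η ε : ℝ} {p : PMF (Fin n)} (h : Describes η ε p a b N α)
    (hA : 0 < (inputParams k a b α).total) :
    ∑ x : Fin n, |(p x).toReal - (inputParams k a b α).weight x / (inputParams k a b α).total| ≤
      2 * (n * η) := by
  have hN : (0 : ℝ) < N := by exact_mod_cast h.pos
  have hw : ∀ x : Fin n, (inputParams k a b α).weight x = α x := fun x => by simp [inputParams]
  have htot := abs_total_sub_le (k := k) h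
  have hsum : ((inputParams k a b α).total : ℝ) = ∑ x, (α x : ℝ) := by
    rw [total_inputParams]
    push_cast
    rfl
  set A : ℝ := ((inputParams k a b α).total : ℝ) with hAdef
  have hA' : 0 < A := by
    rw [hAdef]
    exact_mod_cast hA
  calc _ ≤ ∑ x : Fin n, (|(α x : ℝ) / N - (p x).toReal| + (α x : ℝ) / A * |A / N - 1|) := by
        refine Finset.sum_le_sum fun x _ => ?_
        rw [hw]
        have e : (p x).toReal - (α x : ℝ) / A =
            -((α x : ℝ) / N - (p x).toReal) + (α x : ℝ) / A * (A / N - 1) := by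
          field_simp
          ring
        rw [e]
        refine (abs_add_le _ _).trans ?_
        rw [abs_neg, abs_mul, abs_of_nonneg (a := (α x : ℝ) / A) (by positivity)]
    _ = ∑ x : Fin n, |(α x : ℝ) / N - (p x).toReal| + |A / N - 1| := by
        rw [Finset.sum_add_distrib, ← Finset.sum_mul, ← Finset.sum_div, ← hsum,
          div_self hA'.ne', one_mul]
    _ ≤ n * η + n * η := by
        refine add_le_add ?_ htot
        refine (Finset.sum_le_card_nsmul _ _ η fun x _ => h.close x).trans ?_
        simp
    _ = _ := by ring

end Input

/-- The tester is efficient, complete and sound. -/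
theorem tester_spec (n k : ℕ) (hk : 2 ≤ k) (hkn : k ≤ n) (ε : ℝ) (hε : 0 < ε) (p : PMF (Fin n))
    (a b N : ℕ) (α : Fin n → ℕ)
    (h : Describes (1 / 10 ^ 6 * ε ^ 2 / (n * √(k : ℝ))) ε p a b N α) :
    RunsWithin n tester (testerInput k a b N α)
      (Params.timePoly.eval (bitLength (testerInput k a b N α) + ⌈1 / ε⌉₊))
      (10 ^ 9 * √(k : ℝ) / ε ^ 2) ∧
    2 / 3 ≤ (runLaw p).real {ω | SaysYes tester (testerInput k a b N α) ω.1 ω.2} ∧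
    ∀ q : PMF (Fin n), ε ≤ akDist k q p →
      2 / 3 ≤ (runLaw q).real {ω | SaysNo tester (testerInput k a b N α) ω.1 ω.2} := by
  classical
  have hsized := inputParams_sized hk hkn hε h
  have hclose := sum_abs_sub_weight_le (k := k) h
  have htotal := abs_total_sub_le (k := k) h
  have hinit := init_testerInput (k := k) (a := a) (b := b) (N := N) (α := α)
  obtain ⟨hε1, hε2, hN, -⟩ := h
  set I := inputParams k a b α with hI
  have ha : 0 < I.a := hsized.a_pos
  have hk' : (0 : ℝ) < k := by exact_mod_cast (show 0 < k by omega)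
  have hs1 : 1 ≤ √(k : ℝ) := by
    rw [Real.one_le_sqrt]
    exact_mod_cast (show 1 ≤ k by omega)
  have hn' : (0 : ℝ) < n := by exact_mod_cast (show 0 < n by omega)
  have hη : n * (1 / 10 ^ 6 * ε ^ 2 / (n * √(k : ℝ))) = 1 / 10 ^ 6 * ε ^ 2 / √(k : ℝ) := by
    field_simp
  rw [hη] at hclose htotal
  set e : ℝ := (a : ℝ) / b with he
  have he0 : 0 < e := by linarith
  have hb : 0 < b := by
    rcases Nat.eq_zero_or_pos b with rfl | hb
    · simp [he] at he0
    · exact hb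
  have hb' : (0 : ℝ) < b := by exact_mod_cast hb
  have he2 : I.a ≤ 2 * I.b ↔ e ≤ 2 := by
    rw [he, div_le_iff₀ hb']
    exact_mod_cast Iff.rfl
  -- Here ε ≤ 2e ≤ 4, so `total / N` is within 1/2 of 1. For large ε the permitted error would allow
  -- all weights to vanish.
  have hA : I.a ≤ 2 * I.b → 0 < I.total := by
    intro hab
    rw [he2] at hab
    have h1 : 1 / 10 ^ 6 * ε ^ 2 / √(k : ℝ) ≤ 1 / 2 := by
      rw [div_le_iff₀ (by positivity)]
      nlinarith
    by_contra h0
    rw [Nat.eq_zero_of_not_pos h0, Nat.cast_zero, zero_div, zero_sub, abs_neg, abs_one] at htotal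
    linarith
  have hexec : ∀ (s : ℕ → Fin n) (r : ℕ → Bool), ∃ t τ,
      Exec (fun j => (s j : ℕ)) r tester (State.init (testerInput k a b N α)) t τ ∧
      t ≤ Params.timePoly.eval (bitLength (testerInput k a b N α) + ⌈1 / ε⌉₊) ∧
      (τ.reg 0 = 1 ↔ I.a ≤ 2 * I.b →
        I.accSq (fun j => s j) I.levels ≤ I.accDiag (fun j => s j) I.levels) ∧
      τ.drawn = if I.a ≤ 2 * I.b then I.draws else 0 :=
    fun s r => hsized.exec_tester hA (fun i => (s i).2) hinit
  -- The constant is 2·10^(-6) times 4, because ε ≤ 2e.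
  have hθ : I.a ≤ 2 * I.b → ∑ x : Fin n, |(p x).toReal - I.weight x / I.total| ≤
      8 / 10 ^ 6 * e ^ 2 / √(k : ℝ) := by
    intro hab
    refine (hclose (hA hab)).trans ?_
    rw [mul_div_assoc', div_le_div_iff_of_pos_right (by positivity)]
    nlinarith
  refine ⟨?_, ?_, ?_⟩
  · intro s r
    obtain ⟨t, τ, h1, h2, h3, h4⟩ := hexec s r
    refine ⟨t, τ, h1, h2, ?_⟩
    rw [h4]
    split_ifs with hab
    · have h5 := I.draws_le
      have h6 := Params.root_le (I := I) (show 0 < k by omega)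
      change (I.draws : ℝ) ≤ 10 ^ 8 * (I.root : ℝ) / e ^ 2 + 1 at h5
      change (I.root : ℝ) ≤ 2 * √(k : ℝ) at h6
      rw [he2] at hab
      -- The factors 2 from `root ≤ 2√k` and 4 from ε² ≤ 4e² give 8·10^8; the additional sample is
      -- absorbed by `h9`, since ε ≤ 4.
      have h7 : 10 ^ 8 * (I.root : ℝ) / e ^ 2 ≤ 8 * 10 ^ 8 * √(k : ℝ) / ε ^ 2 := by
        rw [div_le_div_iff₀ (by positivity) (by positivity)]
        have h8 : ε ^ 2 ≤ 4 * e ^ 2 := by nlinarith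
        calc 10 ^ 8 * (I.root : ℝ) * ε ^ 2 ≤ 10 ^ 8 * (2 * √(k : ℝ)) * (4 * e ^ 2) := by gcongr
          _ = _ := by ring
      have h9 : 1 ≤ 16 * √(k : ℝ) / ε ^ 2 := by
        rw [le_div_iff₀ (by positivity)]
        nlinarith
      have h10 : 8 * 10 ^ 8 * √(k : ℝ) / ε ^ 2 + 16 * √(k : ℝ) / ε ^ 2 ≤
          10 ^ 9 * √(k : ℝ) / ε ^ 2 := by
        rw [← add_div]
        gcongr
        linarith
      linarith
    · rw [Nat.cast_zero]
      positivity
  · by_cases hab : I.a ≤ 2 * I.b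
    · refine le_runLaw_real p (m := I.draws)
        (fun y => ¬ (pairSum (fun x => I.feature I.levels x - I.featureMean I.levels) y ≤
          I.draws * (I.draws - 1) * (((I.a : ℝ) / I.b) ^ 2 / (8192 * I.k)))) _ ?_ ?_
      · intro ω hω
        rw [not_not] at hω
        obtain ⟨t, τ, h1, -, h3, -⟩ := hexec ω.1 ω.2
        refine ⟨t, τ, h1, h3.2 fun _ => ?_⟩
        exact (Params.accept_iff (I := I) (show 0 < k by omega) hb ω.1 I.levels).2 hω
      · exact Params.sampleMean_reject_le (I := I) (fun x => ENNReal.toReal_nonneg) p.sum_toReal hk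
          ha hab (Params.roundedEnergy_le (I := I) (p := p) hk ha hab (hA hab) (by norm_num)
            (by norm_num) (hθ hab)) _ fun y hy => (not_le.1 hy).le
    · have : {ω : (ℕ → Fin n) × (ℕ → Bool) |
          SaysYes tester (testerInput k a b N α) ω.1 ω.2} = Set.univ := by
        refine Set.eq_univ_of_forall fun ω => ?_
        obtain ⟨t, τ, h1, -, h3, -⟩ := hexec ω.1 ω.2
        exact ⟨t, τ, h1, h3.2 fun h => absurd h hab⟩
      rw [this, probReal_univ]
      norm_num
  · intro q hq
    have hab : I.a ≤ 2 * I.b := by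
      rw [he2]
      exact hε1.trans (hq.trans (akDist_le_two k q p))
    refine le_runLaw_real q (m := I.draws)
      (fun y => pairSum (fun x => I.feature I.levels x - I.featureMean I.levels) y ≤
        I.draws * (I.draws - 1) * (((I.a : ℝ) / I.b) ^ 2 / (8192 * I.k))) _ ?_ ?_
    · intro ω hω
      obtain ⟨t, τ, h1, -, h3, -⟩ := hexec ω.1 ω.2
      refine ⟨t, τ, h1, fun h => hω ?_⟩
      exact (Params.accept_iff (I := I) (show 0 < k by omega) hb ω.1 I.levels).1 (h3.1 h hab)
    · refine Params.sampleMean_accept_le (I := I) (fun x => ENNReal.toReal_nonneg) q.sum_toReal hk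
        ha hab (Params.le_roundedEnergy (I := I) (p := p) hk ha hab (hA hab)
          ((hθ hab).trans ?_) (hε1.trans hq)) _ fun y hy => hy
      change 8 / 10 ^ 6 * e ^ 2 / √(k : ℝ) ≤ e / 8
      rw [he2] at hab
      rw [div_le_iff₀ (by positivity)]
      nlinarith

/-! ### The lower bound -/

theorem integral_pi_eq_sampleMean {n m : ℕ} (q : PMF (Fin n)) (f : (Fin m → Fin n) → ℝ) :
    ∫ y, f y ∂(Measure.pi fun _ : Fin m => q.toMeasure) =
      sampleMean (fun x => (q x).toReal) m f := by
  rw [integral_fintype (Integrable.of_finite), sampleMean]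
  refine Finset.sum_congr rfl fun y _ => ?_
  rw [smul_eq_mul, Measure.real, Measure.pi_singleton, ENNReal.toReal_prod]
  simp only [PMF.toMeasure_apply_singleton _ _ (MeasurableSet.singleton _)]

/-- The distribution with given real probabilities. -/
noncomputable def pmfOfReal {n : ℕ} (f : Fin n → ℝ) (hf : ∀ x, 0 ≤ f x) (h1 : ∑ x, f x = 1) :
    PMF (Fin n) :=
  PMF.ofFintype (fun x => ENNReal.ofReal (f x)) (by
    rw [← ENNReal.ofReal_sum_of_nonneg fun x _ => hf x, h1, ENNReal.ofReal_one])

theorem pmfOfReal_toReal {n : ℕ} (f : Fin n → ℝ) (hf : ∀ x, 0 ≤ f x) (h1 : ∑ x, f x = 1)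
    (x : Fin n) : (pmfOfReal f hf h1 x).toReal = f x := by
  rw [pmfOfReal, PMF.ofFintype_apply, ENNReal.toReal_ofReal (hf x)]

/-- The partition of `Fin n` into `k - 1` singletons and the remaining interval. -/
theorem exists_singleton_partition {n k : ℕ} (hk : 0 < k) (hkn : k ≤ n) :
    ∃ I : Finpartition (Finset.univ : Finset (Fin n)), I.parts.card = k ∧
      (∀ J ∈ I.parts, (J : Set (Fin n)).OrdConnected) ∧
      ∀ J ∈ I.parts, ∀ x ∈ J, ∀ y ∈ J, x.1 < k → y.1 < k → x = y := by
  classical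
  set g : Fin n → ℕ := fun x => min x.1 (k - 1) with hg
  set fib : ℕ → Finset (Fin n) := fun j => Finset.univ.filter fun x => g x = j with hfib
  have hmem : ∀ j x, x ∈ fib j ↔ g x = j := fun j x => by simp [hfib]
  have hne : ∀ j < k, ∃ x, x ∈ fib j := fun j hj =>
    ⟨⟨j, lt_of_lt_of_le hj hkn⟩, (hmem _ _).2 (by simp only [hg]; omega)⟩
  refine ⟨Finpartition.ofExistsUnique ((Finset.range k).image fib)
    (fun _ _ => Finset.subset_univ _) ?_ ?_, ?_, ?_, ?_⟩
  · intro x _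
    refine ⟨fib (g x), ⟨Finset.mem_image.2 ⟨g x, ?_, rfl⟩, (hmem _ _).2 rfl⟩, ?_⟩
    · rw [Finset.mem_range]
      simp only [hg]
      omega
    · rintro J ⟨hJ, hxJ⟩
      obtain ⟨j, -, rfl⟩ := Finset.mem_image.1 hJ
      rw [(hmem _ _).1 hxJ]
  · intro h
    obtain ⟨j, hj, hj'⟩ := Finset.mem_image.1 h
    obtain ⟨x, hx⟩ := hne j (Finset.mem_range.1 hj)
    rw [hj'] at hx
    simp at hx
  · change ((Finset.range k).image fib).card = k
    rw [Finset.card_image_of_injOn, Finset.card_range]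
    intro i hi j hj hij
    obtain ⟨x, hx⟩ := hne i (Finset.mem_range.1 hi)
    have hx' : x ∈ fib j := hij ▸ hx
    rw [hmem] at hx hx'
    rw [← hx, ← hx']
  · intro J hJ
    obtain ⟨j, -, rfl⟩ := Finset.mem_image.1 hJ
    refine ⟨fun x hx y hy z hz => ?_⟩
    have hx' := (hmem _ _).1 (Finset.mem_coe.1 hx)
    have hy' := (hmem _ _).1 (Finset.mem_coe.1 hy)
    refine Finset.mem_coe.2 ((hmem _ _).2 ?_)
    have h1 := Fin.le_def.1 hz.1
    have h2 := Fin.le_def.1 hz.2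
    simp only [hg] at *
    omega
  · intro J hJ x hx y hy hxk hyk
    obtain ⟨j, -, rfl⟩ := Finset.mem_image.1 hJ
    rw [hmem] at hx hy
    simp only [hg] at hx hy
    exact Fin.ext (by omega)

/-- The `𝒜_k`-distance of distributions that agree outside the first `k` elements is their
`L₁`-distance. -/
theorem le_akDist {n k : ℕ} (hk : 0 < k) (hkn : k ≤ n) (p q : PMF (Fin n))
    (h : ∀ x : Fin n, k ≤ x.1 → (p x).toReal = (q x).toReal) :
    ∑ x, |(p x).toReal - (q x).toReal| ≤ akDist k p q := by
  classical
  obtain ⟨I, h1, h2, h3⟩ := exists_singleton_partition hk hkn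
  refine le_trans (le_of_eq ?_) (le_ciSup (f := fun I : {I : Finpartition
    (Finset.univ : Finset (Fin n)) //
    I.parts.card = k ∧ ∀ J ∈ I.parts, (J : Set (Fin n)).OrdConnected} =>
    ∑ J ∈ I.1.parts, |(∑ i ∈ J, (p i).toReal) - ∑ i ∈ J, (q i).toReal|)
    (Set.finite_range _).bddAbove ⟨I, h1, h2⟩)
  rw [← I.sum_parts]
  refine Finset.sum_congr rfl fun J hJ => ?_
  rw [← Finset.sum_sub_distrib]
  -- A part contains at most one of the first `k` elements, and no other element contributes, so the
  -- absolute value of the sum is the sum of the absolute values.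
  by_cases hx : ∃ x ∈ J, x.1 < k
  · obtain ⟨x, hxJ, hxk⟩ := hx
    have hz : ∀ y ∈ J, y ≠ x → (p y).toReal - (q y).toReal = 0 := by
      intro y hy hne
      rw [h y, sub_self]
      by_contra! hyk
      exact hne (h3 J hJ y hy x hxJ hyk hxk)
    rw [Finset.sum_eq_single_of_mem x hxJ fun y hy hne => by rw [hz y hy hne, abs_zero],
      Finset.sum_eq_single_of_mem x hxJ hz]
  · push Not at hx
    have hz : ∀ y ∈ J, (p y).toReal - (q y).toReal = 0 := fun y hy => by
      rw [h y (hx y hy), sub_self]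
    rw [Finset.sum_eq_zero hz, Finset.sum_eq_zero fun y hy => by rw [hz y hy, abs_zero], abs_zero]

namespace LowerBound

/-- The sign of a bit. -/
def sign (b : Bool) : ℝ := if b then 1 else -1

/-- The uniform distribution on the first `2 * h` numbers. -/
noncomputable def base (h x : ℕ) : ℝ := if x < 2 * h then 1 / (2 * h) else 0

/-- The direction in which the probabilities are perturbed. -/
noncomputable def pert {h : ℕ} (z : Fin h → Bool) (x : ℕ) : ℝ :=
  if hx : x / 2 < h then (-1) ^ x * sign (z ⟨x / 2, hx⟩) else 0

theorem base_nonneg (h x : ℕ) : 0 ≤ base h x := by unfold base; split_ifs <;> positivity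

/-- The elements `2 * i` and `2 * i + 1` form a pair with equal mass and opposite perturbations; all
sums over `base` are computed pair by pair. -/
theorem sum_base_mul {n h : ℕ} (hn : 2 * h ≤ n) (F : ℕ → ℝ) :
    ∑ x : Fin n, base h x * F x =
      1 / (2 * h) * ∑ i : Fin h, (F (2 * i) + F (2 * i + 1)) := by
  have key : ∀ m, ∑ x ∈ Finset.range (2 * m), F x =
      ∑ i ∈ Finset.range m, (F (2 * i) + F (2 * i + 1)) := by
    intro m
    induction m with
    | zero => simp
    | succ m ih =>
      rw [mul_add, mul_one, Finset.sum_range_succ, Finset.sum_range_succ, ih,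
        Finset.sum_range_succ, add_assoc]
  rw [Fin.sum_univ_eq_sum_range (fun x => base h x * F x),
    Fin.sum_univ_eq_sum_range (fun i => F (2 * i) + F (2 * i + 1)), ← key, Finset.mul_sum,
    ← Finset.sum_subset (Finset.range_subset_range.2 hn)]
  · refine Finset.sum_congr rfl fun x hx => ?_
    rw [base, if_pos (Finset.mem_range.1 hx)]
  · intro x _ hx
    rw [base, if_neg (fun h => hx (Finset.mem_range.2 h)), zero_mul]

theorem sum_base {n h : ℕ} (hh : 0 < h) (hn : 2 * h ≤ n) : ∑ x : Fin n, base h x = 1 := by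
  have := sum_base_mul hn fun _ => 1
  simp only [mul_one] at this
  have hh' : (h : ℝ) ≠ 0 := by positivity
  rw [this, Finset.sum_const, Finset.card_univ, Fintype.card_fin, nsmul_eq_mul]
  field_simp
  norm_num

theorem pert_even {h : ℕ} (z : Fin h → Bool) (i : Fin h) : pert z (2 * i) = sign (z i) := by
  have e : 2 * i.1 / 2 = i.1 := by omega
  simp [pert, e]

theorem pert_odd {h : ℕ} (z : Fin h → Bool) (i : Fin h) : pert z (2 * i + 1) = -sign (z i) := by
  have e : (2 * i.1 + 1) / 2 = i.1 := by omega
  simp [pert, e, pow_succ]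

theorem abs_pert {h x : ℕ} (z : Fin h → Bool) (hx : x < 2 * h) : |pert z x| = 1 := by
  have : x / 2 < h := by omega
  rw [pert, dif_pos this, abs_mul, abs_pow, abs_neg, abs_one, one_pow, one_mul]
  cases z ⟨x / 2, this⟩ <;> simp [sign]

theorem one_add_pert_nonneg {h : ℕ} (z : Fin h → Bool) {ε : ℝ} (h0 : 0 ≤ ε) (h1 : ε ≤ 1) (x : ℕ) :
    0 ≤ 1 + ε * pert z x := by
  by_cases hx : x < 2 * h
  · have := neg_le_of_abs_le (abs_pert z hx).le
    nlinarith
  · rw [pert, dif_neg (by omega), mul_zero, add_zero]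
    exact zero_le_one

theorem sum_base_pert {n h : ℕ} (hn : 2 * h ≤ n) (z : Fin h → Bool) :
    ∑ x : Fin n, base h x * pert z x = 0 := by
  rw [sum_base_mul hn]
  simp [pert_even, pert_odd]

theorem sum_base_pert_pert {n h : ℕ} (hn : 2 * h ≤ n) (z z' : Fin h → Bool) :
    ∑ x : Fin n, base h x * (pert z x * pert z' x) =
      1 / h * ∑ i, sign (z i) * sign (z' i) := by
  rw [sum_base_mul hn fun x => pert z x * pert z' x]
  simp only [pert_even, pert_odd, neg_mul_neg, ← two_mul, ← Finset.mul_sum]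
  rw [← mul_assoc, one_div_mul_eq_div, mul_comm (2 : ℝ) (h : ℝ),
      div_mul_cancel_right₀ (by norm_num)]
  ring

/-- The perturbed probabilities. -/
noncomputable def prob {h : ℕ} (ε : ℝ) (z : Fin h → Bool) (x : ℕ) : ℝ :=
  base h x * (1 + ε * pert z x)

theorem sum_prob {n h : ℕ} (hh : 0 < h) (hn : 2 * h ≤ n) (ε : ℝ) (z : Fin h → Bool) :
    ∑ x : Fin n, prob ε z x = 1 := by
  have : ∀ x : Fin n, prob ε z x = base h x + ε * (base h x * pert z x) := fun x => by
    rw [prob]; ring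
  simp only [this, Finset.sum_add_distrib, ← Finset.mul_sum, sum_base hh hn, sum_base_pert hn]
  ring

theorem sampleMean_prod {Ω : Type*} [Fintype Ω] (q g : Ω → ℝ) (m : ℕ) :
    sampleMean q m (fun y => ∏ i, g (y i)) = (∑ x, q x * g x) ^ m := by
  rw [Fintype.sum_pow, sampleMean]
  exact Finset.sum_congr rfl fun y _ => Finset.prod_mul_distrib.symm

/-- The exponential of the sum is a product over independent signs, each of which contributes `2 *
cosh t`. -/
theorem sum_exp_sign {h : ℕ} (t : ℝ) (z : Fin h → Bool) :
    ∑ z' : Fin h → Bool, Real.exp (t * ∑ i, sign (z i) * sign (z' i)) =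
      (2 * Real.cosh t) ^ h := by
  have h1 : ∀ b : Bool, ∑ b' : Bool, Real.exp (t * (sign b * sign b')) = 2 * Real.cosh t := by
    intro b
    rw [Real.cosh_eq]
    cases b <;> simp [sign] <;> ring
  calc _ = ∑ z' : Fin h → Bool, ∏ i, Real.exp (t * (sign (z i) * sign (z' i))) := by
        refine Finset.sum_congr rfl fun z' _ => ?_
        rw [Finset.mul_sum, Real.exp_sum]
    _ = ∏ i : Fin h, ∑ b' : Bool, Real.exp (t * (sign (z i) * sign b')) := by
        rw [Finset.prod_univ_sum, Fintype.piFinset_univ]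
    _ = _ := by simp only [h1, Finset.prod_const, Finset.card_univ, Fintype.card_fin]

/-- The second moment of the averaged likelihood ratio. -/
theorem sum_sampleMean_le {n h m : ℕ} (hh : 0 < h) (hn : 2 * h ≤ n) {ε : ℝ} (h0 : 0 ≤ ε)
    (h1 : ε ≤ 1) :
    ∑ z : Fin h → Bool, ∑ z' : Fin h → Bool, sampleMean (fun x : Fin n => base h x) m
      (fun y => (∏ i, (1 + ε * pert z (y i))) * ∏ i, (1 + ε * pert z' (y i))) ≤
      (2 ^ h) ^ 2 * Real.exp (m ^ 2 * ε ^ 4 / (2 * h)) := by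
  have hh' : (0 : ℝ) < h := by exact_mod_cast hh
  -- Both likelihood ratios are products over the same independent samples, so the mean of their
  -- product is the m-th power of 1 + (ε²/h)·Σ z_i z'_i.
  have hE : ∀ z z' : Fin h → Bool, sampleMean (fun x : Fin n => base h x) m
      (fun y => (∏ i, (1 + ε * pert z (y i))) * ∏ i, (1 + ε * pert z' (y i))) ≤
      Real.exp (m * ε ^ 2 / h * ∑ i, sign (z i) * sign (z' i)) := by
    intro z z'
    simp only [← Finset.prod_mul_distrib]
    rw [sampleMean_prod _ fun x : Fin n => (1 + ε * pert z x) * (1 + ε * pert z' x)]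
    have e : ∑ x : Fin n, base h x * ((1 + ε * pert z x) * (1 + ε * pert z' x)) =
        ε ^ 2 / h * (∑ i, sign (z i) * sign (z' i)) + 1 := by
      have : ∀ x : Fin n, base h x * ((1 + ε * pert z x) * (1 + ε * pert z' x)) =
          base h x + ε * (base h x * pert z x) + ε * (base h x * pert z' x) +
            ε ^ 2 * (base h x * (pert z x * pert z' x)) := fun x => by ring
      simp only [this, Finset.sum_add_distrib, ← Finset.mul_sum, sum_base hh hn,
        sum_base_pert hn, sum_base_pert_pert hn]
      ring
    have hpos : 0 ≤ ∑ x : Fin n, base h x * ((1 + ε * pert z x) * (1 + ε * pert z' x)) :=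
      Finset.sum_nonneg fun x _ => mul_nonneg (base_nonneg _ _)
        (mul_nonneg (one_add_pert_nonneg z h0 h1 x) (one_add_pert_nonneg z' h0 h1 x))
    calc _ ≤ Real.exp (ε ^ 2 / h * ∑ i, sign (z i) * sign (z' i)) ^ m := by
          refine pow_le_pow_left₀ hpos ?_ m
          rw [e]
          exact Real.add_one_le_exp _
      _ = _ := by
          rw [← Real.exp_nat_mul]
          congr 1
          ring
  calc _ ≤ ∑ z : Fin h → Bool, ∑ z' : Fin h → Bool,
        Real.exp (m * ε ^ 2 / h * ∑ i, sign (z i) * sign (z' i)) :=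
        Finset.sum_le_sum fun z _ => Finset.sum_le_sum fun z' _ => hE z z'
    _ = (2 ^ h) ^ 2 * Real.cosh (m * ε ^ 2 / h) ^ h := by
        simp only [sum_exp_sign, Finset.sum_const, Finset.card_univ, Fintype.card_fun,
          Fintype.card_bool, Fintype.card_fin, nsmul_eq_mul, mul_pow]
        push_cast
        ring
    _ ≤ (2 ^ h) ^ 2 * Real.exp ((m * ε ^ 2 / h) ^ 2 / 2) ^ h := by
        gcongr
        exact Real.cosh_le_exp_half_sq _
    _ = _ := by
        rw [← Real.exp_nat_mul]
        congr 2
        field_simp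

/-- If a test separates the uniform distribution from all perturbations, the second moment of the
averaged likelihood ratio is large. -/
theorem le_exp_of_separates {n h m : ℕ} (hh : 0 < h) (hn : 2 * h ≤ n) {ε : ℝ} (h0 : 0 ≤ ε)
    (h1 : ε ≤ 1) {f : (Fin m → Fin n) → ℝ} (hf : ∀ y, f y ∈ Set.Icc (0 : ℝ) 1)
    (hp : 2 / 3 ≤ sampleMean (fun x : Fin n => base h x) m f)
    (hq : ∀ z : Fin h → Bool, sampleMean (fun x : Fin n => prob ε z x) m f ≤ 1 / 3) :
    1 + 1 / 9 ≤ Real.exp (m ^ 2 * ε ^ 4 / (2 * h)) := by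
  set L : (Fin h → Bool) → (Fin m → Fin n) → ℝ := fun z y => ∏ i, (1 + ε * pert z (y i)) with hL
  set μ : ((Fin m → Fin n) → ℝ) → ℝ := sampleMean (fun x : Fin n => base h x) m with hμ
  have hb0 : ∀ x : Fin n, 0 ≤ base h x := fun x => base_nonneg _ _
  have hLf : ∀ z, μ (fun y => L z y * f y) ≤ 1 / 3 := by
    intro z
    refine le_trans (le_of_eq ?_) (hq z)
    simp only [hμ, hL, sampleMean, prob, Finset.prod_mul_distrib, mul_assoc]
  have hL1 : ∀ z, μ (L z) = 1 := by
    intro z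
    rw [hμ, hL, sampleMean_prod _ fun x : Fin n => 1 + ε * pert z x]
    exact (congrArg (· ^ m) (sum_prob hh hn ε z)).trans (one_pow m)
  set K : ℝ := 2 ^ h with hK
  have hK0 : 0 < K := by positivity
  have hcard : ((Finset.univ : Finset (Fin h → Bool)).card : ℝ) = K := by
    simp [hK]
  -- `G` is `K` times one minus the averaged likelihood ratio. The test forces the mean of `G * f`
  -- to be at least `K / 3`, and Cauchy–Schwarz with `f ≤ 1` makes the second moment of `G` at least
  -- K²/9.
  set G : (Fin m → Fin n) → ℝ := fun y => K - ∑ z, L z y with hG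
  have hadd : ∀ F F' : (Fin m → Fin n) → ℝ, μ (fun y => F y + F' y) = μ F + μ F' :=
    sampleMean_add _ _
  have hmulc : ∀ (c : ℝ) (F : (Fin m → Fin n) → ℝ), μ (fun y => c * F y) = c * μ F :=
    sampleMean_const_mul _ _
  have hsum : ∀ F : (Fin h → Bool) → (Fin m → Fin n) → ℝ, μ (fun y => ∑ z, F z y) =
    ∑ z, μ (F z) := fun F => sampleMean_sum _ _ _ F
  have hGf : K / 3 ≤ μ (fun y => G y * f y) := by
    have e : (fun y => G y * f y) = fun y => K * f y + (-1) * ∑ z, L z y * f y := by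
      funext y
      rw [hG, ← Finset.sum_mul]
      ring
    rw [e, hadd, hmulc, hmulc, hsum]
    have h2 : ∑ z, μ (fun y => L z y * f y) ≤ K * (1 / 3) := by
      refine (Finset.sum_le_card_nsmul _ _ _ fun z _ => hLf z).trans ?_
      rw [nsmul_eq_mul, hcard]
    have h3 : K * (2 / 3) ≤ K * μ f := mul_le_mul_of_nonneg_left hp hK0.le
    linarith
  have hcs : μ (fun y => G y * f y) ^ 2 ≤ μ (fun y => G y ^ 2) := by
    have hw : ∀ y ∈ (Finset.univ : Finset (Fin m → Fin n)), 0 ≤ ∏ i, base h (y i) :=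
      fun y _ => Finset.prod_nonneg fun i _ => hb0 _
    have h2 := sum_mul_sq_le Finset.univ hw G f
    have h3 : μ (fun y => f y ^ 2) ≤ 1 := by
      rw [← sampleMean_const (q := fun x : Fin n => base h x) (sum_base hh hn) m 1]
      exact sampleMean_mono hb0 fun y => pow_le_one₀ (hf y).1 (hf y).2
    have h4 : 0 ≤ μ (fun y => G y ^ 2) :=
      Finset.sum_nonneg fun y hy => mul_nonneg (hw y hy) (sq_nonneg _)
    exact h2.trans (mul_le_of_le_one_right h4 h3)
  have hG2 : μ (fun y => G y ^ 2) = ∑ z, ∑ z', μ (fun y => L z y * L z' y) - K ^ 2 := by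
    have e : (fun y => G y ^ 2) = fun y => (K ^ 2 + (-2 * K) * ∑ z, L z y) +
        ∑ z, ∑ z', L z y * L z' y := by
      funext y
      rw [hG, ← Finset.sum_mul_sum]
      ring
    rw [e, hadd, hadd, hmulc, hsum, hsum, hμ, sampleMean_const (sum_base hh hn), ← hμ]
    simp only [hL1, hsum, Finset.sum_const, nsmul_eq_mul, hcard]
    ring
  have hsec := sum_sampleMean_le (m := m) hh hn h0 h1
  have h5 : (K / 3) ^ 2 ≤ μ (fun y => G y * f y) ^ 2 := pow_le_pow_left₀ (by positivity) hGf 2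
  have h6 : K ^ 2 * (1 + 1 / 9) ≤ K ^ 2 * Real.exp (m ^ 2 * ε ^ 4 / (2 * h)) := by
    have h7 : ∑ z, ∑ z', μ (fun y => L z y * L z' y) ≤
      K ^ 2 * Real.exp (m ^ 2 * ε ^ 4 / (2 * h)) := hsec
    linarith
  exact le_of_mul_le_mul_left h6 (by positivity)

/-- Testing identity to the uniform distribution on about `k` elements takes many samples. -/
theorem exists_hard {n k : ℕ} (hk : 2 ≤ k) (hkn : k ≤ n) : ∃ p : PMF (Fin n),
    ∀ ε : ℝ, 0 < ε → ε ≤ 1 → ∀ (m : ℕ) (f : (Fin m → Fin n) → ℝ),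
      IsTester k ε p m f → 1 / 10 * √(k : ℝ) / ε ^ 2 ≤ m := by
  -- `2 * h ≤ k` keeps the perturbation within the first `k` elements, and `k ≤ 3 * h` because `2 ≤
  -- k`.
  obtain ⟨h, hh⟩ : ∃ h, h = k / 2 := ⟨_, rfl⟩
  have hh0 : 0 < h := by omega
  have hn : 2 * h ≤ n := by omega
  have hb1 := sum_base hh0 hn
  refine ⟨pmfOfReal (fun x => base h x) (fun x => base_nonneg _ _) hb1, ?_⟩
  intro ε hε0 hε1 m f hf
  have hq0 : ∀ (z : Fin h → Bool) (x : Fin n), 0 ≤ prob ε z x := fun z x =>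
    mul_nonneg (base_nonneg _ _) (one_add_pert_nonneg z hε0.le hε1 x)
  have hp := hf.complete
  rw [integral_pi_eq_sampleMean] at hp
  simp only [pmfOfReal_toReal] at hp
  have hq : ∀ z : Fin h → Bool, sampleMean (fun x : Fin n => prob ε z x) m f ≤ 1 / 3 := by
    intro z
    have hfar : ε ≤ akDist k (pmfOfReal (fun x => prob ε z x) (hq0 z) (sum_prob hh0 hn ε z))
        (pmfOfReal (fun x => base h x) (fun x => base_nonneg _ _) hb1) := by
      refine le_trans (le_of_eq ?_) (le_akDist (by omega) hkn _ _ fun x hx => ?_)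
      · simp only [pmfOfReal_toReal]
        have : ∀ x : Fin n, |prob ε z x - base h x| = ε * base h x := by
          intro x
          have e : prob ε z x - base h x = ε * base h x * pert z x := by
            rw [prob]; ring
          rw [e, abs_mul, abs_of_nonneg (mul_nonneg hε0.le (base_nonneg _ _))]
          by_cases hx : x.1 < 2 * h
          · rw [abs_pert z hx, mul_one]
          · rw [base, if_neg hx, mul_zero, zero_mul]
        simp only [this, ← Finset.mul_sum, hb1, mul_one]
      · rw [pmfOfReal_toReal, pmfOfReal_toReal, prob, base, if_neg (by omega), zero_mul]
    have hs := hf.sound _ hfar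
    rw [integral_pi_eq_sampleMean] at hs
    simp only [pmfOfReal_toReal] at hs
    have e : sampleMean (fun x : Fin n => prob ε z x) m (fun y => 1 - f y) =
        1 - sampleMean (fun x : Fin n => prob ε z x) m f := by
      have h2 := sampleMean_add (fun x : Fin n => prob ε z x) m (fun _ => 1)
        (fun y => (-1) * f y)
      rw [sampleMean_const (sum_prob hh0 hn ε z), sampleMean_const_mul] at h2
      simp only [sub_eq_add_neg, ← neg_one_mul (f _)]
      rw [h2]
      ring
    linarith
  have hmain := le_exp_of_separates hh0 hn hε0.le hε1 hf.mem_Icc hp hq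
  by_contra! hlt
  have hk' : (0 : ℝ) ≤ k := by positivity
  have hh' : (0 : ℝ) < h := by exact_mod_cast hh0
  rw [lt_div_iff₀ (by positivity)] at hlt
  have h2 : (m * ε ^ 2) ^ 2 ≤ (1 / 10 * √(k : ℝ)) ^ 2 := pow_le_pow_left₀ (by positivity) hlt.le 2
  rw [mul_pow, mul_pow, Real.sq_sqrt hk'] at h2
  have h3 : (k : ℝ) ≤ 3 * h := by exact_mod_cast (show k ≤ 3 * h by omega)
  -- With fewer samples the exponent is at most (k/100)/(2h) ≤ 3/200, but exp(3/200) is below 10/9.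
  have h4 : (m : ℝ) ^ 2 * ε ^ 4 / (2 * h) ≤ 3 / 200 := by
    rw [div_le_iff₀ (by positivity)]
    have e : (m : ℝ) ^ 2 * ε ^ 4 = (m : ℝ) ^ 2 * (ε ^ 2) ^ 2 := by ring
    rw [e]
    linarith
  have h5 : Real.exp ((m : ℝ) ^ 2 * ε ^ 4 / (2 * h)) ≤ Real.exp (3 / 200) := Real.exp_le_exp.2 h4
  have h6 := Real.add_one_le_exp (-(3 / 200) : ℝ)
  have h7 : Real.exp (3 / 200) * Real.exp (-(3 / 200)) = 1 := by
    rw [← Real.exp_add, add_neg_cancel, Real.exp_zero]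
  nlinarith [Real.exp_pos (3 / 200)]

end LowerBound

/-- Identity testing in `𝒜_k`-distance: one polynomial-time tester with `O(√k / ε²)` samples for all
inputs, and the lower bound `Ω(√k / ε²)` for all testers. -/
theorem theorem1 :
    (∃ (A : Com) (C c : ℝ) (P : Polynomial ℕ), 0 < c ∧
      ∀ n k : ℕ, 2 ≤ k → k ≤ n → ∀ ε : ℝ, 0 < ε → ∀ p : PMF (Fin n),
      ∀ (a b N : ℕ) (α : Fin n → ℕ),
        Describes (c * ε ^ 2 / (n * √(k : ℝ))) ε p a b N α →
        RunsWithin n A (testerInput k a b N α)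
          (P.eval (bitLength (testerInput k a b N α) + ⌈1 / ε⌉₊)) (C * √(k : ℝ) / ε ^ 2) ∧
        2 / 3 ≤ (runLaw p).real {ω | SaysYes A (testerInput k a b N α) ω.1 ω.2} ∧
        ∀ q : PMF (Fin n), ε ≤ akDist k q p →
          2 / 3 ≤ (runLaw q).real {ω | SaysNo A (testerInput k a b N α) ω.1 ω.2}) ∧
    (∃ c : ℝ, 0 < c ∧
      ∀ n k : ℕ, 2 ≤ k → k ≤ n → ∃ p : PMF (Fin n),
      ∀ ε : ℝ, 0 < ε → ε ≤ 1 → ∀ (m : ℕ) (f : (Fin m → Fin n) → ℝ),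
        IsTester k ε p m f → c * √(k : ℝ) / ε ^ 2 ≤ m) := by
  refine ⟨⟨tester, 10 ^ 9, 1 / 10 ^ 6, Params.timePoly, by norm_num,
    fun n k hk hkn ε hε p a b N α h => ?_⟩,
    1 / 10, by norm_num, fun n k hk hkn => LowerBound.exists_hard hk hkn⟩
  exact tester_spec n k hk hkn ε hε p a b N α h
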